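/- Let $3\le d\le 5$, $\mu_1>0$, $\mu\ge 0$, $\lambda\in\{1,-1\}$, and put $p_1:=1+\frac{4}{d-2}$. Let $\nu:=\frac12\sqrt{1-4\mu}$ if $\mu\le\frac14$ and $\nu:=\frac i2\sqrt{4\mu-1}$ if $\mu>\frac14$. Consider the equation $$\partial_t^2v-\Delta v+\frac{\mu}{(1+t)^2}v=\frac{\lambda}{(1+t)^{2\mu_1/(d-2)}}|v|^{\frac4{d-2}}v\ \text{ on } (0,\infty)\times\mathbb R^d,\qquad (v(0),\partial_tv(0))=(v_0,v_1)\in H^1(\mathbb R^d)\times L^2(\mathbb R^d).\tag{NLKG}$$ Notation. Let $J_\nu,Y_\nu$ be the Bessel functions of the first and second kind, $e_+(t,\xi)=((1+t)|\xi|)^{1/2}J_\nu((1+t)|\xi|)$, $e_-(t,\xi)=((1+t)|\xi|)^{1/2}Y_\nu((1+t)|\xi|)$, let a dot denote the time derivative, and let $$E_0(t,t_0,\xi)=\frac{e_+(t,\xi)\dot e_-(t_0,\xi)-\dot e_+(t_0,\xi)e_-(t,\xi)}{e_+(t_0,\xi)\dot e_-(t_0,\xi)-\dot e_+(t_0,\xi)e_-(t_0,\xi)},\qquad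 E_1(t,t_0,\xi)=\frac{e_+(t_0,\xi)e_-(t,\xi)-e_+(t,\xi)e_-(t_0,\xi)}{e_+(t_0,\xi)\dot e_-(t_0,\xi)-\dot e_+(t_0,\xi)e_-(t_0,\xi)}.$$ Let $\mathcal E_j(t,t_0)$ be the Fourier multiplier with symbol $E_j(t,t_0,\cdot)$; these are the propagators of the linear equation ($\lambda=0$). A global solution of (NLKG) is a (complex-valued) $v\in C([0,\infty);H^1)\cap L^{p_1}([0,\infty);L^{2p_1})$ with $(v(0),\partial_tv(0))=(v_0,v_1)$ and, for all $t\ge0$, $$v(t)=\mathcal E_0(t,0)v_0+\mathcal E_1(t,0)v_1+\int_0^t\mathcal E_1(t,s)\frac{\lambda}{(1+s)^{2\mu_1/(d-2)}}|v(s)|^{\frac4{d-2}}v(s)\,ds .$$ Let $\dot H^1(\mathbb R^d)$ be the space of tempered distributions $u$ with $\widehat u\in L^1_{\rm loc}$ and $\|u\|_{\dot H^1}=\||\xi|\widehat u\|_{L^2}<\infty$, and let $$\mathcal W(t)=\begin{pmatrix}\cos(t|\nabla|)&|\nabla|^{-1}\sin(t|\nabla|)\\-|\nabla|\sin(t|\nabla|)&\cos(t|\nabla|)\end{pmatrix}$$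 be the solution map of the free wave equation. Theorem. Let $v$ be a global solution of (NLKG), so that in particular $\|v\|_{L^{p_1}([0,\infty);L^{2p_1})}<\infty$. Then $o_t(1):=\|v\|_{L^{p_1}([t,\infty);L^{2p_1})}\to0$ as $t\to\infty$, $v$ is differentiable on $[0,\infty)$ as an $L^2$-valued function (one-sided at $t=0$), and, with $\overrightarrow v(t)=(v(t),\partial_tv(t))$, there is $\overrightarrow{v_+}\in\dot H^1\times L^2$ (real-valued if $v$ is real-valued) such that for all $t\ge0$ $$\big\|\overrightarrow v(t)-\mathcal W(t)\overrightarrow{v_+}\big\|_{\dot H^1\times L^2}\le C\begin{cases}\mu(1+t)^{\max\{-\frac12+\mathrm{Re}\,\nu,\,-\frac{2\mu_1}{d-2}\}}+(1+t)^{-\frac{2\mu_1}{d-2}}o_t(1),&\mu\ne\frac14,\\[4pt]\mu(1+t)^{\max\{-\frac12,\,-\frac{2\mu_1}{d-2}\}}(1+\log(1+t))+(1+t)^{-\frac{2\mu_1}{d-2}}o_t(1),&\mu=\frac14.\end{cases}$$ The constant $C$ depends only on $d,\mu_1,\mu$ and an upper bound for $\|v_0\|_{H^1}+\|v_1\|_{L^2}+\|v\|_{L^{p_1}([0,\infty);L^{2p_1})}$;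 it does not depend on $t$. -/

import Mathlib

open MeasureTheory Filter Topology Set
open scoped SchwartzMap FourierTransform ENNReal NNReal

noncomputable section

namespace NLKG

/-! ### Function spaces on `ℝᵈ` -/

/-- Euclidean space `ℝᵈ`. -/
abbrev Space (d : ℕ) : Type := EuclideanSpace ℝ (Fin d)

/-- The complex Hilbert space `L²(ℝᵈ)`. -/
abbrev L2 (d : ℕ) : Type := Lp ℂ 2 (volume : Measure (Space d))

/-- The frequency variable `|ξ|` of the symbol of `|∇|`. Mathlib's Fourier transform has the kernel
`exp (-2 π i x·ξ)`, so that the symbol of `|∇|` is `2 π ‖ξ‖`. -/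
def freq {d : ℕ} (ξ : Space d) : ℝ := 2 * Real.pi * ‖ξ‖

/-- The inverse Fourier transform of a square integrable function `g`, as an element of `L²`
(and `0` if `g` is not square integrable). -/
def l2OfFourier {d : ℕ} (g : Space d → ℂ) : L2 d :=
  open Classical in if h : MemLp g 2 (volume : Measure (Space d)) then 𝓕⁻ (h.toLp g) else 0

/-- The Fourier multiplier `m(|∇|) = 𝓕⁻¹ m(|ξ|) 𝓕` on `L²(ℝᵈ)`. -/
def multiplier {d : ℕ} (m : ℝ → ℂ) (f : L2 d) : L2 d :=
  l2OfFourier fun ξ => m (freq ξ) * (𝓕 f : L2 d) ξ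

/-- The `H¹(ℝᵈ)` norm `‖(1 + |ξ|²)^{1/2} 𝓕f‖_{L²}`, which is finite exactly for `f ∈ H¹`. -/
def h1Norm {d : ℕ} (f : L2 d) : ℝ≥0∞ :=
  eLpNorm (fun ξ : Space d => ((Real.sqrt (1 + freq ξ ^ 2) : ℝ) : ℂ) * (𝓕 f : L2 d) ξ) 2 volume

/-- The Fourier transform of the tempered distribution `u` is the locally integrable
function `g`. -/
def HasFourierFunction {d : ℕ} (u : 𝓢'(Space d, ℂ)) (g : Space d → ℂ) : Prop :=
  LocallyIntegrable g volume ∧ ∀ χ : 𝓢(Space d, ℂ), (𝓕 u) χ = ∫ ξ, χ ξ * g ξ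

/-- The Fourier transform of `u` as a function (unique up to null sets when it exists). -/
def fourierFunction {d : ℕ} (u : 𝓢'(Space d, ℂ)) : Space d → ℂ :=
  open Classical in if h : ∃ g, HasFourierFunction u g then h.choose else 0

/-- The (unique) tempered distribution with Fourier transform `g`. -/
def distOfFourier {d : ℕ} (g : Space d → ℂ) : 𝓢'(Space d, ℂ) :=
  open Classical in if h : ∃ u, HasFourierFunction u g then h.choose else 0

/-- The homogeneous Sobolev norm `‖ |ξ| 𝓕u ‖_{L²}`; it is infinite if `𝓕u` is not a locally
integrable function. -/
def hdotNorm {d : ℕ} (u : 𝓢'(Space d, ℂ)) : ℝ≥0∞ :=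
  open Classical in
  if ∃ g, HasFourierFunction u g then
    eLpNorm (fun ξ : Space d => (freq ξ : ℂ) * fourierFunction u ξ) 2 volume
  else ⊤

/-- The homogeneous Sobolev space `Ḣ¹(ℝᵈ)`: the tempered distributions `u` whose Fourier transform
is a locally integrable function with `|ξ| 𝓕u ∈ L²`. -/
def MemHdot {d : ℕ} (u : 𝓢'(Space d, ℂ)) : Prop := hdotNorm u < ⊤

/-- The norm of `Ḣ¹(ℝᵈ) × L²(ℝᵈ)`. -/
def energyNorm {d : ℕ} (w : 𝓢'(Space d, ℂ) × L2 d) : ℝ≥0∞ :=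
  (hdotNorm w.1 ^ 2 + ‖w.2‖ₑ ^ 2) ^ (1 / 2 : ℝ)

/-- `f ∈ L²` is real-valued. -/
def IsRealL2 {d : ℕ} (f : L2 d) : Prop := ∀ᵐ x ∂(volume : Measure (Space d)), (f x).im = 0

/-- The tempered distribution `u` is real. -/
def IsRealDist {d : ℕ} (u : 𝓢'(Space d, ℂ)) : Prop :=
  ∀ χ : 𝓢(Space d, ℂ), (∀ x, (χ x).im = 0) → (u χ).im = 0

/-! ### The free wave equation -/

/-- The solution map `W(t)` of the free wave equation on `Ḣ¹ × L²`:
`W(t)(u₀, u₁) = (cos(t|∇|) u₀ + |∇|⁻¹ sin(t|∇|) u₁, -|∇| sin(t|∇|) u₀ + cos(t|∇|) u₁)`. -/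
def freeWave {d : ℕ} (t : ℝ) (w : 𝓢'(Space d, ℂ) × L2 d) : 𝓢'(Space d, ℂ) × L2 d :=
  (distOfFourier fun ξ =>
      (Real.cos (t * freq ξ) : ℂ) * fourierFunction w.1 ξ
        + ((Real.sin (t * freq ξ) / freq ξ : ℝ) : ℂ) * (𝓕 w.2 : L2 d) ξ,
    l2OfFourier fun ξ =>
      ((-(freq ξ * Real.sin (t * freq ξ)) : ℝ) : ℂ) * fourierFunction w.1 ξ
        + (Real.cos (t * freq ξ) : ℂ) * (𝓕 w.2 : L2 d) ξ)

/-! ### The propagator of the Klein-Gordon equation with scale-invariant mass -/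

/-- The Bessel function `J_ν(τ)`, `τ > 0`, of the first kind of complex order `ν`. (Mathlib's
`Complex.Gamma` vanishes at the poles of `Γ`, and `x / 0 = 0`, so the corresponding terms are `0`,
as usual.) -/
def besselJ (ν : ℂ) (τ : ℝ) : ℂ :=
  ∑' k : ℕ, ((-1) ^ k / ((k.factorial : ℂ) * Complex.Gamma (ν + k + 1)))
    * ((τ / 2 : ℝ) : ℂ) ^ (ν + 2 * (k : ℂ))

/-- The quotient that defines the Bessel function of the second kind for non-integer order. -/
def besselYAux (ν : ℂ) (τ : ℝ) : ℂ :=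
  (besselJ ν τ * Complex.cos (ν * Real.pi) - besselJ (-ν) τ) / Complex.sin (ν * Real.pi)

/-- The Bessel function `Y_ν(τ)`, `τ > 0`, of the second kind of complex order `ν`; for integer
order it is the limit of `Y_z(τ)` as `z → ν`. -/
def besselY (ν : ℂ) (τ : ℝ) : ℂ :=
  open Classical in
  if ∃ n : ℤ, ν = n then limUnder (𝓝[≠] ν) (fun z => besselYAux z τ) else besselYAux ν τ

/-- `ν = √(1-4μ)/2` for `μ ≤ 1/4`, and `ν = i √(4μ-1)/2` for `μ > 1/4`. -/
def order (μ : ℝ) : ℂ :=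
  if μ ≤ 1 / 4 then ((Real.sqrt (1 - 4 * μ) / 2 : ℝ) : ℂ)
  else Complex.I * ((Real.sqrt (4 * μ - 1) / 2 : ℝ) : ℂ)

/-- The fundamental solution `e₊(t, ξ)`, as a function of `t` and `r = |ξ|`. -/
def ePlus (μ t r : ℝ) : ℂ :=
  (Real.sqrt ((1 + t) * r) : ℂ) * besselJ (order μ) ((1 + t) * r)

/-- The fundamental solution `e₋(t, ξ)`, as a function of `t` and `r = |ξ|`. -/
def eMinus (μ t r : ℝ) : ℂ :=
  (Real.sqrt ((1 + t) * r) : ℂ) * besselY (order μ) ((1 + t) * r)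

/-- Time derivative of `e₊`. -/
def ePlusDot (μ t r : ℝ) : ℂ := deriv (fun s : ℝ => ePlus μ s r) t

/-- Time derivative of `e₋`. -/
def eMinusDot (μ t r : ℝ) : ℂ := deriv (fun s : ℝ => eMinus μ s r) t

/-- The Wronskian of `e₊` and `e₋`. -/
def wronskian (μ t r : ℝ) : ℂ :=
  ePlus μ t r * eMinusDot μ t r - ePlusDot μ t r * eMinus μ t r

/-- The symbol `E₀(t, t₀, ξ)` as a function of `r = |ξ|`. -/
def symbolE0 (μ t t₀ r : ℝ) : ℂ :=
  (ePlus μ t r * eMinusDot μ t₀ r - ePlusDot μ t₀ r * eMinus μ t r) / wronskian μ t₀ r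

/-- The symbol `E₁(t, t₀, ξ)` as a function of `r = |ξ|`. -/
def symbolE1 (μ t t₀ r : ℝ) : ℂ :=
  (ePlus μ t₀ r * eMinus μ t r - ePlus μ t r * eMinus μ t₀ r) / wronskian μ t₀ r

/-- The operator `𝓔₀(t, t₀)`. -/
def propE0 {d : ℕ} (μ t t₀ : ℝ) (f : L2 d) : L2 d := multiplier (symbolE0 μ t t₀) f

/-- The operator `𝓔₁(t, t₀)`. -/
def propE1 {d : ℕ} (μ t t₀ : ℝ) (f : L2 d) : L2 d := multiplier (symbolE1 μ t t₀) f

/-! ### The nonlinear equation -/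

/-- The energy-critical power `p₁ = 1 + 4/(d-2)`. -/
def p1 (d : ℕ) : ℝ := 1 + 4 / ((d : ℝ) - 2)

/-- The decay exponent `2μ₁/(d-2) = (μ₁/2)(p₁-1)` of the coefficient of the nonlinearity. -/
def decayExp (d : ℕ) (μ₁ : ℝ) : ℝ := 2 * μ₁ / ((d : ℝ) - 2)

/-- The function `|f|^{4/(d-2)} f`. -/
def powerFun {d : ℕ} (f : L2 d) : Space d → ℂ :=
  fun x => ((‖f x‖ ^ (4 / ((d : ℝ) - 2)) : ℝ) : ℂ) * f x

/-- `|f|^{4/(d-2)} f` as an element of `L²`; it is one whenever `f ∈ L^{2p₁}` (otherwise the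
value is `0`). -/
def power {d : ℕ} (f : L2 d) : L2 d :=
  open Classical in
  if h : MemLp (powerFun f) 2 (volume : Measure (Space d)) then h.toLp (powerFun f) else 0

/-- The norm `‖v‖_{L^{p₁}(J : L^{2p₁}(ℝᵈ))}`. -/
def stNorm {d : ℕ} (v : ℝ → L2 d) (J : Set ℝ) : ℝ≥0∞ :=
  (∫⁻ t in J, eLpNorm (v t) (ENNReal.ofReal (2 * p1 d)) volume ^ p1 d) ^ (1 / p1 d)

/-- The interval `[0, T)`, `T ∈ (0, ∞]`. -/
def timeInterval (T : ℝ≥0∞) : Set ℝ := {t | 0 ≤ t ∧ ENNReal.ofReal t < T}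

/-- `v` is a solution of
`∂ₜ²v - Δv + μ(1+t)⁻² v = λ(1+t)^{-2μ₁/(d-2)} |v|^{4/(d-2)} v`, `(v(0), ∂ₜv(0)) = (v₀, v₁)`,
on `[0, T)`, where `v₀ ∈ H¹` and `v₁ ∈ L²`; `∂ₜv` is the derivative of `v` as an
`L²`-valued function. -/
structure IsSolution {d : ℕ} (μ₁ μ lam : ℝ) (T : ℝ≥0∞) (v₀ v₁ : L2 d) (v : ℝ → L2 d) : Prop where
  data : h1Norm v₀ < ⊤
  mem_h1 : ∀ t ∈ timeInterval T, h1Norm (v t) < ⊤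
  continuous_h1 : ∀ t ∈ timeInterval T,
    Tendsto (fun s => h1Norm (v s - v t)) (𝓝[timeInterval T] t) (𝓝 0)
  strichartz : stNorm v (timeInterval T) < ⊤
  initial : v 0 = v₀
  initial_deriv : HasDerivWithinAt v v₁ (timeInterval T) 0
  duhamel : ∀ t ∈ timeInterval T,
    v t = propE0 μ t 0 v₀ + propE1 μ t 0 v₁
      + ∫ s in (0 : ℝ)..t,
          propE1 μ t s ((lam * (1 + s) ^ (-decayExp d μ₁)) • power (v s))

end NLKG

end

/-!
The proof compares the solution with the free wave equation on the Fourier side, treating both the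
nonlinearity and the mass term `μ (1 + t)⁻² v` as a forcing. If `F` denotes this forcing, then
`(|∇|v, ∂ₜv)` is the rotation by the angle `t|ξ|` of
`(|∇|v₀ - ∫₀ᵗ sin(s|∇|) F(s) ds, v₁ + ∫₀ᵗ cos(s|∇|) F(s) ds)`. When `F ∈ L¹([0, ∞); L²)` the two
integrals converge, their limits define the asymptotic state, and the error in the energy norm at
time `t` is at most a constant times `∫_t^∞ ‖F(s)‖ ds` (`norm_state_sub_le`).

For the nonlinearity this tail is at most `(1 + t)^{-α} ‖v‖_{L^{p₁}([t, ∞); L^{2p₁})}^{p₁}`, where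
`α = 2μ₁/(d-2)` (`integrable_power`). For the mass term one needs the growth of `‖v(t)‖_{L²}`, which
is at most that of `(1 + t)^γ` with `γ = max(1/2 + Re ν, 1 - α)`, up to a logarithm when `μ = 1/4`
(`exists_growth_bound`); integrating `(1 + s)^{γ - 2}` over `[t, ∞)` gives the rate
`γ - 1 = max(-1/2 + Re ν, -α)` (`exists_tail_bound`, `exists_forcing_bound`).

The growth bound rests on bounds for the symbols of the propagator that are uniform in the frequency
`r` (`exists_symbol_bound`). No asymptotics of Bessel functions is used for them: the symbols are the
solutions of `y'' + (r² + μ (1 + t)⁻²) y = 0` with the standard initial data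
(`exists_symbol_derivatives`), and a weighted energy of such a solution is monotone in time
(`mode_energy_antitone`). The Bessel functions enter only through their differential equation and
the value of the Wronskian, obtained from their power series; at order zero, which occurs for
`μ = 1/4`, the second solution is the limit in the order and carries a logarithm
(`besselY_zero`).

The passage from the Duhamel formula of the Klein-Gordon propagator to that of the wave propagator is
`wave_duhamel`. Elements of `Ḣ¹` are recovered from their Fourier transforms because in dimension at
least three `|ξ| g ∈ L²` forces `g ∈ L¹ + L²` (`EnergyFunction.exists_split`). Reality of the
asymptotic state is Hermitian symmetry of its Fourier transform, which every step preserves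
(`IsSolution.hermL_asym`).
-/

noncomputable section

namespace NLKG

/-! ### Power series with factorially decaying coefficients -/

/-- The coefficients `c k` are `O(Bᵏ / k!)`. -/
def ExpType (c : ℕ → ℂ) : Prop :=
  ∃ K B : ℝ, 0 ≤ K ∧ 0 ≤ B ∧ ∀ k, ‖c k‖ ≤ K * B ^ k / (k.factorial : ℝ)

/-- The sum of the power series with coefficients `c`. -/
def entireSum (c : ℕ → ℂ) (z : ℂ) : ℂ := ∑' k, c k * z ^ k

/-- The coefficients of the derivative of `entireSum c`. -/
def derivCoeff (c : ℕ → ℂ) : ℕ → ℂ := fun k => (k + 1) * c (k + 1)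

lemma ExpType.derivCoeff {c : ℕ → ℂ} (hc : ExpType c) : ExpType (derivCoeff c) := by
  obtain ⟨K, B, hK, hB, h⟩ := hc
  refine ⟨K * B, B, by positivity, hB, fun k => ?_⟩
  have h1 := h (k + 1)
  have h2 : ‖((k : ℂ) + 1)‖ = (k + 1 : ℝ) := by
    have := Complex.norm_natCast (k + 1)
    push_cast at this; exact this
  have hf : (0 : ℝ) < (k.factorial : ℝ) := by positivity
  rw [NLKG.derivCoeff, norm_mul, h2]
  calc ((k : ℝ) + 1) * ‖c (k + 1)‖ ≤ ((k : ℝ) + 1) * (K * B ^ (k + 1) / ((k + 1).factorial : ℝ)) := by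
        gcongr
    _ = K * B * B ^ k / (k.factorial : ℝ) := by
        rw [Nat.factorial_succ]; push_cast; field_simp; ring

lemma ExpType.exists_summable_bound {c : ℕ → ℂ} (hc : ExpType c) (R : ℝ) :
    ∃ u : ℕ → ℝ, Summable u ∧ ∀ k z, ‖z‖ ≤ R → ‖c k * z ^ k‖ ≤ u k := by
  obtain ⟨K, B, hK, hB, h⟩ := hc
  refine ⟨fun k => K * ((B * R) ^ k / (k.factorial : ℝ)),
    (Real.summable_pow_div_factorial (B * R)).mul_left K, fun k z hz => ?_⟩
  rw [norm_mul, norm_pow]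
  calc ‖c k‖ * ‖z‖ ^ k ≤ (K * B ^ k / (k.factorial : ℝ)) * R ^ k := by
        gcongr
        exact h k
    _ = K * ((B * R) ^ k / (k.factorial : ℝ)) := by rw [mul_pow]; ring

lemma ExpType.summable {c : ℕ → ℂ} (hc : ExpType c) (z : ℂ) : Summable fun k => c k * z ^ k := by
  obtain ⟨u, hu, h⟩ := hc.exists_summable_bound ‖z‖
  exact Summable.of_norm_bounded hu fun k => h k z le_rfl

lemma ExpType.hasDerivAt {c : ℕ → ℂ} (hc : ExpType c) (z : ℂ) :
    HasDerivAt (entireSum c) (entireSum (NLKG.derivCoeff c) z) z := by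
  obtain ⟨u, hu, h⟩ := hc.exists_summable_bound (‖z‖ + 1)
  have hz : z ∈ Metric.ball (0 : ℂ) (‖z‖ + 1) := by simp
  have hle : ∀ (k : ℕ) (w : ℂ), w ∈ Metric.ball (0 : ℂ) (‖z‖ + 1) → ‖c k * w ^ k‖ ≤ u k :=
    fun k w hw => h k w (by simpa using (mem_ball_zero_iff.1 hw).le)
  have hdiff : ∀ k : ℕ, DifferentiableOn ℂ (fun w : ℂ => c k * w ^ k)
      (Metric.ball (0 : ℂ) (‖z‖ + 1)) := fun k => by fun_prop
  have h1 := Complex.hasSum_deriv_of_summable_norm hu hdiff Metric.isOpen_ball hle hz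
  have h2 := (Complex.differentiableOn_tsum_of_summable_norm hu hdiff Metric.isOpen_ball
    hle).differentiableAt (Metric.isOpen_ball.mem_nhds hz)
  have h3 : HasSum (fun k => NLKG.derivCoeff c k * z ^ k)
      (deriv (fun w : ℂ => ∑' k : ℕ, c k * w ^ k) z) := by
    have h4 := (hasSum_nat_add_iff' 1).2 h1
    simp only [Finset.range_one, Finset.sum_singleton, pow_zero, mul_one, deriv_const,
      sub_zero] at h4
    refine h4.congr_fun fun k => ?_
    simp [NLKG.derivCoeff]
    ring
  have h5 : entireSum (NLKG.derivCoeff c) z = deriv (fun w : ℂ => ∑' k : ℕ, c k * w ^ k) z :=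
    h3.tsum_eq
  rw [h5]
  exact h2.hasDerivAt

lemma entireSum_zero (c : ℕ → ℂ) : entireSum c 0 = c 0 := by
  rw [entireSum, tsum_eq_single 0]
  · simp
  · intro k hk; simp [hk]

/-- A recursion for the coefficients `c` with inhomogeneity `e` is a differential equation
for the sum: `z P'' + a P' + P + R = 0`. -/
lemma entireSum_ode {c e : ℕ → ℂ} (hc : ExpType c) (he : ExpType e) (a : ℂ)
    (hrec : ∀ k : ℕ, (k + 1 : ℂ) * (k + a) * c (k + 1) + c k + e k = 0) (z : ℂ) :
    z * entireSum (derivCoeff (derivCoeff c)) z + a * entireSum (derivCoeff c) z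
      + entireSum c z + entireSum e z = 0 := by
  have h2 : HasSum (fun k : ℕ => (k : ℂ) * ((k + 1) * c (k + 1)) * z ^ k)
      (z * entireSum (derivCoeff (derivCoeff c)) z) := by
    rw [← hasSum_nat_add_iff' 1]
    have := (hc.derivCoeff.derivCoeff.summable z).hasSum.mul_left z
    simp only [Finset.range_one, Finset.sum_singleton, Nat.cast_zero, zero_mul, sub_zero]
    refine this.congr_fun fun k => ?_
    simp only [derivCoeff]
    push_cast
    ring
  have h1 := (hc.derivCoeff.summable z).hasSum.mul_left a
  have h0 := (hc.summable z).hasSum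
  have h3 := (he.summable z).hasSum
  have := ((h2.add h1).add h0).add h3
  refine this.unique ?_
  convert hasSum_zero with k
  simp only [derivCoeff]
  linear_combination z ^ k * hrec k

/-! ### Bessel functions and Bessel's equation -/

/-- The coefficients of the entire function `P` with `J_ν(x) = (x/2)^ν P((x/2)²)`. -/
def besselCoeff (ν : ℂ) (k : ℕ) : ℂ := (-1) ^ k / (k.factorial : ℂ) * (Complex.Gamma (ν + k + 1))⁻¹

lemma inv_Gamma_rec (ν : ℂ) (k : ℕ) : (Complex.Gamma (ν + k + 1))⁻¹
    = (ν + k + 1) * (Complex.Gamma (ν + (k + 1 : ℕ) + 1))⁻¹ := by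
  rw [Complex.one_div_Gamma_eq_self_mul_one_div_Gamma_add_one (ν + k + 1)]
  push_cast
  ring_nf

lemma norm_inv_Gamma_le {ν : ℂ} (hν : |ν.re| ≤ 1 / 2) (k : ℕ) :
    ‖(Complex.Gamma (ν + k + 1))⁻¹‖ ≤ ‖(Complex.Gamma (ν + 1))⁻¹‖ * 2 ^ k := by
  induction k with
  | zero => simp
  | succ k ih =>
    have h1 : (1 / 2 : ℝ) ≤ ‖ν + k + 1‖ := by
      refine le_trans ?_ (Complex.re_le_norm _)
      have := (abs_le.1 hν).1
      have hk : (0 : ℝ) ≤ k := k.cast_nonneg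
      simp
      linarith
    rw [inv_Gamma_rec, norm_mul] at ih
    rw [pow_succ]
    nlinarith [norm_nonneg (Complex.Gamma (ν + (k + 1 : ℕ) + 1))⁻¹]

lemma expType_of_pow {b : ℕ → ℂ} {K B : ℝ} (hK : 0 ≤ K) (hB : 0 ≤ B)
    (h : ∀ k, ‖b k‖ ≤ K * B ^ k) : ExpType fun k => (-1) ^ k / (k.factorial : ℂ) * b k := by
  refine ⟨K, B, hK, hB, fun k => ?_⟩
  rw [norm_mul, norm_div, norm_pow, norm_neg, norm_one, one_pow, Complex.norm_natCast,
    one_div_mul_eq_div]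
  gcongr
  exact h k

lemma expType_besselCoeff {ν : ℂ} (hν : |ν.re| ≤ 1 / 2) : ExpType (besselCoeff ν) :=
  expType_of_pow (norm_nonneg _) zero_le_two (norm_inv_Gamma_le hν)

lemma factor_succ (k : ℕ) : ((-1 : ℂ) ^ (k + 1) / ((k + 1).factorial : ℂ)) * (k + 1)
    = -((-1) ^ k / (k.factorial : ℂ)) := by
  have h1 : ((k.factorial : ℕ) : ℂ) ≠ 0 := by exact_mod_cast k.factorial_ne_zero
  have h2 : ((k : ℂ) + 1) ≠ 0 := by exact_mod_cast k.succ_ne_zero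
  rw [Nat.factorial_succ]
  push_cast
  field_simp
  ring

lemma besselCoeff_rec (ν : ℂ) (k : ℕ) :
    (k + 1 : ℂ) * (k + (ν + 1)) * besselCoeff ν (k + 1) + besselCoeff ν k + 0 = 0 := by
  have h := factor_succ k
  have h' := inv_Gamma_rec ν k
  rw [besselCoeff, besselCoeff, h']
  linear_combination (ν + k + 1) * (Complex.Gamma (ν + (k + 1 : ℕ) + 1))⁻¹ * h

lemma besselSum_ode {ν : ℂ} (hν : |ν.re| ≤ 1 / 2) (z : ℂ) :
    z * entireSum (derivCoeff (derivCoeff (besselCoeff ν))) z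
      + (ν + 1) * entireSum (derivCoeff (besselCoeff ν)) z + entireSum (besselCoeff ν) z = 0 := by
  have h := entireSum_ode (e := fun _ => 0) (expType_besselCoeff hν)
    ⟨0, 0, le_rfl, le_rfl, fun k => by simp⟩ (ν + 1) (besselCoeff_rec ν) z
  simpa [entireSum] using h

/-- `J_ν` as `(x/2)^ν` times an entire function of `(x/2)²`. -/
lemma besselJ_eq (ν : ℂ) {x : ℝ} (hx : 0 < x) :
    besselJ ν x = ((x / 2 : ℝ) : ℂ) ^ ν * entireSum (besselCoeff ν) (((x / 2 : ℝ) : ℂ) ^ 2) := by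
  have h0 : ((x / 2 : ℝ) : ℂ) ≠ 0 := by
    exact_mod_cast (half_pos hx).ne'
  rw [besselJ, entireSum, ← tsum_mul_left]
  refine tsum_congr fun k => ?_
  have : ((x / 2 : ℝ) : ℂ) ^ (ν + 2 * (k : ℂ))
      = ((x / 2 : ℝ) : ℂ) ^ ν * (((x / 2 : ℝ) : ℂ) ^ 2) ^ k := by
    rw [Complex.cpow_add _ _ h0, ← pow_mul, ← Complex.cpow_natCast]
    push_cast
    rfl
  rw [this, besselCoeff, div_mul_eq_div_div, div_eq_mul_inv _ (Complex.Gamma _)]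
  ring

/-- `y` solves `y'' = -(1 + μ / x²) y` on `(0, ∞)`, and `y'` is its derivative. -/
def SolvesOn (μ : ℝ) (y y' : ℝ → ℂ) : Prop :=
  ∀ x : ℝ, 0 < x → HasDerivAt y (y' x) x ∧ HasDerivAt y' (-(1 + μ / (x : ℂ) ^ 2) * y x) x

lemma SolvesOn.lincomb {μ : ℝ} {y y' u u' : ℝ → ℂ} (hy : SolvesOn μ y y') (hu : SolvesOn μ u u')
    (a b : ℂ) : SolvesOn μ (fun x => a * y x + b * u x) (fun x => a * y' x + b * u' x) := by
  intro x hx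
  refine ⟨((hy x hx).1.const_mul a).add ((hu x hx).1.const_mul b), ?_⟩
  refine (((hy x hx).2.const_mul a).add ((hu x hx).2.const_mul b)).congr_deriv ?_
  ring

/-- The Wronskian of two solutions is constant, hence equal to its limit at the singular point. -/
lemma SolvesOn.wronskian_eq {μ : ℝ} {y y' u u' : ℝ → ℂ} (hy : SolvesOn μ y y')
    (hu : SolvesOn μ u u') {w : ℂ}
    (hw : Tendsto (fun x => y x * u' x - y' x * u x) (𝓝[>] 0) (𝓝 w)) {x : ℝ} (hx : 0 < x) :
    y x * u' x - y' x * u x = w := by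
  have hd : ∀ x ∈ Ioi (0 : ℝ), HasDerivAt (fun x => y x * u' x - y' x * u x) 0 x := by
    intro x hx
    refine (((hy x hx).1.mul (hu x hx).2).sub ((hy x hx).2.mul (hu x hx).1)).congr_deriv ?_
    ring
  have hc : ∀ z ∈ Ioi (0 : ℝ), y z * u' z - y' z * u z = y x * u' x - y' x * u x := by
    intro z hz
    exact isOpen_Ioi.is_const_of_deriv_eq_zero (convex_Ioi (0 : ℝ)).isPreconnected
      (fun t ht => (hd t ht).differentiableAt.differentiableWithinAt)
      (fun t ht => (hd t ht).deriv) hz hx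
  refine tendsto_nhds_unique (Tendsto.congr' ?_ tendsto_const_nhds) hw
  filter_upwards [self_mem_nhdsWithin] with z hz
  exact (hc z hz).symm

/-- The function `√x (x/2)^ν`, the leading behaviour of `√x J_ν(x)` at the origin. -/
def leadPow (ν : ℂ) (x : ℝ) : ℂ := (Real.sqrt x : ℂ) * ((x / 2 : ℝ) : ℂ) ^ ν

lemma hasDerivAt_leadPow (ν : ℂ) {x : ℝ} (hx : 0 < x) :
    HasDerivAt (leadPow ν) ((ν + 1 / 2) / x * leadPow ν x) x := by
  have hx' : (x : ℂ) ≠ 0 := by exact_mod_cast hx.ne'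
  have h2 : HasDerivAt (fun t : ℝ => (Real.sqrt t : ℂ)) ((1 / (2 * Real.sqrt x) : ℝ) : ℂ) x :=
    (Real.hasDerivAt_sqrt hx.ne').ofReal_comp
  have hs : ((Real.sqrt x : ℝ) : ℂ) ≠ 0 := by exact_mod_cast (Real.sqrt_pos.2 hx).ne'
  have hsq : ((Real.sqrt x : ℝ) : ℂ) * (Real.sqrt x : ℝ) = x := by
    rw [← Complex.ofReal_mul, Real.mul_self_sqrt hx.le]
  have h3 : HasDerivAt (fun t : ℝ => ((t / 2 : ℝ) : ℂ) ^ ν) (ν * ((x / 2 : ℝ) : ℂ) ^ ν / x) x := by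
    have hm : ((x / 2 : ℝ) : ℂ) ∈ Complex.slitPlane := by
      rw [Complex.ofReal_mem_slitPlane]; positivity
    have h4 : HasDerivAt (fun t : ℝ => ((t / 2 : ℝ) : ℂ)) ((1 / 2 : ℝ) : ℂ) x :=
      ((hasDerivAt_id x).div_const 2).ofReal_comp
    have h5 := (Complex.hasStrictDerivAt_cpow_const (c := ν) hm).hasDerivAt.comp x h4
    refine (h5).congr_deriv ?_
    have h0 : ((x / 2 : ℝ) : ℂ) ≠ 0 := by exact_mod_cast (half_pos hx).ne'
    rw [Complex.cpow_sub _ _ h0, Complex.cpow_one]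
    push_cast
    field_simp
  refine (h2.mul h3).congr_deriv ?_
  rw [leadPow]
  push_cast
  rw [← hsq]
  field_simp
  ring

lemma leadPow_mul_neg (ν : ℂ) {x : ℝ} (hx : 0 < x) : leadPow ν x * leadPow (-ν) x = x := by
  have h0 : ((x / 2 : ℝ) : ℂ) ≠ 0 := by exact_mod_cast (half_pos hx).ne'
  have hsq : ((Real.sqrt x : ℝ) : ℂ) * (Real.sqrt x : ℝ) = x := by
    rw [← Complex.ofReal_mul, Real.mul_self_sqrt hx.le]
  have h1 : ((x / 2 : ℝ) : ℂ) ^ ν * ((x / 2 : ℝ) : ℂ) ^ (-ν) = 1 := by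
    rw [← Complex.cpow_add _ _ h0]; simp
  rw [leadPow, leadPow]
  linear_combination (((x / 2 : ℝ) : ℂ) ^ ν * ((x / 2 : ℝ) : ℂ) ^ (-ν)) * hsq + x * h1

/-- Composition of an entire sum with `x ↦ (x/2)²`. -/
def evenSum (c : ℕ → ℂ) (x : ℝ) : ℂ := entireSum c (((x / 2 : ℝ) : ℂ) ^ 2)

lemma ExpType.hasDerivAt_evenSum {c : ℕ → ℂ} (hc : ExpType c) (x : ℝ) :
    HasDerivAt (evenSum c) (x / 2 * evenSum (NLKG.derivCoeff c) x) x := by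
  have h4 : HasDerivAt (fun t : ℝ => ((t / 2 : ℝ) : ℂ)) ((1 / 2 : ℝ) : ℂ) x :=
    ((hasDerivAt_id x).div_const 2).ofReal_comp
  refine ((hc.hasDerivAt (((x / 2 : ℝ) : ℂ) ^ 2)).comp x (h4.pow 2)).congr_deriv ?_
  rw [evenSum]
  push_cast
  ring

lemma ExpType.continuous_evenSum {c : ℕ → ℂ} (hc : ExpType c) : Continuous (evenSum c) :=
  continuous_iff_continuousAt.2 fun x => (hc.hasDerivAt_evenSum x).continuousAt

lemma evenSum_zero (c : ℕ → ℂ) : evenSum c 0 = c 0 := by simp [evenSum, entireSum_zero]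

/-- The solution `√x J_ν(x)`. -/
def solJ (ν : ℂ) (x : ℝ) : ℂ := leadPow ν x * evenSum (besselCoeff ν) x

/-- The derivative of `solJ`. -/
def solJ' (ν : ℂ) (x : ℝ) : ℂ :=
  leadPow ν x * ((ν + 1 / 2) / x * evenSum (besselCoeff ν) x
    + x / 2 * evenSum (derivCoeff (besselCoeff ν)) x)

lemma solJ_eq (ν : ℂ) {x : ℝ} (hx : 0 < x) : solJ ν x = (Real.sqrt x : ℂ) * besselJ ν x := by
  rw [besselJ_eq ν hx, solJ, leadPow, evenSum, mul_assoc]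

lemma solvesOn_solJ {ν : ℂ} (hν : |ν.re| ≤ 1 / 2) {μ : ℝ} (hμ : ν ^ 2 = 1 / 4 - μ) :
    SolvesOn μ (solJ ν) (solJ' ν) := by
  intro x hx
  have hx' : (x : ℂ) ≠ 0 := by exact_mod_cast hx.ne'
  have hX := hasDerivAt_leadPow ν hx
  have hc := expType_besselCoeff hν
  have hP := hc.hasDerivAt_evenSum x
  have hP' := hc.derivCoeff.hasDerivAt_evenSum x
  have hid : HasDerivAt (fun t : ℝ => (t : ℂ)) 1 x := (hasDerivAt_id x).ofReal_comp
  constructor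
  · refine (hX.mul hP).congr_deriv ?_
    rw [solJ']
    ring
  · have hinv : HasDerivAt (fun t : ℝ => (ν + 1 / 2) / (t : ℂ)) (-(ν + 1 / 2) / x ^ 2) x := by
      refine ((hasDerivAt_const x (ν + 1 / 2)).div hid hx').congr_deriv ?_
      ring
    refine (hX.mul ((hinv.mul hP).add ((hid.div_const 2).mul hP'))).congr_deriv ?_
    have hode := besselSum_ode hν (((x / 2 : ℝ) : ℂ) ^ 2)
    change _ * evenSum _ x + _ * evenSum _ x + evenSum _ x = 0 at hode
    push_cast at hode
    rw [solJ]
    simp only [Pi.mul_apply, Pi.add_apply]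
    field_simp
    field_simp at hode
    linear_combination (x ^ 2 * leadPow ν x) * hode
      + (4 * leadPow ν x * evenSum (besselCoeff ν) x) * hμ

lemma evenSum_wronskian_tendsto {c e : ℕ → ℂ} (hc : ExpType c) (he : ExpType e) (a : ℂ) :
    Tendsto (fun x : ℝ => a * (evenSum c x * evenSum e x) + (x : ℂ) ^ 2 / 2
      * (evenSum c x * evenSum (derivCoeff e) x - evenSum (derivCoeff c) x * evenSum e x))
      (𝓝[>] 0) (𝓝 (a * (c 0 * e 0))) := by
  have h1 := hc.continuous_evenSum
  have h2 := he.continuous_evenSum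
  have h3 := hc.derivCoeff.continuous_evenSum
  have h4 := he.derivCoeff.continuous_evenSum
  have hcont : Continuous fun x : ℝ => a * (evenSum c x * evenSum e x) + (x : ℂ) ^ 2 / 2
      * (evenSum c x * evenSum (derivCoeff e) x - evenSum (derivCoeff c) x * evenSum e x) := by
    fun_prop
  have := (hcont.tendsto 0).mono_left (nhdsWithin_le_nhds (s := Ioi 0))
  simpa [evenSum_zero] using this

lemma besselCoeff_zero_ne {ν : ℂ} (hν : |ν.re| ≤ 1 / 2) : besselCoeff ν 0 ≠ 0 := by
  have : 0 < (ν + 1).re := by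
    have := (abs_le.1 hν).1
    simp; linarith
  simpa [besselCoeff] using Complex.Gamma_ne_zero_of_re_pos this

/-- The Wronskian of `√x J_ν` and `√x J_{-ν}`, read off at the origin; it is nonzero unless
`ν = 0`. -/
lemma solJ_wronskian {ν : ℂ} (hν : |ν.re| ≤ 1 / 2) {μ : ℝ} (hμ : ν ^ 2 = 1 / 4 - μ) {x : ℝ}
    (hx : 0 < x) : solJ ν x * solJ' (-ν) x - solJ' ν x * solJ (-ν) x
      = -2 * ν * (besselCoeff ν 0 * besselCoeff (-ν) 0) := by
  have hν' : |(-ν).re| ≤ 1 / 2 := by simpa using hν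
  refine (solvesOn_solJ hν hμ).wronskian_eq (solvesOn_solJ hν' (by simpa using hμ)) ?_ hx
  refine Tendsto.congr' ?_ (evenSum_wronskian_tendsto (expType_besselCoeff hν)
    (expType_besselCoeff hν') (-2 * ν))
  filter_upwards [self_mem_nhdsWithin] with t ht
  have ht' : (t : ℂ) ≠ 0 := by exact_mod_cast (ne_of_gt ht)
  have hm := leadPow_mul_neg ν ht
  simp only [solJ, solJ']
  field_simp
  linear_combination (-1 : ℂ) * (-2 * ν * 2 * evenSum (besselCoeff ν) t * evenSum (besselCoeff (-ν)) t
    + t ^ 2 * (evenSum (besselCoeff ν) t * evenSum (derivCoeff (besselCoeff (-ν))) t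
      - evenSum (derivCoeff (besselCoeff ν)) t * evenSum (besselCoeff (-ν)) t)) * hm

/-! ### The Bessel function of the second kind of order zero -/

/-- The derivative of `1 / Γ(z + k + 1)` at `z = 0`. -/
def invGammaDeriv (k : ℕ) : ℂ := deriv (fun z : ℂ => (Complex.Gamma (z + k + 1))⁻¹) 0

/-- The coefficients of the non-logarithmic part of `Y₀`. -/
def besselYCoeff (k : ℕ) : ℂ := (-1) ^ k / (k.factorial : ℂ) * invGammaDeriv k

lemma differentiable_inv_Gamma_add (k : ℕ) :
    Differentiable ℂ fun z : ℂ => (Complex.Gamma (z + k + 1))⁻¹ :=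
  Complex.differentiable_one_div_Gamma.comp (by fun_prop : Differentiable ℂ fun z : ℂ => z + k + 1)

/-- The derivative at the origin of the functional equation of `1 / Γ`. -/
lemma invGammaDeriv_rec (k : ℕ) : invGammaDeriv k
    = (Complex.Gamma ((k + 1 : ℕ) + 1))⁻¹ + (k + 1) * invGammaDeriv (k + 1) := by
  have h1 : HasDerivAt (fun z : ℂ => z + k + 1) 1 0 := by
    simpa using ((hasDerivAt_id (0 : ℂ)).add_const (k : ℂ)).add_const 1
  have h2 := h1.mul (differentiable_inv_Gamma_add (k + 1) 0).hasDerivAt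
  have h3 : (fun z : ℂ => (Complex.Gamma (z + k + 1))⁻¹)
      = (fun z : ℂ => z + k + 1) * fun z : ℂ => (Complex.Gamma (z + (k + 1 : ℕ) + 1))⁻¹ := by
    funext z
    exact inv_Gamma_rec z k
  rw [invGammaDeriv, h3, h2.deriv, invGammaDeriv]
  simp

lemma norm_invGammaDeriv_le (k : ℕ) : ‖invGammaDeriv k‖ ≤ (‖invGammaDeriv 0‖ + 1) * 2 ^ k := by
  have key : ∀ k, ‖invGammaDeriv k‖ + 1 ≤ (‖invGammaDeriv 0‖ + 1) * 2 ^ k := by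
    intro k
    induction k with
    | zero => simp
    | succ k ih =>
      have h1 := invGammaDeriv_rec k
      have h2 : ‖(Complex.Gamma ((k + 1 : ℕ) + 1))⁻¹‖ ≤ 1 := by
        rw [Complex.Gamma_nat_eq_factorial, norm_inv, Complex.norm_natCast]
        exact inv_le_one_of_one_le₀ (by exact_mod_cast (k + 1).factorial_pos)
      have h3 : ‖((k : ℂ) + 1)‖ = (k + 1 : ℝ) := by
        have := Complex.norm_natCast (k + 1)
        push_cast at this; exact this
      have h4 : (k + 1 : ℝ) * ‖invGammaDeriv (k + 1)‖ ≤ ‖invGammaDeriv k‖ + 1 := by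
        rw [← h3, ← norm_mul]
        have : ((k : ℂ) + 1) * invGammaDeriv (k + 1)
            = invGammaDeriv k - (Complex.Gamma ((k + 1 : ℕ) + 1))⁻¹ := by rw [h1]; ring
        rw [this]
        exact (norm_sub_le _ _).trans (by linarith)
      have h5 : ‖invGammaDeriv (k + 1)‖ ≤ (k + 1 : ℝ) * ‖invGammaDeriv (k + 1)‖ := by
        have : (0 : ℝ) ≤ k := k.cast_nonneg
        nlinarith [norm_nonneg (invGammaDeriv (k + 1))]
      rw [pow_succ]
      nlinarith [norm_nonneg (invGammaDeriv k)]
  linarith [key k]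

lemma expType_besselYCoeff : ExpType besselYCoeff :=
  expType_of_pow (by positivity) zero_le_two norm_invGammaDeriv_le

lemma besselYSum_ode (z : ℂ) :
    z * entireSum (derivCoeff (derivCoeff besselYCoeff)) z + 1 * entireSum (derivCoeff besselYCoeff) z
      + entireSum besselYCoeff z + entireSum (derivCoeff (besselCoeff 0)) z = 0 := by
  refine entireSum_ode expType_besselYCoeff (expType_besselCoeff (by simp)).derivCoeff 1
    (fun k => ?_) z
  have h := factor_succ k
  have h1 := invGammaDeriv_rec k
  simp only [besselYCoeff, derivCoeff, besselCoeff, zero_add]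
  linear_combination (invGammaDeriv (k + 1) * (k + 1) + (Complex.Gamma ((k + 1 : ℕ) + 1))⁻¹) * h
    + (-1) ^ k / (k.factorial : ℂ) * h1

/-- `Y₀` is the limit of `Y_z` as `z → 0`. Numerator and denominator of the defining quotient
vanish there, so that the limit is `2/π` times the derivative of `J_z` in the order `z`; the factor
`(x/2)^z` contributes the logarithm. -/
lemma besselY_zero {x : ℝ} (hx : 0 < x) :
    besselY 0 x = 2 / Real.pi * (Real.log (x / 2) * evenSum (besselCoeff 0) x
      + evenSum besselYCoeff x) := by
  have h0 : ((x / 2 : ℝ) : ℂ) ≠ 0 := by exact_mod_cast (half_pos hx).ne'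
  set w : ℂ := ((x / 2 : ℝ) : ℂ) ^ 2 with hw
  -- the derivative of the power series with respect to the order
  obtain ⟨A, hA⟩ : ∃ A : ℝ, ∀ z ∈ Metric.closedBall (0 : ℂ) (1 / 2),
      ‖(Complex.Gamma (z + 1))⁻¹‖ ≤ A := by
    refine (isCompact_closedBall (0 : ℂ) (1 / 2)).exists_bound_of_continuousOn ?_
    have := (differentiable_inv_Gamma_add 0).continuous
    simpa using this.continuousOn
  have hbound : ∀ (k : ℕ) (z : ℂ), z ∈ Metric.ball (0 : ℂ) (1 / 2) →
      ‖besselCoeff z k * w ^ k‖ ≤ A * ((2 * ‖w‖) ^ k / (k.factorial : ℝ)) := by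
    intro k z hz
    have hre : |z.re| ≤ 1 / 2 := (Complex.abs_re_le_norm z).trans (mem_ball_zero_iff.1 hz).le
    have h1 := (norm_inv_Gamma_le hre k).trans
      (mul_le_mul_of_nonneg_right (hA z (Metric.ball_subset_closedBall hz)) (by positivity))
    rw [besselCoeff, norm_mul, norm_mul, norm_div, norm_pow, norm_neg, norm_one, one_pow,
      Complex.norm_natCast, norm_pow, mul_pow]
    calc 1 / (k.factorial : ℝ) * ‖(Complex.Gamma (z + k + 1))⁻¹‖ * ‖w‖ ^ k
        ≤ 1 / (k.factorial : ℝ) * (A * 2 ^ k) * ‖w‖ ^ k := by gcongr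
      _ = _ := by ring
  have hdiff : ∀ k : ℕ, DifferentiableOn ℂ (fun z => besselCoeff z k * w ^ k)
      (Metric.ball (0 : ℂ) (1 / 2)) := fun k =>
    (((differentiable_inv_Gamma_add k).const_mul _).mul_const _).differentiableOn
  have hsum : Summable fun k : ℕ => A * ((2 * ‖w‖) ^ k / (k.factorial : ℝ)) :=
    (Real.summable_pow_div_factorial _).mul_left A
  have hz0 : (0 : ℂ) ∈ Metric.ball (0 : ℂ) (1 / 2) := by simp
  have h1 := Complex.hasSum_deriv_of_summable_norm hsum hdiff Metric.isOpen_ball hbound hz0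
  have h2 := ((Complex.differentiableOn_tsum_of_summable_norm hsum hdiff Metric.isOpen_ball
    hbound).differentiableAt (Metric.isOpen_ball.mem_nhds hz0)).hasDerivAt
  have h3 : deriv (fun z : ℂ => ∑' k : ℕ, besselCoeff z k * w ^ k) 0 = evenSum besselYCoeff x := by
    rw [← h1.tsum_eq, evenSum, entireSum]
    refine tsum_congr fun k => ?_
    have : HasDerivAt (fun z => besselCoeff z k * w ^ k)
        ((-1) ^ k / (k.factorial : ℂ) * invGammaDeriv k * w ^ k) 0 :=
      ((differentiable_inv_Gamma_add k 0).hasDerivAt.const_mul _).mul_const _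
    rw [this.deriv, besselYCoeff]
  rw [h3] at h2
  have hJ : HasDerivAt (fun z : ℂ => besselJ z x) (Real.log (x / 2) * evenSum (besselCoeff 0) x
      + evenSum besselYCoeff x) 0 := by
    have h4 : HasDerivAt (fun z : ℂ => ((x / 2 : ℝ) : ℂ) ^ z)
        (((x / 2 : ℝ) : ℂ) ^ (0 : ℂ) * Complex.log ((x / 2 : ℝ) : ℂ) * 1) 0 :=
      (hasDerivAt_id (0 : ℂ)).const_cpow (Or.inl h0)
    have h5 := h4.mul h2
    have h6 : (fun z : ℂ => besselJ z x) = (fun z : ℂ => ((x / 2 : ℝ) : ℂ) ^ z)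
        * fun z : ℂ => ∑' k : ℕ, besselCoeff z k * w ^ k := by
      funext z; exact besselJ_eq z hx
    rw [h6]
    refine h5.congr_deriv ?_
    rw [Complex.cpow_zero, Complex.ofReal_log (half_pos hx).le]
    simp only [evenSum, entireSum, one_mul, mul_one, hw]
  set D : ℂ := Real.log (x / 2) * evenSum (besselCoeff 0) x + evenSum besselYCoeff x
  -- numerator and denominator of the quotient vanish at order zero
  have hlin : HasDerivAt (fun z : ℂ => z * (Real.pi : ℂ)) Real.pi 0 := by
    simpa using (hasDerivAt_id (0 : ℂ)).mul_const (Real.pi : ℂ)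
  have hN : HasDerivAt (fun z : ℂ => besselJ z x * Complex.cos (z * Real.pi) - besselJ (-z) x)
      (2 * D) 0 := by
    have hJ' : HasDerivAt (fun z : ℂ => besselJ z x) D (-0) := by simpa using hJ
    refine ((hJ.mul hlin.ccos).sub (hJ'.comp 0 (hasDerivAt_neg (0 : ℂ)))).congr_deriv ?_
    simp
    ring
  have hS : HasDerivAt (fun z : ℂ => Complex.sin (z * Real.pi)) Real.pi 0 := by
    refine hlin.csin.congr_deriv ?_
    simp
  have hlim : Tendsto (fun z => besselYAux z x) (𝓝[≠] 0) (𝓝 (2 * D / Real.pi)) := by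
    have hpi : (Real.pi : ℂ) ≠ 0 := by exact_mod_cast Real.pi_ne_zero
    refine (hN.tendsto_slope.div hS.tendsto_slope hpi).congr' ?_
    filter_upwards [self_mem_nhdsWithin] with z hz
    have hz' : z ≠ 0 := hz
    simp only [slope_def_field, Pi.div_apply, besselYAux, sub_zero]
    simp only [zero_mul, Complex.cos_zero, mul_one, neg_zero, sub_self, Complex.sin_zero, sub_zero]
    rw [div_div_div_cancel_right₀ hz']
  rw [besselY, if_pos ⟨0, by simp⟩, hlim.limUnder_eq]
  ring

/-- The solution `√x (log (x/2) P + Q)`, proportional to `√x Y₀(x)`. -/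
def solLog (x : ℝ) : ℂ := leadPow 0 x * (Real.log (x / 2) * evenSum (besselCoeff 0) x
      + evenSum besselYCoeff x)

/-- The derivative of `solLog`. -/
def solLog' (x : ℝ) : ℂ := leadPow 0 x * ((0 + 1 / 2) / x * (Real.log (x / 2)
      * evenSum (besselCoeff 0) x + evenSum besselYCoeff x) + 1 / x * evenSum (besselCoeff 0) x
      + x / 2 * (Real.log (x / 2) * evenSum (derivCoeff (besselCoeff 0)) x
        + evenSum (derivCoeff besselYCoeff) x))

lemma solvesOn_solLog : SolvesOn (1 / 4) solLog solLog' := by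
  intro x hx
  have hx' : (x : ℂ) ≠ 0 := by exact_mod_cast hx.ne'
  have hX := hasDerivAt_leadPow 0 hx
  have hc : ExpType (besselCoeff 0) := expType_besselCoeff (by simp)
  have hP := hc.hasDerivAt_evenSum x
  have hP' := hc.derivCoeff.hasDerivAt_evenSum x
  have hQ := expType_besselYCoeff.hasDerivAt_evenSum x
  have hQ' := expType_besselYCoeff.derivCoeff.hasDerivAt_evenSum x
  have hid : HasDerivAt (fun t : ℝ => (t : ℂ)) 1 x := (hasDerivAt_id x).ofReal_comp
  have hL : HasDerivAt (fun t : ℝ => (Real.log (t / 2) : ℂ)) (1 / x) x := by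
    refine (((hasDerivAt_id x).div_const 2).log (half_pos hx).ne').ofReal_comp.congr_deriv ?_
    push_cast
    simp only [id]
    field_simp
  have hinv : ∀ a : ℂ, HasDerivAt (fun t : ℝ => a / (t : ℂ)) (-a / x ^ 2) x := fun a => by
    refine ((hasDerivAt_const x a).div hid hx').congr_deriv ?_
    ring
  constructor
  · refine (hX.mul ((hL.mul hP).add hQ)).congr_deriv ?_
    rw [solLog']
    simp only [Pi.mul_apply, Pi.add_apply]
    ring
  · refine (hX.mul ((((hinv (0 + 1 / 2)).mul ((hL.mul hP).add hQ)).add ((hinv 1).mul hP)).add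
      ((hid.div_const 2).mul ((hL.mul hP').add hQ')))).congr_deriv ?_
    have hode := besselSum_ode (ν := 0) (by simp) (((x / 2 : ℝ) : ℂ) ^ 2)
    change _ * evenSum _ x + _ * evenSum _ x + evenSum _ x = 0 at hode
    have hode2 := besselYSum_ode (((x / 2 : ℝ) : ℂ) ^ 2)
    change _ * evenSum _ x + _ * evenSum _ x + evenSum _ x + evenSum _ x = 0 at hode2
    push_cast at hode hode2
    rw [solLog]
    simp only [Pi.mul_apply, Pi.add_apply]
    push_cast
    field_simp
    field_simp at hode hode2
    linear_combination (4 * x ^ 2 * leadPow 0 x * Real.log (x / 2)) * hode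
      + (4 * x ^ 2 * leadPow 0 x) * hode2

lemma solLog_wronskian {x : ℝ} (hx : 0 < x) :
    solJ 0 x * solLog' x - solJ' 0 x * solLog x = besselCoeff 0 0 * besselCoeff 0 0 := by
  have hc : ExpType (besselCoeff 0) := expType_besselCoeff (by simp)
  refine (solvesOn_solJ (ν := 0) (μ := 1 / 4) (by simp) (by push_cast; ring)).wronskian_eq
    solvesOn_solLog ?_ hx
  have h1 := evenSum_wronskian_tendsto hc hc 1
  have h2 := evenSum_wronskian_tendsto hc expType_besselYCoeff 0
  have h3 := h1.add h2
  simp only [one_mul, zero_mul, add_zero, zero_add] at h3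
  refine Tendsto.congr' ?_ h3
  filter_upwards [self_mem_nhdsWithin] with t ht
  have ht' : (t : ℂ) ≠ 0 := by exact_mod_cast (ne_of_gt ht)
  have hm := leadPow_mul_neg 0 ht
  rw [neg_zero] at hm
  simp only [solJ, solJ', solLog, solLog']
  field_simp
  linear_combination (-1 : ℂ) * (2 * evenSum (besselCoeff 0) t ^ 2
    + t ^ 2 * (evenSum (besselCoeff 0) t * evenSum (derivCoeff besselYCoeff) t
      - evenSum (derivCoeff (besselCoeff 0)) t * evenSum besselYCoeff t)) * hm

/-! ### The symbols of the propagator -/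

lemma order_sq (μ : ℝ) : order μ ^ 2 = 1 / 4 - μ := by
  rw [order]
  split_ifs with h
  · rw [← Complex.ofReal_pow, div_pow, Real.sq_sqrt (by linarith)]
    push_cast; ring
  · rw [mul_pow, Complex.I_sq, ← Complex.ofReal_pow, div_pow, Real.sq_sqrt (by linarith)]
    push_cast; ring

lemma abs_re_order_le {μ : ℝ} (hμ : 0 ≤ μ) : |(order μ).re| ≤ 1 / 2 := by
  rw [order]
  split_ifs with h
  · rw [Complex.ofReal_re, abs_of_nonneg (by positivity)]
    have : Real.sqrt (1 - 4 * μ) ≤ 1 := Real.sqrt_le_one.2 (by linarith)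
    linarith
  · simp

/-- The order is an integer, so that `Y_ν` is defined by a limit, only for `μ = 1/4`. -/
lemma order_eq_int {μ : ℝ} (hμ : 0 ≤ μ) {n : ℤ} (h : order μ = n) : μ = 1 / 4 := by
  have h1 := abs_re_order_le hμ
  rw [h, Complex.intCast_re] at h1
  have hn : n = 0 := by
    have h2 : |(n : ℝ)| < 1 := by linarith
    have h3 : |n| < 1 := by exact_mod_cast h2
    exact Int.abs_lt_one_iff.1 h3
  have h2 := order_sq μ
  rw [h, hn] at h2
  have : ((1 / 4 - μ : ℝ) : ℂ) = 0 := by push_cast; simpa using h2.symm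
  have := Complex.ofReal_eq_zero.1 this
  linarith

lemma order_quarter : order (1 / 4) = 0 := by
  have h := order_sq (1 / 4)
  push_cast at h
  simpa using h

/-- The functions `√x J_ν(x)` and `√x Y_ν(x)` form a fundamental system of
`y'' = -(1 + μ / x²) y` on `(0, ∞)`. -/
lemma exists_fundamental_system {μ : ℝ} (hμ : 0 ≤ μ) :
    ∃ (φ φ' ψ ψ' : ℝ → ℂ) (w : ℂ), w ≠ 0 ∧ SolvesOn μ φ φ' ∧ SolvesOn μ ψ ψ' ∧
      (∀ x : ℝ, 0 < x → (Real.sqrt x : ℂ) * besselJ (order μ) x = φ x) ∧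
      (∀ x : ℝ, 0 < x → (Real.sqrt x : ℂ) * besselY (order μ) x = ψ x) ∧
      ∀ x : ℝ, 0 < x → φ x * ψ' x - φ' x * ψ x = w := by
  have hν := abs_re_order_le hμ
  have hsq := order_sq μ
  have hν' : |(-order μ).re| ≤ 1 / 2 := by simpa using hν
  have hsq' : (-order μ) ^ 2 = 1 / 4 - μ := by simpa using hsq
  by_cases h4 : μ = 1 / 4
  · subst h4
    rw [order_quarter]
    have hpi : (Real.pi : ℂ) ≠ 0 := by exact_mod_cast Real.pi_ne_zero
    refine ⟨solJ 0, solJ' 0, fun x => 2 / Real.pi * solLog x + 0 * solLog x,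
      fun x => 2 / Real.pi * solLog' x + 0 * solLog' x,
      2 / Real.pi * (besselCoeff 0 0 * besselCoeff 0 0), ?_, ?_, ?_, ?_, ?_, ?_⟩
    · have := besselCoeff_zero_ne (ν := 0) (by simp)
      have h2 : (2 / Real.pi : ℂ) ≠ 0 := div_ne_zero two_ne_zero hpi
      exact mul_ne_zero h2 (mul_ne_zero this this)
    · exact solvesOn_solJ (by simp) (by push_cast; ring)
    · exact solvesOn_solLog.lincomb solvesOn_solLog _ _
    · exact fun x hx => (solJ_eq 0 hx).symm
    · intro x hx
      simp only [besselY_zero hx, solLog, leadPow, Complex.cpow_zero]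
      ring
    · intro x hx
      have := solLog_wronskian hx
      linear_combination (2 / Real.pi : ℂ) * this
  · have hint : ¬ ∃ n : ℤ, order μ = n := fun ⟨n, hn⟩ => h4 (order_eq_int hμ hn)
    have hsin : Complex.sin (order μ * Real.pi) ≠ 0 := by
      rw [Complex.sin_ne_zero_iff]
      intro k hk
      exact hint ⟨k, mul_right_cancel₀ (by exact_mod_cast Real.pi_ne_zero) hk⟩
    have h0 : order μ ≠ 0 := fun h => hint ⟨0, by simpa using h⟩
    refine ⟨solJ (order μ), solJ' (order μ),
      fun x => Complex.cos (order μ * Real.pi) / Complex.sin (order μ * Real.pi) * solJ (order μ) x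
        + (-1 / Complex.sin (order μ * Real.pi)) * solJ (-order μ) x,
      fun x => Complex.cos (order μ * Real.pi) / Complex.sin (order μ * Real.pi) * solJ' (order μ) x
        + (-1 / Complex.sin (order μ * Real.pi)) * solJ' (-order μ) x,
      (-1 / Complex.sin (order μ * Real.pi))
        * (-2 * order μ * (besselCoeff (order μ) 0 * besselCoeff (-order μ) 0)),
      ?_, ?_, ?_, ?_, ?_, ?_⟩
    · have h1 := besselCoeff_zero_ne hν
      have h2 := besselCoeff_zero_ne hν'
      exact mul_ne_zero (div_ne_zero (by simp) hsin)
        (mul_ne_zero (mul_ne_zero (by simp) h0) (mul_ne_zero h1 h2))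
    · exact solvesOn_solJ hν hsq
    · exact (solvesOn_solJ hν hsq).lincomb (solvesOn_solJ hν' hsq') _ _
    · exact fun x hx => (solJ_eq _ hx).symm
    · intro x hx
      simp only [besselY, if_neg hint, besselYAux, solJ_eq _ hx]
      ring
    · intro x hx
      have := solJ_wronskian hν hsq hx
      linear_combination (-1 / Complex.sin (order μ * Real.pi)) * this

lemma SolvesOn.continuousOn {μ : ℝ} {y y' : ℝ → ℂ} (h : SolvesOn μ y y') :
    ContinuousOn y (Ioi 0) ∧ ContinuousOn y' (Ioi 0) :=
  ⟨fun x hx => (h x hx).1.continuousAt.continuousWithinAt,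
    fun x hx => (h x hx).2.continuousAt.continuousWithinAt⟩

/-- A solution of `y'' = -(r² + μ / (1 + t)²) y` on `(-1, ∞)` together with its derivative. -/
def SolvesMode (μ r : ℝ) (y y' : ℝ → ℂ) : Prop :=
  ∀ t : ℝ, -1 < t → HasDerivAt y (y' t) t ∧
    HasDerivAt y' (-((r : ℂ) ^ 2 + μ / (1 + t : ℂ) ^ 2) * y t) t

lemma SolvesOn.solvesMode {μ : ℝ} {y y' : ℝ → ℂ} (h : SolvesOn μ y y') {r : ℝ} (hr : 0 < r) :
    SolvesMode μ r (fun t => y ((1 + t) * r)) (fun t => r * y' ((1 + t) * r)) := by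
  intro t ht
  have hx : 0 < (1 + t) * r := mul_pos (by linarith) hr
  have hl : HasDerivAt (fun t : ℝ => (1 + t) * r) r t := by
    simpa using ((hasDerivAt_id t).const_add 1).mul_const r
  have h1 := (h _ hx).1.scomp t hl
  have h2 := (h _ hx).2.scomp t hl
  refine ⟨h1.congr_deriv (by simp), (h2.const_mul (r : ℂ)).congr_deriv ?_⟩
  have hr' : (r : ℂ) ≠ 0 := by exact_mod_cast hr.ne'
  have ht' : (1 + t : ℂ) ≠ 0 := by
    have : (1 + t : ℝ) ≠ 0 := by linarith
    exact_mod_cast this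
  simp only [Complex.real_smul]
  push_cast
  field_simp

/-- The symbols `E₀(t, s, r)`, `E₁(t, s, r)` are the solutions of the mode equation with data
`(1, 0)` and `(0, 1)` at time `s`. They and their time derivatives depend continuously on the
frequency, and `E₁` is jointly continuous in the two times. -/
lemma exists_symbol_derivatives {μ : ℝ} (hμ : 0 ≤ μ) :
    ∃ D0 D1 : ℝ → ℝ → ℝ → ℂ,
      (∀ s r : ℝ, -1 < s → 0 < r →
        SolvesMode μ r (fun t => symbolE0 μ t s r) (fun t => D0 t s r) ∧
        SolvesMode μ r (fun t => symbolE1 μ t s r) (fun t => D1 t s r) ∧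
        symbolE0 μ s s r = 1 ∧ D0 s s r = 0 ∧ symbolE1 μ s s r = 0 ∧ D1 s s r = 1) ∧
      (∀ t s : ℝ, -1 < t → -1 < s →
        ContinuousOn (symbolE0 μ t s) (Ioi 0) ∧ ContinuousOn (symbolE1 μ t s) (Ioi 0) ∧
        ContinuousOn (D0 t s) (Ioi 0) ∧ ContinuousOn (D1 t s) (Ioi 0)) ∧
      (∀ r : ℝ, 0 < r → ContinuousOn (fun p : ℝ × ℝ => symbolE1 μ p.1 p.2 r)
        {p | -1 < p.1 ∧ -1 < p.2}) := by
  obtain ⟨φ, φ', ψ, ψ', w, hw, hφ, hψ, hJ, hY, hW⟩ := exists_fundamental_system hμ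
  have hpos : ∀ {t r : ℝ}, -1 < t → 0 < r → 0 < (1 + t) * r := fun ht hr =>
    mul_pos (by linarith) hr
  have hep : ∀ {t r : ℝ}, -1 < t → 0 < r → ePlus μ t r = φ ((1 + t) * r) := fun ht hr =>
    hJ _ (hpos ht hr)
  have hem : ∀ {t r : ℝ}, -1 < t → 0 < r → eMinus μ t r = ψ ((1 + t) * r) := fun ht hr =>
    hY _ (hpos ht hr)
  have hepd : ∀ {t r : ℝ}, -1 < t → 0 < r → ePlusDot μ t r = r * φ' ((1 + t) * r) := by
    intro t r ht hr
    refine HasDerivAt.deriv (((hφ.solvesMode hr) t ht).1.congr_of_eventuallyEq ?_)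
    filter_upwards [Ioi_mem_nhds ht] with s hs using hep hs hr
  have hemd : ∀ {t r : ℝ}, -1 < t → 0 < r → eMinusDot μ t r = r * ψ' ((1 + t) * r) := by
    intro t r ht hr
    refine HasDerivAt.deriv (((hψ.solvesMode hr) t ht).1.congr_of_eventuallyEq ?_)
    filter_upwards [Ioi_mem_nhds ht] with s hs using hem hs hr
  have hwr : ∀ {t r : ℝ}, -1 < t → 0 < r → wronskian μ t r = r * w := by
    intro t r ht hr
    rw [wronskian, hep ht hr, hem ht hr, hepd ht hr, hemd ht hr, ← hW _ (hpos ht hr)]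
    ring
  have hE0 : ∀ {t s r : ℝ}, -1 < t → -1 < s → 0 < r → symbolE0 μ t s r
      = ψ' ((1 + s) * r) / w * φ ((1 + t) * r) + (-φ' ((1 + s) * r) / w) * ψ ((1 + t) * r) := by
    intro t s r ht hs hr
    have hr' : (r : ℂ) ≠ 0 := by exact_mod_cast hr.ne'
    rw [symbolE0, hwr hs hr, hep ht hr, hem ht hr, hepd hs hr, hemd hs hr]
    field_simp
    ring
  have hE1 : ∀ {t s r : ℝ}, -1 < t → -1 < s → 0 < r → symbolE1 μ t s r
      = (-ψ ((1 + s) * r) / (r * w)) * φ ((1 + t) * r)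
        + φ ((1 + s) * r) / (r * w) * ψ ((1 + t) * r) := by
    intro t s r ht hs hr
    have hr' : (r : ℂ) ≠ 0 := by exact_mod_cast hr.ne'
    rw [symbolE1, hwr hs hr, hep ht hr, hem ht hr, hep hs hr, hem hs hr]
    field_simp
    ring
  have hcomb : ∀ {r : ℝ} (_ : 0 < r) (a b : ℂ), SolvesMode μ r
      (fun t => a * φ ((1 + t) * r) + b * ψ ((1 + t) * r))
      (fun t => a * (r * φ' ((1 + t) * r)) + b * (r * ψ' ((1 + t) * r))) := by
    intro r hr a b t ht
    obtain ⟨h1, h2⟩ := hφ.solvesMode hr t ht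
    obtain ⟨h3, h4⟩ := hψ.solvesMode hr t ht
    refine ⟨(h1.const_mul a).add (h3.const_mul b),
      ((h2.const_mul a).add (h4.const_mul b)).congr_deriv ?_⟩
    ring
  have hcongr : ∀ {r : ℝ} {y u u' : ℝ → ℂ}, SolvesMode μ r u u' → (∀ t, -1 < t → y t = u t) →
      SolvesMode μ r y u' := by
    intro r y u u' h hy t ht
    refine ⟨(h t ht).1.congr_of_eventuallyEq ?_, ?_⟩
    · filter_upwards [Ioi_mem_nhds ht] with s hs using hy s hs
    · rw [hy t ht]; exact (h t ht).2
  have hcr : ∀ {f : ℝ → ℂ} {t : ℝ}, ContinuousOn f (Ioi 0) → -1 < t →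
      ContinuousOn (fun r => f ((1 + t) * r)) (Ioi 0) := fun hf ht =>
    hf.comp (by fun_prop) fun r hr => hpos ht hr
  have hid : ContinuousOn (fun r : ℝ => (r : ℂ)) (Ioi 0) := by fun_prop
  refine ⟨fun t s r => ψ' ((1 + s) * r) / w * (r * φ' ((1 + t) * r))
      + (-φ' ((1 + s) * r) / w) * (r * ψ' ((1 + t) * r)),
    fun t s r => (-ψ ((1 + s) * r) / (r * w)) * (r * φ' ((1 + t) * r))
      + φ ((1 + s) * r) / (r * w) * (r * ψ' ((1 + t) * r)), ?_, ?_, ?_⟩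
  · intro s r hs hr
    have hr' : (r : ℂ) ≠ 0 := by exact_mod_cast hr.ne'
    have hW' := hW _ (hpos hs hr)
    refine ⟨hcongr (hcomb hr _ _) fun t ht => hE0 ht hs hr,
      hcongr (hcomb hr _ _) fun t ht => hE1 ht hs hr, ?_, ?_, ?_, ?_⟩
    · rw [hE0 hs hs hr]
      field_simp
      linear_combination hW'
    · ring
    · rw [hE1 hs hs hr]
      ring
    · field_simp
      linear_combination hW'
  · intro t s ht hs
    have a1 := hcr hφ.continuousOn.1 ht
    have a2 := hcr hφ.continuousOn.2 ht
    have a3 := hcr hψ.continuousOn.1 ht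
    have a4 := hcr hψ.continuousOn.2 ht
    have b1 := hcr hφ.continuousOn.1 hs
    have b2 := hcr hφ.continuousOn.2 hs
    have b3 := hcr hψ.continuousOn.1 hs
    have b4 := hcr hψ.continuousOn.2 hs
    have hne : ∀ r ∈ Ioi (0 : ℝ), (r : ℂ) * w ≠ 0 := fun r hr =>
      mul_ne_zero (by exact_mod_cast (ne_of_gt hr)) hw
    have hrw : ContinuousOn (fun r : ℝ => (r : ℂ) * w) (Ioi 0) := hid.mul continuousOn_const
    refine ⟨?_, ?_, ?_, ?_⟩
    · exact (((b4.div_const w).mul a1).add ((b2.neg.div_const w).mul a3)).congr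
        fun r hr => hE0 ht hs hr
    · exact (((b3.neg.div hrw hne).mul a1).add ((b1.div hrw hne).mul a3)).congr
        fun r hr => hE1 ht hs hr
    · exact ((b4.div_const w).mul (hid.mul a2)).add ((b2.neg.div_const w).mul (hid.mul a4))
    · exact ((b3.neg.div hrw hne).mul (hid.mul a2)).add ((b1.div hrw hne).mul (hid.mul a4))
  · intro r hr
    have c1 : ∀ {f : ℝ → ℂ}, ContinuousOn f (Ioi 0) →
        ContinuousOn (fun p : ℝ × ℝ => f ((1 + p.1) * r)) {p | -1 < p.1 ∧ -1 < p.2} := fun hf =>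
      hf.comp (by fun_prop) fun p hp => hpos hp.1 hr
    have c2 : ∀ {f : ℝ → ℂ}, ContinuousOn f (Ioi 0) →
        ContinuousOn (fun p : ℝ × ℝ => f ((1 + p.2) * r)) {p | -1 < p.1 ∧ -1 < p.2} := fun hf =>
      hf.comp (by fun_prop) fun p hp => hpos hp.2 hr
    exact ((((c2 hψ.continuousOn.1).neg.div_const _).mul (c1 hφ.continuousOn.1)).add
      (((c2 hφ.continuousOn.1).div_const _).mul (c1 hψ.continuousOn.1))).congr
        fun p hp => hE1 hp.1 hp.2 hr

/-! ### Growth of the modes -/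

/-- For a real solution `y` of the mode equation and `p = τ y' - y / 2`, `τ = 1 + t`, the weighted
energy `τ^(-ρ-1) (p² / (ε² + r² τ²) + y²)` is nonincreasing when `ρ = (1/4 - μ + ε²) / ε ≥ 0`.
In the variable `log τ` the function `u = τ^(-1/2) y` solves `u'' = (1/4 - μ - r² τ²) u`. -/
lemma mode_energy_antitone {μ r ε ρ : ℝ} (hε : 0 < ε) (hρ : 0 ≤ ρ)
    (hρε : ρ * ε = 1 / 4 - μ + ε ^ 2) {y y' : ℝ → ℝ}
    (hy : ∀ t : ℝ, -1 < t → HasDerivAt y (y' t) t ∧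
      HasDerivAt y' (-(r ^ 2 + μ / (1 + t) ^ 2) * y t) t) :
    AntitoneOn (fun t => (1 + t) ^ (-ρ - 1) * (((1 + t) * y' t - y t / 2) ^ 2
      / (ε ^ 2 + r ^ 2 * (1 + t) ^ 2) + y t ^ 2)) (Ioi (-1)) := by
  have hd : ∀ t ∈ Ioi (-1 : ℝ), HasDerivAt (fun t => (1 + t) ^ (-ρ - 1)
      * (((1 + t) * y' t - y t / 2) ^ 2 / (ε ^ 2 + r ^ 2 * (1 + t) ^ 2) + y t ^ 2))
      ((1 + t) ^ (-ρ - 2) * (2 * ((1 + t) * y' t - y t / 2) * y t * (ρ * ε)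
        / (ε ^ 2 + r ^ 2 * (1 + t) ^ 2) - 2 * (r ^ 2 * (1 + t) ^ 2)
        * ((1 + t) * y' t - y t / 2) ^ 2 / (ε ^ 2 + r ^ 2 * (1 + t) ^ 2) ^ 2
        - ρ * (((1 + t) * y' t - y t / 2) ^ 2 / (ε ^ 2 + r ^ 2 * (1 + t) ^ 2) + y t ^ 2))) t := by
    intro t ht
    have ht0 : 0 < 1 + t := by have : -1 < t := ht; linarith
    obtain ⟨h1, h2⟩ := hy t ht
    have hτ : HasDerivAt (fun t : ℝ => 1 + t) 1 t := (hasDerivAt_id t).const_add 1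
    have hk : ε ^ 2 + r ^ 2 * (1 + t) ^ 2 ≠ 0 := by positivity
    have hpow : HasDerivAt (fun t : ℝ => (1 + t) ^ (-ρ - 1))
        (1 * (-ρ - 1) * (1 + t) ^ (-ρ - 1 - 1)) t := hτ.rpow_const (Or.inl ht0.ne')
    have hp := (hτ.mul h2).sub (h1.div_const 2)
    have hK := ((hτ.pow 2).const_mul (r ^ 2)).const_add (ε ^ 2)
    refine (hpow.mul (((hp.pow 2).div hK hk).add (h1.pow 2))).congr_deriv ?_
    have e1 : (1 + t) ^ (-ρ - 1) = (1 + t) ^ (-ρ - 2) * (1 + t) := by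
      rw [← Real.rpow_add_one ht0.ne']; ring_nf
    have e2 : (1 + t) ^ (-ρ - 1 - 1) = (1 + t) ^ (-ρ - 2) := by ring_nf
    simp only [Pi.mul_apply, Pi.add_apply, Pi.sub_apply, Pi.pow_apply, Pi.div_apply]
    rw [e1, e2, hρε]
    field_simp
    ring
  refine antitoneOn_of_deriv_nonpos (convex_Ioi _)
    (fun t ht => (hd t ht).continuousAt.continuousWithinAt) ?_ ?_
  · rw [interior_Ioi]
    exact fun t ht => (hd t ht).differentiableAt.differentiableWithinAt
  · rw [interior_Ioi]
    intro t ht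
    have ht0 : 0 < 1 + t := by have : -1 < t := ht; linarith
    rw [(hd t ht).deriv]
    refine mul_nonpos_of_nonneg_of_nonpos (by positivity) ?_
    set p := (1 + t) * y' t - y t / 2
    set q := r ^ 2 * (1 + t) ^ 2 with hq
    have hq0 : 0 ≤ q := by positivity
    have hk : 0 < ε ^ 2 + q := by positivity
    have h1 : 2 * p * y t * (ρ * ε) / (ε ^ 2 + q) ≤ ρ * (p ^ 2 / (ε ^ 2 + q) + y t ^ 2) := by
      have h2 : 2 * p * y t * (ρ * ε) ≤ ρ * (p ^ 2 + (ε ^ 2 + q) * y t ^ 2) := by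
        have h3 := mul_nonneg hρ (sq_nonneg (p - ε * y t))
        have h4 := mul_nonneg hρ (mul_nonneg hq0 (sq_nonneg (y t)))
        linarith
      rw [div_le_iff₀ hk]
      refine h2.trans (le_of_eq ?_)
      field_simp
    have h5 : 0 ≤ 2 * q * p ^ 2 / (ε ^ 2 + q) ^ 2 := by positivity
    linarith

/-- Growth of a real solution of the mode equation from time `s` to time `t`, with a constant that does
not depend on the frequency `r`. -/
lemma mode_sq_le_real {μ r ε ρ : ℝ} (hε : 0 < ε) (hρ : 0 ≤ ρ)
    (hρε : ρ * ε = 1 / 4 - μ + ε ^ 2) {y y' : ℝ → ℝ}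
    (hy : ∀ t : ℝ, -1 < t → HasDerivAt y (y' t) t ∧
      HasDerivAt y' (-(r ^ 2 + μ / (1 + t) ^ 2) * y t) t) {s t : ℝ} (hs : -1 < s) (hst : s ≤ t) :
    y t ^ 2 ≤ ((1 + t) / (1 + s)) ^ (ρ + 1)
      * (((1 + s) * y' s - y s / 2) ^ 2 / ε ^ 2 + y s ^ 2) := by
  have hs0 : 0 < 1 + s := by linarith
  have ht0 : 0 < 1 + t := by linarith
  have h := mode_energy_antitone hε hρ hρε hy hs (show t ∈ Ioi (-1) from by
    simp only [mem_Ioi]; linarith) hst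
  simp only at h
  have h1 : y t ^ 2 ≤ ((1 + t) * y' t - y t / 2) ^ 2 / (ε ^ 2 + r ^ 2 * (1 + t) ^ 2) + y t ^ 2 :=
    le_add_of_nonneg_left (by positivity)
  have h2 : ((1 + s) * y' s - y s / 2) ^ 2 / (ε ^ 2 + r ^ 2 * (1 + s) ^ 2)
      ≤ ((1 + s) * y' s - y s / 2) ^ 2 / ε ^ 2 := by
    gcongr
    have : 0 ≤ r ^ 2 * (1 + s) ^ 2 := by positivity
    linarith
  have h3 : (1 + t) ^ (-ρ - 1) * y t ^ 2 ≤ (1 + s) ^ (-ρ - 1)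
      * (((1 + s) * y' s - y s / 2) ^ 2 / ε ^ 2 + y s ^ 2) :=
    (mul_le_mul_of_nonneg_left h1 (by positivity)).trans (h.trans
      (mul_le_mul_of_nonneg_left (by linarith) (by positivity)))
  have e : ∀ x : ℝ, 0 < x → x ^ (-ρ - 1) = (x ^ (ρ + 1))⁻¹ := fun x hx => by
    rw [← Real.rpow_neg hx.le]; ring_nf
  rw [e _ ht0, e _ hs0, inv_mul_le_iff₀ (by positivity)] at h3
  refine h3.trans (le_of_eq ?_)
  rw [Real.div_rpow ht0.le hs0.le]
  ring

lemma mode_sq_le {μ r ε ρ : ℝ} (hε : 0 < ε) (hρ : 0 ≤ ρ)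
    (hρε : ρ * ε = 1 / 4 - μ + ε ^ 2) {y y' : ℝ → ℂ} (hy : SolvesMode μ r y y')
    {s t : ℝ} (hs : -1 < s) (hst : s ≤ t) :
    ‖y t‖ ^ 2 ≤ ((1 + t) / (1 + s)) ^ (ρ + 1)
      * (‖(1 + s) * y' s - y s / 2‖ ^ 2 / ε ^ 2 + ‖y s‖ ^ 2) := by
  have hc : ∀ t : ℝ, -((r : ℂ) ^ 2 + μ / (1 + t : ℂ) ^ 2)
      = ((-(r ^ 2 + μ / (1 + t) ^ 2) : ℝ) : ℂ) := fun t => by push_cast; ring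
  have hre := mode_sq_le_real (y := fun t => (y t).re) (y' := fun t => (y' t).re) (r := r)
    hε hρ hρε (fun t ht => by
      refine ⟨Complex.reCLM.hasFDerivAt.comp_hasDerivAt t (hy t ht).1,
        (Complex.reCLM.hasFDerivAt.comp_hasDerivAt t (hy t ht).2).congr_deriv ?_⟩
      rw [hc]; simp only [Complex.reCLM_apply, Complex.re_ofReal_mul]) hs hst
  have him := mode_sq_le_real (y := fun t => (y t).im) (y' := fun t => (y' t).im) (r := r)
    hε hρ hρε (fun t ht => by
      refine ⟨Complex.imCLM.hasFDerivAt.comp_hasDerivAt t (hy t ht).1,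
        (Complex.imCLM.hasFDerivAt.comp_hasDerivAt t (hy t ht).2).congr_deriv ?_⟩
      rw [hc]; simp only [Complex.imCLM_apply, Complex.im_ofReal_mul]) hs hst
  have e : ∀ z : ℂ, ‖z‖ ^ 2 = z.re ^ 2 + z.im ^ 2 := fun z => by
    rw [Complex.sq_norm, Complex.normSq_apply]; ring
  have e1 : ((1 + s : ℂ) * y' s - y s / 2).re = (1 + s) * (y' s).re - (y s).re / 2 := by simp
  have e2 : ((1 + s : ℂ) * y' s - y s / 2).im = (1 + s) * (y' s).im - (y s).im / 2 := by simp
  rw [e, e, e, e1, e2]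
  refine (add_le_add hre him).trans (le_of_eq ?_)
  ring

/-- The logarithmic correction `1 + log (1 + t)` in the borderline case `μ = 1/4`, and `1`
otherwise. -/
def logCorr (μ t : ℝ) : ℝ := if μ = 1 / 4 then 1 + Real.log (1 + t) else 1

lemma one_le_logCorr (μ : ℝ) {t : ℝ} (ht : 0 ≤ t) : 1 ≤ logCorr μ t := by
  rw [logCorr]
  split_ifs
  · have := Real.log_nonneg (show 1 ≤ 1 + t by linarith); linarith
  · exact le_rfl

/-- A choice of the parameters `ε`, `ρ` in the energy estimate at time `t`. The growth rate
`ρ + 1 = 1 + 2 Re ν` is attained with a fixed `ε` unless `μ = 1/4`. In that case `ρ = ε > 0`, and the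
choice `ε = 1 / (1 + log (1 + t))` costs only a bounded factor and the logarithm in `1 / ε`. -/
lemma exists_energy_parameters {μ : ℝ} (hμ : 0 ≤ μ) :
    ∃ K : ℝ, 0 < K ∧ ∀ t : ℝ, 0 ≤ t → ∃ ε ρ : ℝ, 0 < ε ∧ 0 ≤ ρ ∧ ρ * ε = 1 / 4 - μ + ε ^ 2 ∧
      1 / ε ≤ K * logCorr μ t ∧ ∀ s : ℝ, 0 ≤ s → s ≤ t →
        ((1 + t) / (1 + s)) ^ (ρ + 1) ≤ Real.exp 1 * (((1 + t) / (1 + s)) ^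
          (1 / 2 + (order μ).re)) ^ 2 := by
  have hsq : ∀ (x a : ℝ), 0 ≤ x → (x ^ a) ^ 2 = x ^ (2 * a) := fun x a hx => by
    rw [← Real.rpow_natCast, ← Real.rpow_mul hx]; push_cast; ring_nf
  have hexp : (1 : ℝ) ≤ Real.exp 1 := Real.one_le_exp zero_le_one
  rcases lt_trichotomy μ (1 / 4) with h | h | h
  · have hs : 0 < Real.sqrt (1 - 4 * μ) := Real.sqrt_pos.2 (by linarith)
    have hs2 := Real.sq_sqrt (show 0 ≤ 1 - 4 * μ by linarith)
    refine ⟨1 / (Real.sqrt (1 - 4 * μ) / 2), by positivity, fun t ht =>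
      ⟨Real.sqrt (1 - 4 * μ) / 2, Real.sqrt (1 - 4 * μ), by positivity, hs.le, ?_, ?_, ?_⟩⟩
    · nlinarith
    · rw [logCorr, if_neg h.ne, mul_one]
    · intro s hs0 hst
      have hx : 0 ≤ (1 + t) / (1 + s) := by positivity
      rw [order, if_pos h.le, Complex.ofReal_re, hsq _ _ hx]
      have : Real.sqrt (1 - 4 * μ) + 1 = 2 * (1 / 2 + Real.sqrt (1 - 4 * μ) / 2) := by ring
      rw [this]
      exact le_mul_of_one_le_left (by positivity) hexp
  · subst h
    refine ⟨1, one_pos, fun t ht => ?_⟩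
    have hlog : 0 ≤ Real.log (1 + t) := Real.log_nonneg (by linarith)
    refine ⟨1 / (1 + Real.log (1 + t)), 1 / (1 + Real.log (1 + t)), by positivity,
      by positivity, by ring, ?_, ?_⟩
    · rw [logCorr, if_pos rfl, one_div_one_div, one_mul]
    · intro s hs0 hst
      have hx : 0 < (1 + t) / (1 + s) := by positivity
      rw [order_quarter, hsq _ _ hx.le, Real.rpow_add hx]
      simp only [Complex.zero_re, add_zero]
      norm_num
      refine mul_le_mul_of_nonneg_right ?_ hx.le
      rw [Real.rpow_def_of_pos hx]
      refine Real.exp_le_exp.2 ?_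
      have h1 : Real.log ((1 + t) / (1 + s)) ≤ Real.log (1 + t) := by
        refine Real.log_le_log hx (div_le_self (by linarith) (by linarith))
      rw [← div_eq_mul_inv, div_le_one (by positivity)]
      linarith
  · have hs : 0 < Real.sqrt (4 * μ - 1) := Real.sqrt_pos.2 (by linarith)
    have hs2 := Real.sq_sqrt (show 0 ≤ 4 * μ - 1 by linarith)
    refine ⟨1 / (Real.sqrt (4 * μ - 1) / 2), by positivity, fun t ht =>
      ⟨Real.sqrt (4 * μ - 1) / 2, 0, by positivity, le_rfl, ?_, ?_, ?_⟩⟩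
    · nlinarith
    · rw [logCorr, if_neg h.ne', mul_one]
    · intro s hs0 hst
      have hx : 0 ≤ (1 + t) / (1 + s) := by positivity
      rw [order, if_neg (not_le.2 h), hsq _ _ hx]
      have : (Complex.I * ((Real.sqrt (4 * μ - 1) / 2 : ℝ) : ℂ)).re = 0 := by simp
      rw [this]
      norm_num
      exact le_mul_of_one_le_left hx hexp

/-- Growth of the symbols, uniformly in the frequency. -/
lemma exists_symbol_bound {μ : ℝ} (hμ : 0 ≤ μ) :
    ∃ K : ℝ, 0 < K ∧ (∀ t r : ℝ, 0 ≤ t → 0 < r →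
        ‖symbolE0 μ t 0 r‖ ≤ K * (1 + t) ^ (1 / 2 + (order μ).re) * logCorr μ t) ∧
      ∀ t s r : ℝ, 0 ≤ s → s ≤ t → 0 < r → ‖symbolE1 μ t s r‖
        ≤ K * (1 + t) ^ (1 / 2 + (order μ).re) * (1 + s) ^ (1 / 2 - (order μ).re)
          * logCorr μ t := by
  obtain ⟨K, hK, h⟩ := exists_energy_parameters hμ
  obtain ⟨D0, D1, hD, -, -⟩ := exists_symbol_derivatives hμ
  have he : Real.exp 1 ≤ 2 ^ 2 := by
    have := Real.exp_one_lt_d9; norm_num; linarith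
  refine ⟨2 * (K + 1), by positivity, fun t r ht hr => ?_, fun t s r hs hst hr => ?_⟩
  · obtain ⟨ε, ρ, hε, hρ, hρε, hεK, hx⟩ := h t ht
    have hL := one_le_logCorr μ ht
    obtain ⟨h1, -, h2, h3, -, -⟩ := hD 0 r (by norm_num) hr
    have h4 := mode_sq_le hε hρ hρε h1 (by norm_num : (-1 : ℝ) < 0) ht
    simp only [h2, h3] at h4
    have h5 := hx 0 le_rfl ht
    simp only [add_zero, div_one] at h4 h5
    have h6 : ‖(1 + ((0 : ℝ) : ℂ)) * 0 - 1 / 2‖ ^ 2 / ε ^ 2 + ‖(1 : ℂ)‖ ^ 2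
        ≤ ((K + 1) * logCorr μ t) ^ 2 := by
      have : ‖(1 + ((0 : ℝ) : ℂ)) * 0 - 1 / 2‖ ^ 2 / ε ^ 2 + ‖(1 : ℂ)‖ ^ 2
          = 1 / 4 * (1 / ε) ^ 2 + 1 := by
        simp; ring
      rw [this]
      have h7 : (1 / ε) ^ 2 ≤ (K * logCorr μ t) ^ 2 := by gcongr
      have h8 : 1 ≤ logCorr μ t ^ 2 := one_le_pow₀ hL
      have h9 : 0 ≤ 2 * K * logCorr μ t ^ 2 := by positivity
      have h10 : 0 ≤ (1 / ε) ^ 2 := sq_nonneg _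
      linarith [show ((K + 1) * logCorr μ t) ^ 2 = (K * logCorr μ t) ^ 2
        + 2 * K * logCorr μ t ^ 2 + logCorr μ t ^ 2 by ring]
    refine abs_le_of_sq_le_sq' ?_ (by positivity) |>.2
    refine h4.trans ((mul_le_mul h5 h6 (by positivity) (by positivity)).trans ?_)
    calc Real.exp 1 * ((1 + t) ^ (1 / 2 + (order μ).re)) ^ 2 * ((K + 1) * logCorr μ t) ^ 2
        ≤ 2 ^ 2 * ((1 + t) ^ (1 / 2 + (order μ).re)) ^ 2 * ((K + 1) * logCorr μ t) ^ 2 := by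
          gcongr
      _ = _ := by ring
  · have ht : 0 ≤ t := hs.trans hst
    have hs1 : 0 < 1 + s := by linarith
    have ht1 : 0 < 1 + t := by linarith
    obtain ⟨ε, ρ, hε, hρ, hρε, hεK, hx⟩ := h t ht
    have hL := one_le_logCorr μ ht
    obtain ⟨-, h1, -, -, h2, h3⟩ := hD s r (by linarith) hr
    have h4 := mode_sq_le hε hρ hρε h1 (by linarith : (-1 : ℝ) < s) hst
    simp only [h2, h3] at h4
    have h5 := hx s hs hst
    have h6 : ‖(1 + (s : ℂ)) * 1 - 0 / 2‖ ^ 2 / ε ^ 2 + ‖(0 : ℂ)‖ ^ 2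
        ≤ ((K + 1) * logCorr μ t * (1 + s)) ^ 2 := by
      have hn : ‖(1 + (s : ℂ)) * 1 - 0 / 2‖ = 1 + s := by
        have : (1 + (s : ℂ)) * 1 - 0 / 2 = ((1 + s : ℝ) : ℂ) := by push_cast; ring
        rw [this, Complex.norm_real, Real.norm_of_nonneg hs1.le]
      have : ‖(1 + (s : ℂ)) * 1 - 0 / 2‖ ^ 2 / ε ^ 2 + ‖(0 : ℂ)‖ ^ 2
          = ((1 / ε) * (1 + s)) ^ 2 := by
        rw [hn]; simp; field_simp
      rw [this]
      have h8 : 1 / ε ≤ (K + 1) * logCorr μ t := by nlinarith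
      gcongr
    refine abs_le_of_sq_le_sq' ?_ (by positivity) |>.2
    refine h4.trans ((mul_le_mul h5 h6 (by positivity) (by positivity)).trans ?_)
    have e : (1 + s) ^ (1 / 2 - (order μ).re) = (1 + s) / (1 + s) ^ (1 / 2 + (order μ).re) := by
      rw [eq_div_iff (by positivity), ← Real.rpow_add hs1]
      norm_num
    rw [e, Real.div_rpow ht1.le hs1.le]
    calc Real.exp 1 * ((1 + t) ^ (1 / 2 + (order μ).re) / (1 + s) ^ (1 / 2 + (order μ).re)) ^ 2
          * ((K + 1) * logCorr μ t * (1 + s)) ^ 2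
        ≤ 2 ^ 2 * ((1 + t) ^ (1 / 2 + (order μ).re) / (1 + s) ^ (1 / 2 + (order μ).re)) ^ 2
          * ((K + 1) * logCorr μ t * (1 + s)) ^ 2 := by
          gcongr
      _ = _ := by ring

/-! ### Bounded radial multiplication operators -/

/-- A radial symbol: continuous on `(0, ∞)` and bounded by `B` there. -/
def GoodSymbol (m : ℝ → ℂ) (B : ℝ) : Prop :=
  ContinuousOn m (Ioi 0) ∧ ∀ r : ℝ, 0 < r → ‖m r‖ ≤ B

instance nontrivial_space {d : ℕ} [hd : Fact (3 ≤ d)] : Nontrivial (Space d) := by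
  have : Nonempty (Fin d) := ⟨⟨0, by have := hd.out; omega⟩⟩
  infer_instance

lemma freq_pos_of_ne {d : ℕ} {ξ : Space d} (h : ξ ≠ 0) : 0 < freq ξ := by
  have := norm_pos_iff.2 h
  rw [freq]; positivity

lemma continuous_freq {d : ℕ} : Continuous (freq : Space d → ℝ) := by
  unfold freq; fun_prop

lemma freq_neg {d : ℕ} (ξ : Space d) : freq (-ξ) = freq ξ := by simp [freq]

variable {d : ℕ} [hd : Fact (3 ≤ d)]

variable (d) in
lemma ae_freq_pos : ∀ᵐ ξ ∂(volume : Measure (Space d)), 0 < freq ξ := by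
  have : ∀ᵐ ξ ∂(volume : Measure (Space d)), ξ ≠ 0 := by
    simp [ae_iff]
  filter_upwards [this] with ξ hξ using freq_pos_of_ne hξ

lemma aestronglyMeasurable_comp_freq {m : ℝ → ℂ} (hm : ContinuousOn m (Ioi 0)) :
    AEStronglyMeasurable (fun ξ : Space d => m (freq ξ)) volume := by
  have h1 : ContinuousOn (fun ξ : Space d => m (freq ξ)) {0}ᶜ :=
    hm.comp continuous_freq.continuousOn fun ξ hξ => freq_pos_of_ne hξ
  have h2 := h1.aestronglyMeasurable (μ := volume) (measurableSet_singleton (0 : Space d)).compl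
  rwa [Measure.restrict_eq_self_of_ae_mem] at h2
  simp [ae_iff]

/-- The operator of multiplication by `m(|ξ|)` on `L²`, for a bounded symbol `m`
(and `0` for an unbounded one). -/
def mulL (m : ℝ → ℂ) : L2 d →L[ℂ] L2 d :=
  open Classical in
  if h : MemLp (fun ξ : Space d => m (freq ξ)) ∞ volume then
    (ContinuousLinearMap.mul ℂ ℂ).holderL volume ∞ 2 2 (h.toLp _)
  else 0

lemma GoodSymbol.memLp_top {m : ℝ → ℂ} {B : ℝ} (h : GoodSymbol m B) :
    MemLp (fun ξ : Space d => m (freq ξ)) ∞ volume := by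
  refine memLp_top_of_bound (aestronglyMeasurable_comp_freq h.1) B ?_
  filter_upwards [ae_freq_pos d] with ξ hξ using h.2 _ hξ

lemma mulL_ae {m : ℝ → ℂ} {B : ℝ} (h : GoodSymbol m B) (f : L2 d) :
    mulL m f =ᵐ[volume] fun ξ => m (freq ξ) * f ξ := by
  have hm := h.memLp_top (d := d)
  have h1 : mulL m f = (ContinuousLinearMap.mul ℂ ℂ).holder 2 (hm.toLp _) f := by
    rw [mulL, dif_pos hm]; rfl
  rw [h1]
  filter_upwards [(ContinuousLinearMap.mul ℂ ℂ).coeFn_holder (r := 2) (hm.toLp _) f,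
    hm.coeFn_toLp] with ξ h2 h3
  rw [h2, h3]; rfl

lemma norm_mulL_le {m : ℝ → ℂ} {B : ℝ} (h : GoodSymbol m B) (f : L2 d) :
    ‖mulL m f‖ ≤ B * ‖f‖ := by
  refine Lp.norm_le_mul_norm_of_ae_le_mul ?_
  filter_upwards [mulL_ae h f, ae_freq_pos d] with ξ h1 h2
  rw [h1, norm_mul]
  exact mul_le_mul_of_nonneg_right (h.2 _ h2) (norm_nonneg _)

lemma GoodSymbol.nonneg {m : ℝ → ℂ} {B : ℝ} (h : GoodSymbol m B) : 0 ≤ B :=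
  (norm_nonneg _).trans (h.2 1 one_pos)

lemma GoodSymbol.mono {m : ℝ → ℂ} {B B' : ℝ} (h : GoodSymbol m B) (hB : B ≤ B') :
    GoodSymbol m B' := ⟨h.1, fun r hr => (h.2 r hr).trans hB⟩

lemma GoodSymbol.mul {m n : ℝ → ℂ} {B B' : ℝ} (h : GoodSymbol m B) (h' : GoodSymbol n B') :
    GoodSymbol (fun r => m r * n r) (B * B') :=
  ⟨h.1.mul h'.1, fun r hr => by
    rw [norm_mul]
    exact mul_le_mul (h.2 r hr) (h'.2 r hr) (norm_nonneg _) h.nonneg⟩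

lemma GoodSymbol.add {m n : ℝ → ℂ} {B B' : ℝ} (h : GoodSymbol m B) (h' : GoodSymbol n B') :
    GoodSymbol (fun r => m r + n r) (B + B') :=
  ⟨h.1.add h'.1, fun r hr => (norm_add_le _ _).trans (add_le_add (h.2 r hr) (h'.2 r hr))⟩

lemma GoodSymbol.sub {m n : ℝ → ℂ} {B B' : ℝ} (h : GoodSymbol m B) (h' : GoodSymbol n B') :
    GoodSymbol (fun r => m r - n r) (B + B') :=
  ⟨h.1.sub h'.1, fun r hr => (norm_sub_le _ _).trans (add_le_add (h.2 r hr) (h'.2 r hr))⟩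

lemma GoodSymbol.const (c : ℂ) : GoodSymbol (fun _ => c) ‖c‖ :=
  ⟨continuousOn_const, fun _ _ => le_rfl⟩

lemma mulL_congr {m n : ℝ → ℂ} {B B' : ℝ} (h : GoodSymbol m B) (h' : GoodSymbol n B')
    (e : ∀ r : ℝ, 0 < r → m r = n r) (f : L2 d) : mulL m f = mulL n f := by
  refine Lp.ext ?_
  filter_upwards [mulL_ae h f, mulL_ae h' f, ae_freq_pos d] with ξ h1 h2 h3
  rw [h1, h2, e _ h3]

lemma mulL_mul {m n : ℝ → ℂ} {B B' : ℝ} (h : GoodSymbol m B) (h' : GoodSymbol n B') (f : L2 d) :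
    mulL (fun r => m r * n r) f = mulL m (mulL n f) := by
  refine Lp.ext ?_
  filter_upwards [mulL_ae (h.mul h') f, mulL_ae h (mulL n f), mulL_ae h' f] with ξ h1 h2 h3
  rw [h1, h2, h3, mul_assoc]

lemma mulL_add {m n : ℝ → ℂ} {B B' : ℝ} (h : GoodSymbol m B) (h' : GoodSymbol n B') (f : L2 d) :
    mulL (fun r => m r + n r) f = mulL m f + mulL n f := by
  refine Lp.ext ?_
  filter_upwards [mulL_ae (h.add h') f, mulL_ae h f, mulL_ae h' f,
    Lp.coeFn_add (mulL m f) (mulL n f)] with ξ h1 h2 h3 h4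
  rw [h1, h4, Pi.add_apply, h2, h3, add_mul]

lemma mulL_sub {m n : ℝ → ℂ} {B B' : ℝ} (h : GoodSymbol m B) (h' : GoodSymbol n B') (f : L2 d) :
    mulL (fun r => m r - n r) f = mulL m f - mulL n f := by
  refine Lp.ext ?_
  filter_upwards [mulL_ae (h.sub h') f, mulL_ae h f, mulL_ae h' f,
    Lp.coeFn_sub (mulL m f) (mulL n f)] with ξ h1 h2 h3 h4
  rw [h1, h4, Pi.sub_apply, h2, h3, sub_mul]

lemma mulL_const (c : ℂ) (f : L2 d) : mulL (fun _ => c) f = c • f := by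
  refine Lp.ext ?_
  filter_upwards [mulL_ae (GoodSymbol.const c) f, Lp.coeFn_smul c f] with ξ h1 h2
  rw [h1, h2]; rfl

lemma multiplier_eq {m : ℝ → ℂ} {B : ℝ} (h : GoodSymbol m B) (f : L2 d) :
    multiplier m f = 𝓕⁻ (mulL m (𝓕 f)) := by
  have h1 := mulL_ae h (𝓕 f)
  have h2 : MemLp (fun ξ : Space d => m (freq ξ) * (𝓕 f : L2 d) ξ) 2 volume :=
    (memLp_congr_ae h1).1 (Lp.memLp _)
  rw [multiplier, l2OfFourier, dif_pos h2]
  congr 1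
  refine Lp.ext ?_
  filter_upwards [h1, h2.coeFn_toLp] with ξ h3 h4
  rw [h3, h4]

/-- Dominated convergence in `L²`. -/
lemma tendsto_L2_of_dominated {d : ℕ} {ι : Type*} {l : Filter ι} [l.IsCountablyGenerated]
    {F : ι → L2 d} {f G : L2 d} {F' : ι → Space d → ℂ} {K : ℝ}
    (hF : ∀ᶠ i in l, ∀ᵐ ξ, F i ξ - f ξ = F' i ξ)
    (hb : ∀ᶠ i in l, ∀ᵐ ξ, ‖F' i ξ‖ ≤ K * ‖G ξ‖)
    (hlim : ∀ᵐ ξ, Tendsto (fun i => F' i ξ) l (𝓝 0)) :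
    Tendsto F l (𝓝 f) := by
  rw [Lp.tendsto_Lp_iff_tendsto_eLpNorm']
  have e : ∀ᶠ i in l, eLpNorm (⇑(F i) - ⇑f) 2 volume
      = (∫⁻ ξ, ‖F' i ξ‖ₑ ^ (2 : ℝ)) ^ (1 / 2 : ℝ) := by
    filter_upwards [hF] with i hi
    rw [eLpNorm_eq_lintegral_rpow_enorm_toReal two_ne_zero ENNReal.ofNat_ne_top]
    simp only [ENNReal.toReal_ofNat]
    congr 1
    refine lintegral_congr_ae ?_
    filter_upwards [hi] with ξ h1
    rw [Pi.sub_apply, h1]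
  refine Tendsto.congr' (EventuallyEq.symm e) ?_
  have key : Tendsto (fun i => ∫⁻ ξ, ‖F' i ξ‖ₑ ^ (2 : ℝ)) l (𝓝 (∫⁻ _ : Space d, 0)) := by
    refine tendsto_lintegral_filter_of_dominated_convergence'
      (fun ξ => (ENNReal.ofReal K * ‖G ξ‖ₑ) ^ (2 : ℝ)) ?_ ?_ ?_ ?_
    · filter_upwards [hF] with i hi
      have h1 : AEStronglyMeasurable (F' i) volume :=
        ((Lp.aestronglyMeasurable (F i)).sub (Lp.aestronglyMeasurable f)).congr hi
      exact h1.enorm.pow_const _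
    · filter_upwards [hb] with i hi
      filter_upwards [hi] with ξ hξ
      refine ENNReal.rpow_le_rpow ?_ (by norm_num)
      rw [← ofReal_norm, ← ofReal_norm, ← ENNReal.ofReal_mul' (norm_nonneg _)]
      exact ENNReal.ofReal_le_ofReal hξ
    · have h1 : ∀ ξ, (ENNReal.ofReal K * ‖G ξ‖ₑ) ^ (2 : ℝ)
          = ENNReal.ofReal K ^ (2 : ℝ) * ‖G ξ‖ₑ ^ (2 : ℝ) := fun ξ =>
        ENNReal.mul_rpow_of_nonneg _ _ (by norm_num)
      simp only [h1]
      rw [lintegral_const_mul' _ _ (ENNReal.rpow_ne_top_of_nonneg (by norm_num)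
        ENNReal.ofReal_ne_top)]
      refine ENNReal.mul_ne_top (ENNReal.rpow_ne_top_of_nonneg (by norm_num)
        ENNReal.ofReal_ne_top) ?_
      have h2 := lintegral_rpow_enorm_lt_top_of_eLpNorm_lt_top two_ne_zero ENNReal.ofNat_ne_top
        (Lp.eLpNorm_lt_top G)
      simpa using h2.ne
    · filter_upwards [hlim] with ξ hξ
      have h2 := (hξ.enorm).ennrpow_const 2
      simpa using h2
  have h3 := key.ennrpow_const (1 / 2)
  simpa using h3

/-- Strong convergence of the multiplication operators, by dominated convergence. -/
lemma tendsto_mulL {ι : Type*} {l : Filter ι} [l.IsCountablyGenerated] {m : ι → ℝ → ℂ}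
    {n : ℝ → ℂ} {B : ℝ} (hm : ∀ᶠ i in l, GoodSymbol (m i) B) (hn : GoodSymbol n B)
    (hlim : ∀ r : ℝ, 0 < r → Tendsto (fun i => m i r) l (𝓝 (n r))) (f : L2 d) :
    Tendsto (fun i => mulL (m i) f) l (𝓝 (mulL n f)) := by
  refine tendsto_L2_of_dominated (G := f) (K := B + B)
    (F' := fun i ξ => (m i (freq ξ) - n (freq ξ)) * f ξ) ?_ ?_ ?_
  · filter_upwards [hm] with i hi
    filter_upwards [mulL_ae hi f, mulL_ae hn f] with ξ h1 h2
    rw [h1, h2, sub_mul]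
  · filter_upwards [hm] with i hi
    filter_upwards [ae_freq_pos d] with ξ hξ
    rw [norm_mul]
    exact mul_le_mul_of_nonneg_right ((hi.sub hn).2 _ hξ) (norm_nonneg _)
  · filter_upwards [ae_freq_pos d] with ξ hξ
    have h1 := ((hlim _ hξ).sub_const (n (freq ξ))).mul_const (f ξ)
    rwa [sub_self, zero_mul] at h1

lemma tendsto_mulL_apply {ι : Type*} {l : Filter ι} [l.IsCountablyGenerated] {m : ι → ℝ → ℂ}
    {n : ℝ → ℂ} {B : ℝ} (hm : ∀ᶠ i in l, GoodSymbol (m i) B) (hn : GoodSymbol n B)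
    (hlim : ∀ r : ℝ, 0 < r → Tendsto (fun i => m i r) l (𝓝 (n r))) {g : ι → L2 d} {f : L2 d}
    (hg : Tendsto g l (𝓝 f)) :
    Tendsto (fun i => mulL (m i) (g i)) l (𝓝 (mulL n f)) := by
  have h1 := tendsto_mulL hm hn hlim f
  have h2 : Tendsto (fun i => mulL (m i) (g i - f)) l (𝓝 0) := by
    refine squeeze_zero_norm' (a := fun i => B * ‖g i - f‖) ?_ ?_
    · filter_upwards [hm] with i hi using norm_mulL_le hi _
    · have h3 := ((hg.sub_const f).norm).const_mul B
      simpa using h3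
  have h4 := h2.add h1
  simpa using h4

lemma continuousOn_mulL {X : Type*} [TopologicalSpace X] [FirstCountableTopology X] {S : Set X}
    {m : X → ℝ → ℂ} {B : ℝ} (hm : ∀ x ∈ S, GoodSymbol (m x) B)
    (hc : ∀ r : ℝ, 0 < r → ContinuousOn (fun x => m x r) S) {g : X → L2 d}
    (hg : ContinuousOn g S) : ContinuousOn (fun x => mulL (m x) (g x)) S := fun x hx =>
  tendsto_mulL_apply (eventually_mem_nhdsWithin.mono hm) (hm x hx) (fun r hr => hc r hr x hx)
    (hg x hx)

lemma hasDerivAt_mulL {m m' : ℝ → ℝ → ℂ} {a b B : ℝ} (hm : ∀ σ ∈ Icc a b, GoodSymbol (m σ) B)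
    (hm' : ∀ σ ∈ Icc a b, GoodSymbol (m' σ) B)
    (hd' : ∀ r : ℝ, 0 < r → ∀ σ ∈ Icc a b, HasDerivAt (fun σ => m σ r) (m' σ r) σ)
    (f : L2 d) {σ : ℝ} (hσ : σ ∈ Ioo a b) :
    HasDerivAt (fun σ => mulL (m σ) f) (mulL (m' σ) f) σ := by
  have hσ' := Ioo_subset_Icc_self hσ
  rw [hasDerivAt_iff_tendsto_slope]
  have hslope : ∀ τ ∈ Icc a b, GoodSymbol (fun r => ((τ - σ : ℝ) : ℂ)⁻¹ * (m τ r - m σ r)) B := by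
    intro τ hτ
    refine ⟨continuousOn_const.mul ((hm τ hτ).1.sub (hm σ hσ').1), fun r hr => ?_⟩
    have h1 := (convex_Icc a b).norm_image_sub_le_of_norm_hasDerivWithin_le
      (fun x hx => (hd' r hr x hx).hasDerivWithinAt) (fun x hx => (hm' x hx).2 r hr) hσ' hτ
    rw [norm_mul, norm_inv, Complex.norm_real]
    rcases eq_or_ne τ σ with h | h
    · simp [h, (hm σ hσ').nonneg]
    · rw [inv_mul_le_iff₀ (norm_pos_iff.2 (sub_ne_zero.2 h)), mul_comm]
      exact h1
  have hgoodc : ∀ τ ∈ Icc a b, GoodSymbol (fun r => m τ r - m σ r) (B + B) := fun τ hτ =>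
    (hm τ hτ).sub (hm σ hσ')
  have hev : ∀ᶠ τ in 𝓝[≠] σ, τ ∈ Icc a b := nhdsWithin_le_nhds (Icc_mem_nhds hσ.1 hσ.2)
  refine Tendsto.congr' ?_ (tendsto_mulL (l := 𝓝[≠] σ)
    (m := fun τ r => ((τ - σ : ℝ) : ℂ)⁻¹ * (m τ r - m σ r)) (hev.mono hslope) (hm' σ hσ')
    (fun r hr => ?_) f)
  · filter_upwards [hev] with τ hτ
    rw [mulL_mul (GoodSymbol.const _) (hgoodc τ hτ), mulL_const,
      mulL_sub (hm τ hτ) (hm σ hσ'), slope_def_module]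
    rw [← Complex.ofReal_inv, Complex.coe_smul]
    rfl
  · have h2 := (hd' r hr σ hσ').tendsto_slope
    refine h2.congr fun τ => ?_
    rw [slope_def_module, ← Complex.ofReal_inv, Complex.real_smul]

/-- The fundamental theorem of calculus for a family of multiplication operators. -/
lemma integral_mulL {m m' : ℝ → ℝ → ℂ} {a b B : ℝ} (hab : a ≤ b)
    (hm : ∀ σ ∈ Icc a b, GoodSymbol (m σ) B) (hm' : ∀ σ ∈ Icc a b, GoodSymbol (m' σ) B)
    (hd' : ∀ r : ℝ, 0 < r → ∀ σ ∈ Icc a b, HasDerivAt (fun σ => m σ r) (m' σ r) σ)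
    (hc : ∀ r : ℝ, 0 < r → ContinuousOn (fun σ => m' σ r) (Icc a b)) (f : L2 d) :
    ∫ σ in a..b, mulL (m' σ) f = mulL (m b) f - mulL (m a) f := by
  refine intervalIntegral.integral_eq_sub_of_hasDerivAt_of_le hab ?_
    (fun σ hσ => hasDerivAt_mulL hm hm' hd' f hσ) ?_
  · exact continuousOn_mulL hm (fun r hr σ hσ => (hd' r hr σ hσ).continuousAt.continuousWithinAt)
      continuousOn_const
  · refine ContinuousOn.intervalIntegrable ?_
    rw [uIcc_of_le hab]
    exact continuousOn_mulL hm' hc continuousOn_const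

/-! ### Iterated time integrals -/

/-- Fubini's theorem on the triangle `0 < s ≤ σ ≤ t`. -/
lemma integral_triangle_swap {H : Type*} [NormedAddCommGroup H] [NormedSpace ℝ H]
    {f : ℝ → ℝ → H} {t : ℝ} (ht : 0 ≤ t)
    (hf : Integrable (indicator {p : ℝ × ℝ | 0 < p.2 ∧ p.2 ≤ p.1 ∧ p.1 ≤ t}
      (fun p => f p.1 p.2)) (volume.prod volume)) :
    ∫ σ in (0 : ℝ)..t, ∫ s in (0 : ℝ)..σ, f σ s = ∫ s in (0 : ℝ)..t, ∫ σ in s..t, f σ s := by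
  set T : Set (ℝ × ℝ) := {p : ℝ × ℝ | 0 < p.2 ∧ p.2 ≤ p.1 ∧ p.1 ≤ t} with hT
  have hswap := integral_integral_swap
    (f := fun σ s : ℝ => indicator T (fun p => f p.1 p.2) (σ, s)) hf
  have h1 : ∫ σ in (0 : ℝ)..t, ∫ s in (0 : ℝ)..σ, f σ s
      = ∫ σ, ∫ s, indicator T (fun p => f p.1 p.2) (σ, s) := by
    rw [intervalIntegral.integral_of_le ht, ← integral_indicator measurableSet_Ioc]
    refine integral_congr_ae (Eventually.of_forall fun σ => ?_)
    by_cases hσ : σ ∈ Ioc 0 t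
    · simp only [indicator_of_mem hσ]
      rw [intervalIntegral.integral_of_le hσ.1.le, ← integral_indicator measurableSet_Ioc]
      refine integral_congr_ae (Eventually.of_forall fun s => ?_)
      by_cases hs : s ∈ Ioc 0 σ
      · have : (σ, s) ∈ T := ⟨hs.1, hs.2, hσ.2⟩
        simp only [indicator_of_mem hs, indicator_of_mem this]
      · have : (σ, s) ∉ T := fun h => hs ⟨h.1, h.2.1⟩
        simp only [indicator_of_notMem hs, indicator_of_notMem this]
    · simp only [indicator_of_notMem hσ]
      have : ∀ s, (σ, s) ∉ T := fun s h => hσ ⟨h.1.trans_le h.2.1, h.2.2⟩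
      simp only [indicator_of_notMem (this _), integral_zero]
  have h2 : ∫ s in (0 : ℝ)..t, ∫ σ in s..t, f σ s
      = ∫ s, ∫ σ, indicator T (fun p => f p.1 p.2) (σ, s) := by
    rw [intervalIntegral.integral_of_le ht, ← integral_indicator measurableSet_Ioc]
    refine integral_congr_ae (Eventually.of_forall fun s => ?_)
    by_cases hs : s ∈ Ioc 0 t
    · simp only [indicator_of_mem hs]
      rw [intervalIntegral.integral_of_le hs.2, ← integral_Icc_eq_integral_Ioc,
        ← integral_indicator measurableSet_Icc]
      refine integral_congr_ae (Eventually.of_forall fun σ => ?_)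
      by_cases hσ : σ ∈ Icc s t
      · have : (σ, s) ∈ T := ⟨hs.1, hσ.1, hσ.2⟩
        simp only [indicator_of_mem hσ, indicator_of_mem this]
      · have : (σ, s) ∉ T := fun h => hσ ⟨h.2.1, h.2.2⟩
        simp only [indicator_of_notMem hσ, indicator_of_notMem this]
    · simp only [indicator_of_notMem hs]
      have : ∀ σ, (σ, s) ∉ T := fun σ h => hs ⟨h.1, h.2.1.trans h.2.2⟩
      simp only [indicator_of_notMem (this _), integral_zero]
  rw [h1, h2, hswap]

lemma aestronglyMeasurable_comp_pair {α X E F : Type*} [MeasurableSpace α] {μ : Measure α}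
    [TopologicalSpace X] [TopologicalSpace E] [TopologicalSpace F] {Φ : X → E → F}
    (hΦ : Continuous fun p : X × E => Φ p.1 p.2) {u : α → X} {n : α → E}
    (hu : AEStronglyMeasurable u μ) (hn : AEStronglyMeasurable n μ) :
    AEStronglyMeasurable (fun a => Φ (u a) (n a)) μ :=
  hΦ.comp_aestronglyMeasurable (hu.prodMk hn)

/-- The closed triangle `0 ≤ s ≤ σ ≤ t` in the `(σ, s)` plane. -/
def triangle (t : ℝ) : Set (ℝ × ℝ) := {p | 0 ≤ p.2 ∧ p.2 ≤ p.1 ∧ p.1 ≤ t}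

/-- A continuous retraction of the plane onto the triangle. -/
def clampTriangle (t : ℝ) (p : ℝ × ℝ) : ℝ × ℝ :=
  (max (min (max p.1 0) t) (min (max p.2 0) t), min (max p.2 0) t)

lemma clampTriangle_mem {t : ℝ} (ht : 0 ≤ t) (p : ℝ × ℝ) : clampTriangle t p ∈ triangle t :=
  ⟨le_min (le_max_right _ _) ht, le_max_right _ _, max_le (min_le_right _ _) (min_le_right _ _)⟩

lemma clampTriangle_eq {t : ℝ} {p : ℝ × ℝ} (hp : p ∈ triangle t) : clampTriangle t p = p := by
  obtain ⟨h1, h2, h3⟩ := hp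
  have h4 : 0 ≤ p.1 := h1.trans h2
  have h5 : p.2 ≤ t := h2.trans h3
  rw [clampTriangle, max_eq_left h4, max_eq_left h1, min_eq_left h3, min_eq_left h5,
    max_eq_left h2]

lemma continuous_clampTriangle (t : ℝ) : Continuous (clampTriangle t) := by
  unfold clampTriangle; fun_prop

/-- A strongly continuous bounded operator kernel applied to an integrable function is
integrable on the triangle. -/
lemma integrable_triangle_mulL {m : ℝ → ℝ → ℝ → ℂ} {t B : ℝ} (ht : 0 ≤ t)
    (hm : ∀ p ∈ triangle t, GoodSymbol (m p.1 p.2) B)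
    (hc : ∀ r : ℝ, 0 < r → ContinuousOn (fun p : ℝ × ℝ => m p.1 p.2 r) (triangle t))
    {n : ℝ → L2 d} (hn : IntervalIntegrable n volume 0 t) :
    Integrable (indicator {p : ℝ × ℝ | 0 < p.2 ∧ p.2 ≤ p.1 ∧ p.1 ≤ t}
      (fun p => mulL (m p.1 p.2) (n p.2))) (volume.prod volume) := by
  set T : Set (ℝ × ℝ) := {p : ℝ × ℝ | 0 < p.2 ∧ p.2 ≤ p.1 ∧ p.1 ≤ t} with hT
  have hTsub : T ⊆ triangle t := fun p hp => ⟨hp.1.le, hp.2⟩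
  have hTm : MeasurableSet T :=
    (measurableSet_lt measurable_const measurable_snd).inter
      ((measurableSet_le measurable_snd measurable_fst).inter
        (measurableSet_le measurable_fst measurable_const))
  set n' : ℝ → L2 d := indicator (Ioc 0 t) n with hn'
  have hn'i : Integrable n' volume := by
    rw [hn', integrable_indicator_iff measurableSet_Ioc]
    exact (intervalIntegrable_iff_integrableOn_Ioc_of_le ht).1 hn
  have hΦ : Continuous fun p : (ℝ × ℝ) × L2 d =>
      mulL (m (clampTriangle t p.1).1 (clampTriangle t p.1).2) p.2 := by
    rw [← continuousOn_univ]
    refine continuousOn_mulL (B := B) (m := fun p : (ℝ × ℝ) × L2 d =>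
      m (clampTriangle t p.1).1 (clampTriangle t p.1).2)
      (fun p _ => hm _ (clampTriangle_mem ht _)) (fun r hr => ?_) continuous_snd.continuousOn
    exact (hc r hr).comp ((continuous_clampTriangle t).comp continuous_fst).continuousOn
      fun p _ => clampTriangle_mem ht _
  have hmeas : AEStronglyMeasurable (fun p : ℝ × ℝ =>
      mulL (m (clampTriangle t p).1 (clampTriangle t p).2) (n' p.2)) (volume.prod volume) :=
    aestronglyMeasurable_comp_pair (Φ := fun (p : ℝ × ℝ) (x : L2 d) =>
      mulL (m (clampTriangle t p).1 (clampTriangle t p).2) x) hΦ aestronglyMeasurable_id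
      hn'i.aestronglyMeasurable.comp_snd
  have heq : indicator T (fun p : ℝ × ℝ => mulL (m p.1 p.2) (n p.2))
      = indicator T (fun p : ℝ × ℝ =>
        mulL (m (clampTriangle t p).1 (clampTriangle t p).2) (n' p.2)) := by
    refine indicator_congr fun p hp => ?_
    have : p.2 ∈ Ioc 0 t := ⟨hp.1, hp.2.1.trans hp.2.2⟩
    rw [clampTriangle_eq (hTsub hp), hn', indicator_of_mem this]
  rw [heq]
  have hdom : Integrable (fun p : ℝ × ℝ =>
      (indicator (Ioc 0 t) (fun _ => B) p.1) * ‖n' p.2‖) (volume.prod volume) := by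
    refine Integrable.mul_prod (f := indicator (Ioc 0 t) (fun _ => B)) ?_ hn'i.norm
    rw [integrable_indicator_iff measurableSet_Ioc]
    simp [integrableOn_const_iff]
  refine hdom.mono' (hmeas.indicator hTm) (Eventually.of_forall fun p => ?_)
  by_cases hp : p ∈ T
  · have : p.1 ∈ Ioc 0 t := ⟨hp.1.trans_le hp.2.1, hp.2.2⟩
    rw [indicator_of_mem hp, indicator_of_mem this]
    exact norm_mulL_le (hm _ (clampTriangle_mem ht _)) _
  · rw [indicator_of_notMem hp, norm_zero]
    refine mul_nonneg (indicator_nonneg (fun _ _ => ?_) _) (norm_nonneg _)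
    exact (hm _ (clampTriangle_mem ht (0, 0))).nonneg

lemma integral_triangle_mulL {m : ℝ → ℝ → ℝ → ℂ} {t B : ℝ} (ht : 0 ≤ t)
    (hm : ∀ p ∈ triangle t, GoodSymbol (m p.1 p.2) B)
    (hc : ∀ r : ℝ, 0 < r → ContinuousOn (fun p : ℝ × ℝ => m p.1 p.2 r) (triangle t))
    {n : ℝ → L2 d} (hn : IntervalIntegrable n volume 0 t) :
    ∫ σ in (0 : ℝ)..t, ∫ s in (0 : ℝ)..σ, mulL (m σ s) (n s)
      = ∫ s in (0 : ℝ)..t, ∫ σ in s..t, mulL (m σ s) (n s) :=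
  integral_triangle_swap (f := fun σ s => mulL (m σ s) (n s)) ht
    (integrable_triangle_mulL ht hm hc hn)

/-- A strongly continuous bounded family of operators preserves integrability in time. -/
lemma intervalIntegrable_mulL {m : ℝ → ℝ → ℂ} {t B : ℝ} (ht : 0 ≤ t)
    (hm : ∀ s ∈ Icc 0 t, GoodSymbol (m s) B)
    (hc : ∀ r : ℝ, 0 < r → ContinuousOn (fun s => m s r) (Icc 0 t))
    {n : ℝ → L2 d} (hn : IntervalIntegrable n volume 0 t) :
    IntervalIntegrable (fun s => mulL (m s) (n s)) volume 0 t := by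
  rw [intervalIntegrable_iff_integrableOn_Ioc_of_le ht] at hn ⊢
  have hcl : ∀ s : ℝ, min (max s 0) t ∈ Icc 0 t := fun s =>
    ⟨le_min (le_max_right _ _) ht, min_le_right _ _⟩
  have hceq : ∀ s ∈ Ioc 0 t, min (max s 0) t = s := fun s hs => by
    rw [max_eq_left hs.1.le, min_eq_left hs.2]
  have hΦ : Continuous fun p : ℝ × L2 d => mulL (m (min (max p.1 0) t)) p.2 := by
    rw [← continuousOn_univ]
    refine continuousOn_mulL (B := B) (m := fun p : ℝ × L2 d => m (min (max p.1 0) t))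
      (fun p _ => hm _ (hcl _)) (fun r hr => ?_) continuous_snd.continuousOn
    exact (hc r hr).comp (by fun_prop) fun p _ => hcl _
  have hmeas : AEStronglyMeasurable (fun s : ℝ => mulL (m (min (max s 0) t)) (n s))
      (volume.restrict (Ioc 0 t)) :=
    aestronglyMeasurable_comp_pair (Φ := fun (s : ℝ) (x : L2 d) => mulL (m (min (max s 0) t)) x)
      hΦ aestronglyMeasurable_id hn.aestronglyMeasurable
  have hmeas' : AEStronglyMeasurable (fun s : ℝ => mulL (m s) (n s))
      (volume.restrict (Ioc 0 t)) := by
    refine hmeas.congr ?_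
    filter_upwards [ae_restrict_mem measurableSet_Ioc] with s hs
    rw [hceq s hs]
  refine (hn.norm.const_mul B).mono' hmeas' ?_
  filter_upwards [ae_restrict_mem measurableSet_Ioc] with s hs
  exact norm_mulL_le (hm s (Ioc_subset_Icc_self hs)) _

/-! ### Comparison with the free wave propagator -/

/-- The symbol of `cos (t|∇|)`. -/
def cosS (t r : ℝ) : ℂ := (Real.cos (t * r) : ℝ)

/-- The symbol of `sin (t|∇|)`. -/
def sinS (t r : ℝ) : ℂ := (Real.sin (t * r) : ℝ)

/-- The symbol of `|∇|⁻¹ sin (t|∇|)`. -/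
def sincS (t r : ℝ) : ℂ := (Real.sin (t * r) / r : ℝ)

lemma goodSymbol_cosS (t : ℝ) : GoodSymbol (cosS t) 1 := by
  refine ⟨?_, fun r _ => ?_⟩
  · unfold cosS; fun_prop
  · rw [cosS, Complex.norm_real]; exact Real.abs_cos_le_one _

lemma goodSymbol_sinS (t : ℝ) : GoodSymbol (sinS t) 1 := by
  refine ⟨?_, fun r _ => ?_⟩
  · unfold sinS; fun_prop
  · rw [sinS, Complex.norm_real]; exact Real.abs_sin_le_one _

lemma goodSymbol_sincS (t : ℝ) : GoodSymbol (sincS t) |t| := by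
  refine ⟨?_, fun r hr => ?_⟩
  · unfold sincS
    refine Complex.continuous_ofReal.comp_continuousOn (ContinuousOn.div (by fun_prop) (by fun_prop)
      fun r hr => ne_of_gt hr)
  · rw [sincS, Complex.norm_real, Real.norm_eq_abs, abs_div, abs_of_pos hr, div_le_iff₀ hr]
    refine Real.abs_sin_le_abs.trans ?_
    rw [abs_mul, abs_of_pos hr]

lemma hasDerivAt_cosS (t r σ : ℝ) :
    HasDerivAt (fun σ => cosS (t - σ) r) (r * sinS (t - σ) r) σ := by
  have h1 : HasDerivAt (fun σ : ℝ => (t - σ) * r) (-1 * r) σ :=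
    ((hasDerivAt_id σ).const_sub t).mul_const r
  refine h1.cos.ofReal_comp.congr_deriv ?_
  rw [sinS]; push_cast; ring

lemma hasDerivAt_sincS (t σ : ℝ) {r : ℝ} (hr : 0 < r) :
    HasDerivAt (fun σ => sincS (t - σ) r) (-cosS (t - σ) r) σ := by
  have h1 : HasDerivAt (fun σ : ℝ => (t - σ) * r) (-1 * r) σ :=
    ((hasDerivAt_id σ).const_sub t).mul_const r
  refine (h1.sin.div_const r).ofReal_comp.congr_deriv ?_
  have hr' : (r : ℂ) ≠ 0 := by exact_mod_cast hr.ne'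
  rw [cosS]; push_cast; field_simp

lemma r_mul_sincS (t : ℝ) {r : ℝ} (hr : 0 < r) : (r : ℂ) * sincS t r = sinS t r := by
  have hr' : (r : ℂ) ≠ 0 := by exact_mod_cast hr.ne'
  rw [sincS, sinS]; push_cast; field_simp

/-- The coefficient of the mass term. -/
def massCoeff (μ s : ℝ) : ℂ := ((μ / (1 + s) ^ 2 : ℝ) : ℂ)

lemma norm_massCoeff_le {μ s : ℝ} (hμ : 0 ≤ μ) (hs : 0 ≤ s) : ‖massCoeff μ s‖ ≤ μ := by
  rw [massCoeff, Complex.norm_real, Real.norm_of_nonneg (by positivity)]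
  exact div_le_self hμ (one_le_pow₀ (by linarith))

lemma continuousOn_massCoeff (μ : ℝ) : ContinuousOn (massCoeff μ) (Ici 0) := by
  unfold massCoeff
  refine Complex.continuous_ofReal.comp_continuousOn (ContinuousOn.div (by fun_prop) (by fun_prop)
    fun s hs => ?_)
  have : (0 : ℝ) ≤ s := hs
  positivity

/-- Duhamel's formula for the free wave equation, for a family of modes: the mass term is
treated as a forcing. -/
lemma mulL_mode_eq {μ s t B B₀ : ℝ} (hμ : 0 ≤ μ) (hs : 0 ≤ s) (hst : s ≤ t) {y y' : ℝ → ℝ → ℂ}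
    (hy : ∀ r : ℝ, 0 < r → SolvesMode μ r (fun σ => y σ r) (fun σ => y' σ r))
    (hyg : ∀ σ ∈ Icc s t, GoodSymbol (y σ) B)
    (hy'c : ∀ σ ∈ Icc s t, ContinuousOn (y' σ) (Ioi 0))
    (h0 : ∀ r : ℝ, 0 < r → ‖cosS (t - s) r * y s r + sincS (t - s) r * y' s r‖ ≤ B₀)
    (f : L2 d) :
    mulL (y t) f = mulL (fun r => cosS (t - s) r * y s r + sincS (t - s) r * y' s r) f
      - ∫ σ in s..t, mulL (fun r => sincS (t - σ) r * (massCoeff μ σ * y σ r)) f := by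
  set m : ℝ → ℝ → ℂ := fun σ r => cosS (t - σ) r * y σ r + sincS (t - σ) r * y' σ r with hm
  set m' : ℝ → ℝ → ℂ := fun σ r => -1 * (sincS (t - σ) r * (massCoeff μ σ * y σ r)) with hm'
  have hσ0 : ∀ σ ∈ Icc s t, -1 < σ := fun σ hσ => by linarith [hσ.1]
  have hB : 0 ≤ B := (hyg s ⟨le_rfl, hst⟩).nonneg
  have hk : ∀ σ ∈ Icc s t,
      GoodSymbol (fun r => sincS (t - σ) r * (massCoeff μ σ * y σ r)) (t * (μ * B)) := by
    intro σ hσ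
    refine (((goodSymbol_sincS (t - σ)).mul ((GoodSymbol.const (massCoeff μ σ)).mul
      (hyg σ hσ)))).mono ?_
    have h1 : |t - σ| ≤ t := by rw [abs_of_nonneg (by linarith [hσ.2])]; linarith [hσ.1]
    have h2 := norm_massCoeff_le hμ (hs.trans hσ.1)
    have h3 : 0 ≤ t := hs.trans hst
    gcongr
  have hmc : ∀ σ ∈ Icc s t, ContinuousOn (m σ) (Ioi 0) := fun σ hσ =>
    ((goodSymbol_cosS (t - σ)).1.mul (hyg σ hσ).1).add ((goodSymbol_sincS _).1.mul (hy'c σ hσ))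
  have hder : ∀ r : ℝ, 0 < r → ∀ σ ∈ Icc s t, HasDerivAt (fun σ => m σ r) (m' σ r) σ := by
    intro r hr σ hσ
    obtain ⟨h1, h2⟩ := hy r hr σ (hσ0 σ hσ)
    refine (((hasDerivAt_cosS t r σ).mul h1).add ((hasDerivAt_sincS t σ hr).mul h2)).congr_deriv ?_
    have := r_mul_sincS (t - σ) hr
    simp only [hm', massCoeff]
    push_cast
    linear_combination (-(r * y σ r)) * this
  have hm'g : ∀ σ ∈ Icc s t, GoodSymbol (m' σ) (t * (μ * B)) := fun σ hσ =>
    ((GoodSymbol.const (-1)).mul (hk σ hσ)).mono (by simp)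
  have hmg : ∀ σ ∈ Icc s t, GoodSymbol (m σ) (B₀ + t * (μ * B) * t + t * (μ * B)) := by
    intro σ hσ
    refine ⟨hmc σ hσ, fun r hr => ?_⟩
    have h1 := (convex_Icc s t).norm_image_sub_le_of_norm_hasDerivWithin_le
      (fun x hx => (hder r hr x hx).hasDerivWithinAt) (fun x hx => (hm'g x hx).2 r hr)
      ⟨le_rfl, hst⟩ hσ
    have h2 : ‖σ - s‖ ≤ t := by
      rw [Real.norm_of_nonneg (by linarith [hσ.1])]; linarith [hσ.2]
    have h3 : 0 ≤ t * (μ * B) := by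
      have := hs.trans hst
      positivity
    have h4 : ‖m σ r‖ ≤ ‖m s r‖ + ‖m σ r - m s r‖ := by
      have := norm_add_le (m s r) (m σ r - m s r)
      rwa [add_sub_cancel] at this
    have h5 := h0 r hr
    have h6 : t * (μ * B) * ‖σ - s‖ ≤ t * (μ * B) * t := by gcongr
    have h7 : ‖m s r‖ ≤ B₀ := h5
    linarith
  have hyc : ∀ r : ℝ, 0 < r → ContinuousOn (fun σ => m' σ r) (Icc s t) := by
    intro r hr
    refine continuousOn_const.mul (ContinuousOn.mul ?_ (ContinuousOn.mul ?_ ?_))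
    · exact fun σ _ => (hasDerivAt_sincS t σ hr).continuousAt.continuousWithinAt
    · exact (continuousOn_massCoeff μ).mono fun σ hσ => hs.trans hσ.1
    · exact fun σ hσ => ((hy r hr σ (hσ0 σ hσ)).1).continuousAt.continuousWithinAt
  have hm'g' : ∀ σ ∈ Icc s t, GoodSymbol (m' σ) (B₀ + t * (μ * B) * t + t * (μ * B)) := by
    intro σ hσ
    refine (hm'g σ hσ).mono ?_
    have h1 : 0 ≤ B₀ := (norm_nonneg _).trans (h0 1 one_pos)
    have h3 : 0 ≤ t * (μ * B) * t := by
      have := hs.trans hst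
      positivity
    linarith
  have key := integral_mulL hst hmg hm'g' hder hyc f
  have e1 : ∫ σ in s..t, mulL (m' σ) f
      = -∫ σ in s..t, mulL (fun r => sincS (t - σ) r * (massCoeff μ σ * y σ r)) f := by
    rw [← intervalIntegral.integral_neg]
    refine intervalIntegral.integral_congr fun σ hσ => ?_
    rw [uIcc_of_le hst] at hσ
    simp only [hm']
    rw [mulL_mul (GoodSymbol.const (-1)) (hk σ hσ), mulL_const, neg_one_smul]
  have e2 : mulL (m t) f = mulL (y t) f := by
    refine mulL_congr (hmg t ⟨hst, le_rfl⟩) (hyg t ⟨hst, le_rfl⟩) (fun r _ => ?_) f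
    simp [hm, cosS, sincS]
  rw [e1, e2] at key
  rw [sub_eq_add_neg, key]
  abel

/-! ### Duhamel's formula with the mass term as a forcing -/

lemma logCorr_mono (μ : ℝ) {t T : ℝ} (ht : 0 ≤ t) (htT : t ≤ T) : logCorr μ t ≤ logCorr μ T := by
  rw [logCorr, logCorr]
  split_ifs
  · gcongr
  · exact le_rfl

/-- The symbols of the propagator are bounded on bounded time intervals. -/
lemma exists_goodSymbol {μ : ℝ} (hμ : 0 ≤ μ) (T : ℝ) : ∃ B : ℝ,
    (∀ t ∈ Icc 0 T, GoodSymbol (symbolE0 μ t 0) B) ∧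
      ∀ p ∈ triangle T, GoodSymbol (symbolE1 μ p.1 p.2) B := by
  obtain ⟨K, hK, h0, h1⟩ := exists_symbol_bound hμ
  obtain ⟨D0, D1, -, hc, -⟩ := exists_symbol_derivatives hμ
  have hν := abs_le.1 (abs_re_order_le hμ)
  have ha : 0 ≤ 1 / 2 + (order μ).re := by linarith [hν.1]
  have hb : 0 ≤ 1 / 2 - (order μ).re := by linarith [hν.2]
  refine ⟨K * (1 + T) ^ (1 / 2 + (order μ).re) * (1 + T) ^ (1 / 2 - (order μ).re)
    * logCorr μ T, fun t ht => ⟨(hc t 0 (by linarith [ht.1]) (by norm_num)).1, fun r hr => ?_⟩,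
    fun p hp => ⟨(hc p.1 p.2 (by linarith [hp.1, hp.2.1]) (by linarith [hp.1])).2.1,
      fun r hr => ?_⟩⟩
  · have hT : 0 ≤ T := ht.1.trans ht.2
    have h2 := logCorr_mono μ ht.1 ht.2
    have h3 := one_le_logCorr μ ht.1
    have h4 : (1 + t) ^ (1 / 2 + (order μ).re) ≤ (1 + T) ^ (1 / 2 + (order μ).re) :=
      Real.rpow_le_rpow (by linarith [ht.1]) (by linarith [ht.2]) ha
    have h5 : 1 ≤ (1 + T) ^ (1 / 2 - (order μ).re) := Real.one_le_rpow (by linarith) hb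
    calc ‖symbolE0 μ t 0 r‖ ≤ K * (1 + t) ^ (1 / 2 + (order μ).re) * logCorr μ t := h0 t r ht.1 hr
      _ ≤ K * (1 + T) ^ (1 / 2 + (order μ).re) * logCorr μ T := by
        gcongr
      _ ≤ K * (1 + T) ^ (1 / 2 + (order μ).re) * (1 + T) ^ (1 / 2 - (order μ).re)
          * logCorr μ T := by
        refine mul_le_mul_of_nonneg_right ?_ (by linarith)
        exact le_mul_of_one_le_right (by positivity) h5
  · have ht := hp.1.trans hp.2.1
    have hT : 0 ≤ T := ht.trans hp.2.2
    have h2 := logCorr_mono μ ht hp.2.2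
    have h3 := one_le_logCorr μ ht
    refine (h1 p.1 p.2 r hp.1 hp.2.1 hr).trans ?_
    have h4 : (1 + p.1) ^ (1 / 2 + (order μ).re) ≤ (1 + T) ^ (1 / 2 + (order μ).re) :=
      Real.rpow_le_rpow (by linarith) (by linarith [hp.2.2]) ha
    have h5 : (1 + p.2) ^ (1 / 2 - (order μ).re) ≤ (1 + T) ^ (1 / 2 - (order μ).re) :=
      Real.rpow_le_rpow (by linarith [hp.1]) (by linarith [hp.2.1, hp.2.2]) hb
    have h6 : 0 ≤ (1 + p.2) ^ (1 / 2 - (order μ).re) :=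
      Real.rpow_nonneg (by linarith [hp.1]) _
    gcongr

/-- The propagator `𝓔₀` in terms of that of the wave equation. -/
lemma mulL_symbolE0_eq {μ t : ℝ} (hμ : 0 ≤ μ) (ht : 0 ≤ t) (f : L2 d) :
    mulL (symbolE0 μ t 0) f = mulL (cosS t) f
      - ∫ σ in (0 : ℝ)..t, mulL (fun r => sincS (t - σ) r * (massCoeff μ σ * symbolE0 μ σ 0 r)) f := by
  obtain ⟨B, hB, -⟩ := exists_goodSymbol hμ t
  obtain ⟨D0, D1, hD, hc, -⟩ := exists_symbol_derivatives hμ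
  have e : ∀ r : ℝ, 0 < r → cosS (t - 0) r * symbolE0 μ 0 0 r + sincS (t - 0) r * D0 0 0 r
      = cosS t r := fun r hr => by
    obtain ⟨-, -, h1, h2, -, -⟩ := hD 0 r (by norm_num) hr
    rw [h1, h2, sub_zero]; ring
  rw [mulL_mode_eq hμ le_rfl ht (y := fun σ r => symbolE0 μ σ 0 r) (y' := fun σ r => D0 σ 0 r)
    (B₀ := 1) (fun r hr => (hD 0 r (by norm_num) hr).1) hB
    (fun σ hσ => (hc σ 0 (by linarith [hσ.1]) (by norm_num)).2.2.1)
    (fun r hr => by rw [e r hr]; exact (goodSymbol_cosS t).2 r hr) f]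
  congr 1
  refine mulL_congr (B := 1) ⟨(goodSymbol_cosS t).1.congr fun r hr => e r hr, fun r hr => ?_⟩
    (goodSymbol_cosS t) e f
  rw [e r hr]; exact (goodSymbol_cosS t).2 r hr

/-- The propagator `𝓔₁` in terms of that of the wave equation. -/
lemma mulL_symbolE1_eq {μ s t : ℝ} (hμ : 0 ≤ μ) (hs : 0 ≤ s) (hst : s ≤ t) (f : L2 d) :
    mulL (symbolE1 μ t s) f = mulL (sincS (t - s)) f
      - ∫ σ in s..t, mulL (fun r => sincS (t - σ) r * (massCoeff μ σ * symbolE1 μ σ s r)) f := by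
  obtain ⟨B, -, hB⟩ := exists_goodSymbol hμ t
  obtain ⟨D0, D1, hD, hc, -⟩ := exists_symbol_derivatives hμ
  have e : ∀ r : ℝ, 0 < r → cosS (t - s) r * symbolE1 μ s s r + sincS (t - s) r * D1 s s r
      = sincS (t - s) r := fun r hr => by
    obtain ⟨-, -, -, -, h1, h2⟩ := hD s r (by linarith) hr
    rw [h1, h2]; ring
  rw [mulL_mode_eq hμ hs hst (y := fun σ r => symbolE1 μ σ s r) (y' := fun σ r => D1 σ s r)
    (B₀ := |t - s|) (fun r hr => (hD s r (by linarith) hr).2.1)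
    (fun σ hσ => hB (σ, s) ⟨hs, hσ.1, hσ.2⟩)
    (fun σ hσ => (hc σ s (by linarith [hσ.1]) (by linarith)).2.2.2)
    (fun r hr => by rw [e r hr]; exact (goodSymbol_sincS (t - s)).2 r hr) f]
  congr 1
  refine mulL_congr (B := |t - s|) ⟨(goodSymbol_sincS (t - s)).1.congr fun r hr => e r hr,
    fun r hr => ?_⟩ (goodSymbol_sincS (t - s)) e f
  rw [e r hr]; exact (goodSymbol_sincS (t - s)).2 r hr

lemma continuousOn_sincS_sub (t : ℝ) {r : ℝ} (hr : 0 < r) (S : Set ℝ) :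
    ContinuousOn (fun σ => sincS (t - σ) r) S := fun σ _ =>
  (hasDerivAt_sincS t σ hr).continuousAt.continuousWithinAt

/-- Solutions in the sense of the propagators `𝓔₀`, `𝓔₁` (on the Fourier side) satisfy Duhamel's
formula for the wave equation with the mass term as a forcing. -/
theorem wave_duhamel {μ : ℝ} (hμ : 0 ≤ μ) {V n : ℝ → L2 d} {V0 V1 : L2 d}
    (hV : ContinuousOn V (Ici 0)) (hn : ∀ t : ℝ, 0 ≤ t → IntervalIntegrable n volume 0 t)
    (hduh : ∀ t : ℝ, 0 ≤ t → V t = mulL (symbolE0 μ t 0) V0 + mulL (symbolE1 μ t 0) V1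
      + ∫ s in (0 : ℝ)..t, mulL (symbolE1 μ t s) (n s)) {t : ℝ} (ht : 0 ≤ t) :
    V t = mulL (cosS t) V0 + mulL (sincS t) V1
      + ∫ s in (0 : ℝ)..t, mulL (sincS (t - s)) (n s - massCoeff μ s • V s) := by
  obtain ⟨B, hB0, hB1⟩ := exists_goodSymbol hμ t
  obtain ⟨D0, D1, hD, hc, hcj⟩ := exists_symbol_derivatives hμ
  have htri : ∀ p ∈ triangle t, -1 < p.1 ∧ -1 < p.2 := fun p hp =>
    ⟨by linarith [hp.1, hp.2.1], by linarith [hp.1]⟩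
  have hVt : ContinuousOn V (Icc 0 t) := hV.mono Icc_subset_Ici_self
  -- the operators `|∇|⁻¹ sin ((t - σ)|∇|)` with the mass coefficient
  have hS : ∀ σ ∈ Icc 0 t, GoodSymbol (fun r => sincS (t - σ) r * massCoeff μ σ) (t * μ) := by
    intro σ hσ
    refine ((goodSymbol_sincS (t - σ)).mul (GoodSymbol.const (massCoeff μ σ))).mono ?_
    have h1 : |t - σ| ≤ t := by rw [abs_of_nonneg (by linarith [hσ.2])]; linarith [hσ.1]
    exact mul_le_mul h1 (norm_massCoeff_le hμ hσ.1) (norm_nonneg _) ht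
  have hSc : ∀ r : ℝ, 0 < r → ContinuousOn (fun σ => sincS (t - σ) r * massCoeff μ σ) (Icc 0 t) :=
    fun r hr => (continuousOn_sincS_sub t hr _).mul
      ((continuousOn_massCoeff μ).mono Icc_subset_Ici_self)
  have hSint : ∀ g : ℝ → L2 d, ContinuousOn g (Icc 0 t) → IntervalIntegrable
      (fun σ => mulL (fun r => sincS (t - σ) r * massCoeff μ σ) (g σ)) volume 0 t := by
    intro g hg
    refine ContinuousOn.intervalIntegrable ?_
    rw [uIcc_of_le ht]
    exact continuousOn_mulL hS hSc hg
  have hE0c : ContinuousOn (fun σ => mulL (symbolE0 μ σ 0) V0) (Icc 0 t) := by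
    refine continuousOn_mulL hB0 (fun r hr σ hσ => ?_) continuousOn_const
    exact ((hD 0 r (by norm_num) hr).1 σ (by linarith [hσ.1])).1.continuousAt.continuousWithinAt
  have hE1c : ContinuousOn (fun σ => mulL (symbolE1 μ σ 0) V1) (Icc 0 t) := by
    refine continuousOn_mulL (fun σ hσ => hB1 (σ, 0) ⟨le_rfl, hσ.1, hσ.2⟩) (fun r hr σ hσ => ?_)
      continuousOn_const
    exact ((hD 0 r (by norm_num) hr).2.1 σ (by linarith [hσ.1])).1.continuousAt.continuousWithinAt
  set J : ℝ → L2 d := fun σ => ∫ s in (0 : ℝ)..σ, mulL (symbolE1 μ σ s) (n s) with hJ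
  have hJeq : ∀ σ : ℝ, 0 ≤ σ → J σ = V σ - mulL (symbolE0 μ σ 0) V0 - mulL (symbolE1 μ σ 0) V1 :=
    fun σ hσ => by rw [hduh σ hσ]; abel
  have hJc : ContinuousOn J (Icc 0 t) :=
    ((hVt.sub hE0c).sub hE1c).congr fun σ hσ => hJeq σ hσ.1
  -- the composed symbols
  have hcomp : ∀ {σ : ℝ} {y : ℝ → ℂ} (_ : σ ∈ Icc 0 t) (_ : GoodSymbol y B) (f : L2 d),
      mulL (fun r => sincS (t - σ) r * (massCoeff μ σ * y r)) f
        = mulL (fun r => sincS (t - σ) r * massCoeff μ σ) (mulL y f) := by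
    intro σ y hσ hy f
    rw [← mulL_mul (hS σ hσ) hy]
    exact mulL_congr ((goodSymbol_sincS (t - σ)).mul ((GoodSymbol.const _).mul hy))
      ((hS σ hσ).mul hy) (fun r _ => by ring) f
  -- the three terms of Duhamel's formula
  have h0 : mulL (symbolE0 μ t 0) V0 = mulL (cosS t) V0
      - ∫ σ in (0 : ℝ)..t, mulL (fun r => sincS (t - σ) r * massCoeff μ σ)
        (mulL (symbolE0 μ σ 0) V0) := by
    rw [mulL_symbolE0_eq hμ ht]
    congr 1
    refine intervalIntegral.integral_congr fun σ hσ => ?_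
    rw [uIcc_of_le ht] at hσ
    exact hcomp hσ (hB0 σ hσ) V0
  have h1 : mulL (symbolE1 μ t 0) V1 = mulL (sincS t) V1
      - ∫ σ in (0 : ℝ)..t, mulL (fun r => sincS (t - σ) r * massCoeff μ σ)
        (mulL (symbolE1 μ σ 0) V1) := by
    rw [mulL_symbolE1_eq hμ le_rfl ht, sub_zero]
    congr 1
    refine intervalIntegral.integral_congr fun σ hσ => ?_
    rw [uIcc_of_le ht] at hσ
    exact hcomp hσ (hB1 (σ, 0) ⟨le_rfl, hσ.1, hσ.2⟩) V1
  have hSn : IntervalIntegrable (fun s => mulL (sincS (t - s)) (n s)) volume 0 t := by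
    refine intervalIntegrable_mulL ht (B := t) (fun s hs => (goodSymbol_sincS (t - s)).mono ?_)
      (fun r hr => continuousOn_sincS_sub t hr _) (hn t ht)
    rw [abs_of_nonneg (by linarith [hs.2])]; linarith [hs.1]
  have hE1n : IntervalIntegrable (fun s => mulL (symbolE1 μ t s) (n s)) volume 0 t := by
    refine intervalIntegrable_mulL ht (fun s hs => hB1 (t, s) ⟨hs.1, hs.2, le_rfl⟩)
      (fun r hr => ?_) (hn t ht)
    exact (hcj r hr).comp (f := fun s : ℝ => (t, s)) (by fun_prop)
      fun s hs => ⟨by simp only; linarith, by simp only; linarith [hs.1]⟩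
  have h2 : J t = (∫ s in (0 : ℝ)..t, mulL (sincS (t - s)) (n s))
      - ∫ σ in (0 : ℝ)..t, mulL (fun r => sincS (t - σ) r * massCoeff μ σ) (J σ) := by
    have e1 : ∫ σ in (0 : ℝ)..t, mulL (fun r => sincS (t - σ) r * massCoeff μ σ) (J σ)
        = ∫ σ in (0 : ℝ)..t, ∫ s in (0 : ℝ)..σ,
          mulL (fun r => sincS (t - σ) r * (massCoeff μ σ * symbolE1 μ σ s r)) (n s) := by
      refine intervalIntegral.integral_congr fun σ hσ => ?_
      rw [uIcc_of_le ht] at hσ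
      simp only [hJ]
      rw [← ContinuousLinearMap.intervalIntegral_comp_comm]
      · refine intervalIntegral.integral_congr fun s hs => ?_
        rw [uIcc_of_le hσ.1] at hs
        exact (hcomp hσ (hB1 (σ, s) ⟨hs.1, hs.2, hσ.2⟩) (n s)).symm
      · refine intervalIntegrable_mulL hσ.1 (fun s hs => hB1 (σ, s) ⟨hs.1, hs.2, hσ.2⟩)
          (fun r hr => ?_) (hn σ hσ.1)
        exact (hcj r hr).comp (f := fun s : ℝ => (σ, s)) (by fun_prop)
          fun s hs => ⟨by simp only; linarith [hσ.1], by simp only; linarith [hs.1]⟩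
    have e2 := integral_triangle_mulL (m := fun σ s r =>
        sincS (t - σ) r * (massCoeff μ σ * symbolE1 μ σ s r)) (B := t * (μ * B)) ht
        (fun p hp => ?_) (fun r hr => ?_) (hn t ht)
    · rw [e1, e2, ← intervalIntegral.integral_sub hSn]
      · refine intervalIntegral.integral_congr fun s hs => ?_
        rw [uIcc_of_le ht] at hs
        exact mulL_symbolE1_eq hμ hs.1 hs.2 (n s)
      · refine (hSn.sub hE1n).congr fun s hs => ?_
        rw [uIoc_of_le ht] at hs
        rw [mulL_symbolE1_eq hμ hs.1.le hs.2 (n s)]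
        abel
    · have hσ : p.1 ∈ Icc 0 t := ⟨hp.1.trans hp.2.1, hp.2.2⟩
      have hB := (hB1 p hp).nonneg
      refine ((goodSymbol_sincS (t - p.1)).mul ((GoodSymbol.const (massCoeff μ p.1)).mul
        (hB1 p hp))).mono ?_
      have h3 : |t - p.1| ≤ t := by rw [abs_of_nonneg (by linarith [hσ.2])]; linarith [hσ.1]
      have h4 := norm_massCoeff_le hμ hσ.1
      gcongr
    · refine ContinuousOn.mul ?_ (ContinuousOn.mul ?_ ((hcj r hr).mono htri))
      · exact (continuousOn_sincS_sub t hr univ).comp continuous_fst.continuousOn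
          fun _ _ => mem_univ _
      · exact (continuousOn_massCoeff μ).comp continuous_fst.continuousOn
          fun p hp => hp.1.trans hp.2.1
  have h3 : ∫ s in (0 : ℝ)..t, mulL (sincS (t - s)) (n s - massCoeff μ s • V s)
      = (∫ s in (0 : ℝ)..t, mulL (sincS (t - s)) (n s))
        - ((∫ σ in (0 : ℝ)..t, mulL (fun r => sincS (t - σ) r * massCoeff μ σ)
            (mulL (symbolE0 μ σ 0) V0))
          + (∫ σ in (0 : ℝ)..t, mulL (fun r => sincS (t - σ) r * massCoeff μ σ)
            (mulL (symbolE1 μ σ 0) V1))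
          + ∫ σ in (0 : ℝ)..t, mulL (fun r => sincS (t - σ) r * massCoeff μ σ) (J σ)) := by
    rw [← intervalIntegral.integral_add (hSint _ hE0c) (hSint _ hE1c),
      ← intervalIntegral.integral_add ((hSint _ hE0c).add (hSint _ hE1c)) (hSint _ hJc),
      ← intervalIntegral.integral_sub hSn
        (((hSint _ hE0c).add (hSint _ hE1c)).add (hSint _ hJc))]
    refine intervalIntegral.integral_congr fun σ hσ => ?_
    rw [uIcc_of_le ht] at hσ
    rw [← map_add, ← map_add, map_sub, hJeq σ hσ.1]
    congr 1
    rw [mulL_mul (goodSymbol_sincS _) (GoodSymbol.const _), mulL_const]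
    congr 2
    abel
  rw [hduh t ht, h3, h0, h1]
  change _ + J t = _
  rw [h2]
  abel

/-! ### The forced wave evolution in the energy space -/

lemma continuous_cosS (r : ℝ) : Continuous fun t => cosS t r := by unfold cosS; fun_prop

lemma continuous_sinS (r : ℝ) : Continuous fun t => sinS t r := by unfold sinS; fun_prop

/-- `∫₀ᵗ cos(s|∇|) F(s) ds`. -/
def primC (F : ℝ → L2 d) (t : ℝ) : L2 d := ∫ s in (0 : ℝ)..t, mulL (cosS s) (F s)

/-- `∫₀ᵗ sin(s|∇|) F(s) ds`. -/
def primS (F : ℝ → L2 d) (t : ℝ) : L2 d := ∫ s in (0 : ℝ)..t, mulL (sinS s) (F s)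

/-- The first component `|∇|v` of the wave evolution with data `(a₀, V₁)` and forcing `F`. -/
def stateA (a0 V1 : L2 d) (F : ℝ → L2 d) (t : ℝ) : L2 d :=
  mulL (cosS t) (a0 - primS F t) + mulL (sinS t) (V1 + primC F t)

/-- The second component `∂ₜv` of the wave evolution with data `(a₀, V₁)` and forcing `F`. -/
def stateB (a0 V1 : L2 d) (F : ℝ → L2 d) (t : ℝ) : L2 d :=
  mulL (cosS t) (V1 + primC F t) - mulL (sinS t) (a0 - primS F t)

lemma intervalIntegrable_cosS {F : ℝ → L2 d} {t : ℝ} (ht : 0 ≤ t)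
    (hF : IntervalIntegrable F volume 0 t) :
    IntervalIntegrable (fun s => mulL (cosS s) (F s)) volume 0 t :=
  intervalIntegrable_mulL ht (fun s _ => goodSymbol_cosS s)
    (fun r _ => (continuous_cosS r).continuousOn) hF

lemma intervalIntegrable_sinS {F : ℝ → L2 d} {t : ℝ} (ht : 0 ≤ t)
    (hF : IntervalIntegrable F volume 0 t) :
    IntervalIntegrable (fun s => mulL (sinS s) (F s)) volume 0 t :=
  intervalIntegrable_mulL ht (fun s _ => goodSymbol_sinS s)
    (fun r _ => (continuous_sinS r).continuousOn) hF

lemma mulL_cosS_sub (t s : ℝ) (f : L2 d) :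
    mulL (cosS (t - s)) f = mulL (cosS t) (mulL (cosS s) f) + mulL (sinS t) (mulL (sinS s) f) := by
  have h1 := (goodSymbol_cosS t).mul (goodSymbol_cosS s)
  have h2 := (goodSymbol_sinS t).mul (goodSymbol_sinS s)
  rw [← mulL_mul (goodSymbol_cosS t) (goodSymbol_cosS s),
    ← mulL_mul (goodSymbol_sinS t) (goodSymbol_sinS s), ← mulL_add h1 h2]
  refine mulL_congr (goodSymbol_cosS _) (h1.add h2) (fun r _ => ?_) f
  simp only [cosS, sinS, sub_mul, Real.cos_sub]
  push_cast; ring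

lemma mulL_sinS_sub (t s : ℝ) (f : L2 d) :
    mulL (sinS (t - s)) f = mulL (sinS t) (mulL (cosS s) f) - mulL (cosS t) (mulL (sinS s) f) := by
  have h1 := (goodSymbol_sinS t).mul (goodSymbol_cosS s)
  have h2 := (goodSymbol_cosS t).mul (goodSymbol_sinS s)
  rw [← mulL_mul (goodSymbol_sinS t) (goodSymbol_cosS s),
    ← mulL_mul (goodSymbol_cosS t) (goodSymbol_sinS s), ← mulL_sub h1 h2]
  refine mulL_congr (goodSymbol_sinS _) (h1.sub h2) (fun r _ => ?_) f
  simp only [cosS, sinS, sub_mul, Real.sin_sub]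
  push_cast; ring

lemma integral_cosS_sub {F : ℝ → L2 d} {t : ℝ} (ht : 0 ≤ t)
    (hF : IntervalIntegrable F volume 0 t) :
    ∫ s in (0 : ℝ)..t, mulL (cosS (t - s)) (F s)
      = mulL (cosS t) (primC F t) + mulL (sinS t) (primS F t) := by
  have hc := intervalIntegrable_cosS ht hF
  have hs := intervalIntegrable_sinS ht hF
  have hc' := intervalIntegrable_mulL (m := fun _ => cosS t) ht (fun _ _ => goodSymbol_cosS t)
    (fun r _ => continuousOn_const) hc
  have hs' := intervalIntegrable_mulL (m := fun _ => sinS t) ht (fun _ _ => goodSymbol_sinS t)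
    (fun r _ => continuousOn_const) hs
  rw [primC, primS, ← ContinuousLinearMap.intervalIntegral_comp_comm _ hc,
    ← ContinuousLinearMap.intervalIntegral_comp_comm _ hs,
    ← intervalIntegral.integral_add hc' hs']
  exact intervalIntegral.integral_congr fun s _ => mulL_cosS_sub t s (F s)

lemma integral_sinS_sub {F : ℝ → L2 d} {t : ℝ} (ht : 0 ≤ t)
    (hF : IntervalIntegrable F volume 0 t) :
    ∫ s in (0 : ℝ)..t, mulL (sinS (t - s)) (F s)
      = mulL (sinS t) (primC F t) - mulL (cosS t) (primS F t) := by
  have hc := intervalIntegrable_cosS ht hF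
  have hs := intervalIntegrable_sinS ht hF
  have hc' := intervalIntegrable_mulL (m := fun _ => sinS t) ht (fun _ _ => goodSymbol_sinS t)
    (fun r _ => continuousOn_const) hc
  have hs' := intervalIntegrable_mulL (m := fun _ => cosS t) ht (fun _ _ => goodSymbol_cosS t)
    (fun r _ => continuousOn_const) hs
  rw [primC, primS, ← ContinuousLinearMap.intervalIntegral_comp_comm _ hc,
    ← ContinuousLinearMap.intervalIntegral_comp_comm _ hs,
    ← intervalIntegral.integral_sub hc' hs']
  exact intervalIntegral.integral_congr fun s _ => mulL_sinS_sub t s (F s)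

/-- The symbols `1 / (1 + r)` and `r / (1 + r)`, which turn the unbounded multiplication by `r`
into a bounded one. -/
lemma goodSymbol_resolvent : GoodSymbol (fun r : ℝ => ((1 + r : ℝ) : ℂ)⁻¹) 1 ∧
    GoodSymbol (fun r : ℝ => (r : ℂ) * ((1 + r : ℝ) : ℂ)⁻¹) 1 := by
  have hne : ∀ r ∈ Ioi (0 : ℝ), ((1 + r : ℝ) : ℂ) ≠ 0 := fun r hr => by
    have : (0 : ℝ) < r := hr
    exact_mod_cast (by positivity : (1 + r : ℝ) ≠ 0)
  have hc : ContinuousOn (fun r : ℝ => ((1 + r : ℝ) : ℂ)⁻¹) (Ioi 0) :=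
    ContinuousOn.inv₀ (by fun_prop) hne
  have hn : ∀ r : ℝ, 0 < r → ‖((1 + r : ℝ) : ℂ)⁻¹‖ = (1 + r)⁻¹ := fun r hr => by
    rw [norm_inv, Complex.norm_real, Real.norm_of_nonneg (by positivity)]
  refine ⟨⟨hc, fun r hr => ?_⟩, ⟨ContinuousOn.mul (by fun_prop) hc, fun r hr => ?_⟩⟩
  · rw [hn r hr]
    exact inv_le_one_of_one_le₀ (by linarith)
  · rw [norm_mul, hn r hr, Complex.norm_real, Real.norm_of_nonneg hr.le, ← div_eq_mul_inv,
      div_le_one (by positivity)]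
    linarith

/-- The first component of the wave evolution is `|∇|v`. -/
lemma stateA_ae {V0 V1 a0 Vt : L2 d} {F : ℝ → L2 d} {t : ℝ} (ht : 0 ≤ t)
    (hF : IntervalIntegrable F volume 0 t)
    (ha0 : a0 =ᵐ[volume] fun ξ => (freq ξ : ℂ) * V0 ξ)
    (hV : Vt = mulL (cosS t) V0 + mulL (sincS t) V1
      + ∫ s in (0 : ℝ)..t, mulL (sincS (t - s)) (F s)) :
    stateA a0 V1 F t =ᵐ[volume] fun ξ => (freq ξ : ℂ) * Vt ξ := by
  obtain ⟨hρ, hρ'⟩ := goodSymbol_resolvent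
  set ρ : ℝ → ℂ := fun r : ℝ => ((1 + r : ℝ) : ℂ)⁻¹ with hρd
  set ρ' : ℝ → ℂ := fun r : ℝ => (r : ℂ) * ((1 + r : ℝ) : ℂ)⁻¹ with hρd'
  have hswap : ∀ (τ : ℝ) (f : L2 d), mulL ρ' (mulL (sincS τ) f) = mulL ρ (mulL (sinS τ) f) := by
    intro τ f
    rw [← mulL_mul hρ' (goodSymbol_sincS τ), ← mulL_mul hρ (goodSymbol_sinS τ)]
    refine mulL_congr (hρ'.mul (goodSymbol_sincS τ)) (hρ.mul (goodSymbol_sinS τ))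
      (fun r hr => ?_) f
    simp only [hρd, hρd', ← r_mul_sincS τ hr]
    ring
  have h0 : mulL ρ' V0 = mulL ρ a0 := by
    refine Lp.ext ?_
    filter_upwards [mulL_ae hρ' V0, mulL_ae hρ a0, ha0] with ξ h1 h2 h3
    rw [h1, h2, h3]
    simp only [hρd, hρd']
    ring
  have hcomm : ∀ f : L2 d, mulL ρ' (mulL (cosS t) f) = mulL (cosS t) (mulL ρ' f) := fun f => by
    rw [← mulL_mul hρ' (goodSymbol_cosS t), ← mulL_mul (goodSymbol_cosS t) hρ']
    exact mulL_congr (hρ'.mul (goodSymbol_cosS t)) ((goodSymbol_cosS t).mul hρ')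
      (fun r _ => mul_comm _ _) f
  have hcomm' : ∀ f : L2 d, mulL ρ (mulL (cosS t) f) = mulL (cosS t) (mulL ρ f) := fun f => by
    rw [← mulL_mul hρ (goodSymbol_cosS t), ← mulL_mul (goodSymbol_cosS t) hρ]
    exact mulL_congr (hρ.mul (goodSymbol_cosS t)) ((goodSymbol_cosS t).mul hρ)
      (fun r _ => mul_comm _ _) f
  have hint : IntervalIntegrable (fun s => mulL (sincS (t - s)) (F s)) volume 0 t := by
    refine intervalIntegrable_mulL ht (B := t) (fun s hs => (goodSymbol_sincS (t - s)).mono ?_)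
      (fun r hr => continuousOn_sincS_sub t hr _) hF
    rw [abs_of_nonneg (by linarith [hs.2])]; linarith [hs.1]
  have hint' : IntervalIntegrable (fun s => mulL (sinS (t - s)) (F s)) volume 0 t :=
    intervalIntegrable_mulL ht (fun s _ => goodSymbol_sinS (t - s))
      (fun r _ => ((continuous_sinS r).comp (by fun_prop)).continuousOn) hF
  have key : mulL ρ' Vt = mulL ρ (stateA a0 V1 F t) := by
    have h1 : mulL ρ' (∫ s in (0 : ℝ)..t, mulL (sincS (t - s)) (F s))
        = mulL ρ (∫ s in (0 : ℝ)..t, mulL (sinS (t - s)) (F s)) := by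
      rw [← ContinuousLinearMap.intervalIntegral_comp_comm _ hint,
        ← ContinuousLinearMap.intervalIntegral_comp_comm _ hint']
      exact intervalIntegral.integral_congr fun s _ => hswap (t - s) (F s)
    rw [hV, map_add, map_add, h1, hswap, hcomm, h0, ← hcomm', integral_sinS_sub ht hF, stateA,
      ← map_add, ← map_add]
    congr 1
    simp only [map_add, map_sub]
    abel
  have key' := mulL_ae hρ' Vt
  rw [key] at key'
  filter_upwards [key', mulL_ae hρ (stateA a0 V1 F t), ae_freq_pos d] with ξ h1 h2 h3
  rw [h2] at h1
  have hne : ((1 + freq ξ : ℝ) : ℂ) ≠ 0 := by exact_mod_cast (by positivity : (1 + freq ξ : ℝ) ≠ 0)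
  simp only [hρd, hρd'] at h1
  field_simp at h1
  exact h1

/-- The second component of the wave evolution is the time derivative of `v`. -/
lemma integral_stateB {V0 V1 a0 Vt : L2 d} {F : ℝ → L2 d} {t : ℝ} (ht : 0 ≤ t)
    (hF : ∀ t : ℝ, 0 ≤ t → IntervalIntegrable F volume 0 t)
    (ha0 : a0 =ᵐ[volume] fun ξ => (freq ξ : ℂ) * V0 ξ)
    (hV : Vt = mulL (cosS t) V0 + mulL (sincS t) V1
      + ∫ s in (0 : ℝ)..t, mulL (sincS (t - s)) (F s)) :
    ∫ σ in (0 : ℝ)..t, stateB a0 V1 F σ = Vt - V0 := by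
  have hsinc0 : ∀ r : ℝ, 0 < r → sincS 0 r = 0 := fun r _ => by simp [sincS]
  have hder : ∀ s r : ℝ, 0 < r → ∀ σ, HasDerivAt (fun σ => sincS (σ - s) r) (cosS (σ - s) r) σ := by
    intro s r hr σ
    have h1 : HasDerivAt (fun σ : ℝ => (σ - s) * r) (1 * r) σ :=
      ((hasDerivAt_id σ).sub_const s).mul_const r
    refine (h1.sin.div_const r).ofReal_comp.congr_deriv ?_
    have hr' : (r : ℂ) ≠ 0 := by exact_mod_cast hr.ne'
    rw [cosS]; push_cast; field_simp
  -- `∫ cos((σ - s)|∇|) dσ = |∇|⁻¹ sin((t - s)|∇|)`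
  have hcos : ∀ s ∈ Icc 0 t, ∀ f : L2 d,
      ∫ σ in s..t, mulL (cosS (σ - s)) f = mulL (sincS (t - s)) f := by
    intro s hs f
    have h1 := integral_mulL (m := fun σ r => sincS (σ - s) r) (m' := fun σ r => cosS (σ - s) r)
      (a := s) (b := t) (B := t + 1) hs.2
      (fun σ hσ => (goodSymbol_sincS (σ - s)).mono (by
        rw [abs_of_nonneg (by linarith [hσ.1])]; linarith [hσ.2, hs.1]))
      (fun σ _ => (goodSymbol_cosS (σ - s)).mono (by linarith))
      (fun r hr σ _ => hder s r hr σ)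
      (fun r _ => ((continuous_cosS r).comp (by fun_prop)).continuousOn) f
    rw [h1]
    have h2 : mulL (fun r => sincS (s - s) r) f = 0 := by
      rw [mulL_congr (n := fun _ => 0) (goodSymbol_sincS (s - s)) (GoodSymbol.const 0)
        (fun r hr => by rw [sub_self]; exact hsinc0 r hr), mulL_const, zero_smul]
    rw [h2, sub_zero]
  -- `∫ -|∇| sin(σ|∇|) dσ = cos(t|∇|) - 1`
  have hsin : ∫ σ in (0 : ℝ)..t, mulL (sinS σ) a0 = V0 - mulL (cosS t) V0 := by
    have hg : ∀ σ : ℝ, 0 ≤ σ → GoodSymbol (fun r => (1 - cosS σ r) * (r : ℂ)⁻¹) (σ + 1) := by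
      intro σ hσ
      refine ⟨ContinuousOn.mul ?_ ?_, fun r hr => ?_⟩
      · exact continuousOn_const.sub (goodSymbol_cosS σ).1
      · exact ContinuousOn.inv₀ (by fun_prop) fun r hr => by exact_mod_cast (ne_of_gt hr)
      · have h1 : (1 - cosS σ r) * (r : ℂ)⁻¹ = ((1 - Real.cos (σ * r)) / r : ℝ) := by
          rw [cosS, div_eq_mul_inv]; push_cast; ring
        simp only [h1]
        rw [Complex.norm_real, Real.norm_of_nonneg
          (div_nonneg (by linarith [Real.cos_le_one (σ * r)]) hr.le), div_le_iff₀ hr]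
        have h3 : 1 - Real.cos (σ * r) ≤ σ * r := by
          have h4 := Real.one_sub_sq_div_two_le_cos (x := σ * r)
          have h5 := Real.neg_one_le_cos (σ * r)
          have h6 : 0 ≤ σ * r := mul_nonneg hσ hr.le
          rcases le_total (σ * r) 2 with h7 | h7
          · nlinarith
          · linarith
        nlinarith
    have h1 := integral_mulL (m := fun σ r => (1 - cosS σ r) * (r : ℂ)⁻¹)
      (m' := fun σ r => sinS σ r) (a := 0) (b := t) (B := t + 1) ht
      (fun σ hσ => (hg σ hσ.1).mono (by linarith [hσ.2]))
      (fun σ _ => (goodSymbol_sinS σ).mono (by linarith))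
      (fun r hr σ _ => by
        have h1 : HasDerivAt (fun σ : ℝ => σ * r) (1 * r) σ := (hasDerivAt_id σ).mul_const r
        refine ((h1.cos.ofReal_comp.const_sub 1).mul_const (r : ℂ)⁻¹).congr_deriv ?_
        have hr' : (r : ℂ) ≠ 0 := by exact_mod_cast hr.ne'
        rw [sinS]; push_cast; field_simp)
      (fun r _ => (continuous_sinS r).continuousOn) a0
    rw [h1]
    refine Lp.ext ?_
    filter_upwards [Lp.coeFn_sub (mulL (fun r => (1 - cosS t r) * (r : ℂ)⁻¹) a0)
        (mulL (fun r => (1 - cosS 0 r) * (r : ℂ)⁻¹) a0), mulL_ae (hg t ht) a0,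
        mulL_ae (hg 0 le_rfl) a0, Lp.coeFn_sub V0 (mulL (cosS t) V0),
        mulL_ae (goodSymbol_cosS t) V0, ha0, ae_freq_pos d] with ξ h2 h3 h4 h5 h6 h7 h8
    have hr' : (freq ξ : ℂ) ≠ 0 := by exact_mod_cast h8.ne'
    rw [h2, h5, Pi.sub_apply, Pi.sub_apply, h3, h4, h6, h7]
    simp only [cosS, zero_mul, Real.cos_zero]
    push_cast
    field_simp
    ring
  have hswap := integral_triangle_mulL (m := fun σ s r => cosS (σ - s) r) (B := 1) ht
    (fun p _ => goodSymbol_cosS _)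
    (fun r _ => ((continuous_cosS r).comp (by fun_prop : Continuous fun p : ℝ × ℝ =>
      p.1 - p.2)).continuousOn) (hF t ht)
  have e : ∀ σ ∈ Icc 0 t, stateB a0 V1 F σ = (mulL (cosS σ) V1 - mulL (sinS σ) a0)
      + ∫ s in (0 : ℝ)..σ, mulL (cosS (σ - s)) (F s) := by
    intro σ hσ
    rw [integral_cosS_sub hσ.1 (hF σ hσ.1), stateB, map_add, map_sub]
    abel
  have hcV : IntervalIntegrable (fun σ => mulL (cosS σ) V1) volume 0 t :=
    intervalIntegrable_cosS ht intervalIntegrable_const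
  have hsa : IntervalIntegrable (fun σ => mulL (sinS σ) a0) volume 0 t :=
    intervalIntegrable_sinS ht intervalIntegrable_const
  have hprimc : ∀ G : ℝ → L2 d, IntervalIntegrable G volume 0 t →
      ContinuousOn (fun σ => ∫ s in (0 : ℝ)..σ, G s) (Icc 0 t) := by
    intro G hG
    have := intervalIntegral.continuousOn_primitive_interval (μ := volume) (a := 0) (b := t)
      (f := G) (by
        rw [uIcc_of_le ht, integrableOn_Icc_iff_integrableOn_Ioc]
        exact (intervalIntegrable_iff_integrableOn_Ioc_of_le ht).1 hG)
    rwa [uIcc_of_le ht] at this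
  have hconv : IntervalIntegrable (fun σ => ∫ s in (0 : ℝ)..σ, mulL (cosS (σ - s)) (F s))
      volume 0 t := by
    refine ContinuousOn.intervalIntegrable ?_
    rw [uIcc_of_le ht]
    have h1 : ContinuousOn (fun σ => mulL (cosS σ) (primC F σ) + mulL (sinS σ) (primS F σ))
        (Icc 0 t) :=
      (continuousOn_mulL (fun σ _ => goodSymbol_cosS σ)
        (fun r _ => (continuous_cosS r).continuousOn)
        (hprimc _ (intervalIntegrable_cosS ht (hF t ht)))).add
      (continuousOn_mulL (fun σ _ => goodSymbol_sinS σ)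
        (fun r _ => (continuous_sinS r).continuousOn)
        (hprimc _ (intervalIntegrable_sinS ht (hF t ht))))
    exact h1.congr fun σ hσ => integral_cosS_sub hσ.1 (hF σ hσ.1)
  rw [intervalIntegral.integral_congr (g := fun σ => (mulL (cosS σ) V1 - mulL (sinS σ) a0)
      + ∫ s in (0 : ℝ)..σ, mulL (cosS (σ - s)) (F s)) (fun σ hσ => by
        rw [uIcc_of_le ht] at hσ; exact e σ hσ),
    intervalIntegral.integral_add (hcV.sub hsa) hconv, intervalIntegral.integral_sub hcV hsa,
    hswap, hsin]
  have h1 := hcos 0 ⟨le_rfl, ht⟩ V1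
  simp only [sub_zero] at h1
  rw [h1, hV]
  have h2 : ∫ s in (0 : ℝ)..t, ∫ σ in s..t, mulL (fun r => cosS (σ - s) r) (F s)
      = ∫ s in (0 : ℝ)..t, mulL (sincS (t - s)) (F s) := by
    refine intervalIntegral.integral_congr fun s hs => ?_
    rw [uIcc_of_le ht] at hs
    exact hcos s hs (F s)
  rw [h2]
  abel

lemma continuousOn_stateB (a0 V1 : L2 d) {F : ℝ → L2 d}
    (hF : ∀ t : ℝ, 0 ≤ t → IntervalIntegrable F volume 0 t) :
    ContinuousOn (stateB a0 V1 F) (Ici 0) := by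
  have hprim : ∀ G : ℝ → L2 d, (∀ t : ℝ, 0 ≤ t → IntervalIntegrable G volume 0 t) →
      ContinuousOn (fun σ => ∫ s in (0 : ℝ)..σ, G s) (Ici 0) := by
    intro G hG t ht
    have ht' : (0 : ℝ) ≤ t := ht
    have h1 := intervalIntegral.continuousOn_primitive_interval (μ := volume) (a := 0) (b := t + 1)
      (f := G) (by
        rw [uIcc_of_le (by linarith), integrableOn_Icc_iff_integrableOn_Ioc]
        exact (intervalIntegrable_iff_integrableOn_Ioc_of_le (by linarith)).1
          (hG (t + 1) (by linarith)))
    rw [uIcc_of_le (by linarith)] at h1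
    have h2 := h1 t ⟨ht', by linarith⟩
    refine h2.mono_of_mem_nhdsWithin ?_
    filter_upwards [self_mem_nhdsWithin, nhdsWithin_le_nhds (Iio_mem_nhds (lt_add_one t))]
      with s hs hs' using ⟨hs, le_of_lt hs'⟩
  have hC := hprim _ fun t ht => intervalIntegrable_cosS ht (hF t ht)
  have hS := hprim _ fun t ht => intervalIntegrable_sinS ht (hF t ht)
  exact (continuousOn_mulL (fun σ _ => goodSymbol_cosS σ)
      (fun r _ => (continuous_cosS r).continuousOn) (continuousOn_const.add hC)).sub
    (continuousOn_mulL (fun σ _ => goodSymbol_sinS σ)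
      (fun r _ => (continuous_sinS r).continuousOn) (continuousOn_const.sub hS))

/-- One-sided fundamental theorem of calculus on `[0, ∞)`. -/
lemma hasDerivWithinAt_of_integral {H : Type*} [NormedAddCommGroup H] [NormedSpace ℝ H]
    [CompleteSpace H] {V b : ℝ → H} (hb : ContinuousOn b (Ici 0))
    (hV : ∀ t : ℝ, 0 ≤ t → ∫ σ in (0 : ℝ)..t, b σ = V t - V 0) {t : ℝ} (ht : 0 ≤ t) :
    HasDerivWithinAt V (b t) (Ici 0) t := by
  have hc : Continuous fun σ => b (max σ 0) :=
    hb.comp_continuous (by fun_prop) fun σ => mem_Ici.2 (le_max_right _ _)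
  have h1 := (hc.integral_hasStrictDerivAt 0 t).hasDerivAt.const_add (V 0)
  rw [max_eq_left ht] at h1
  have e : ∀ u ∈ Ici (0 : ℝ), V u = V 0 + ∫ σ in (0 : ℝ)..u, b (max σ 0) := by
    intro u hu
    have h2 : ∫ σ in (0 : ℝ)..u, b (max σ 0) = ∫ σ in (0 : ℝ)..u, b σ := by
      refine intervalIntegral.integral_congr fun σ hσ => ?_
      rw [uIcc_of_le hu] at hσ
      simp only [max_eq_left hσ.1]
    rw [h2, hV u hu]; abel
  exact h1.hasDerivWithinAt.congr e (e t ht)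

/-! ### The nonlinearity -/

/-- The power nonlinearity `|z|^β z` truncated at height `k`. -/
def truncPow (β : ℝ) (k : ℕ) (z : ℂ) : ℂ := ((min ‖z‖ k ^ β : ℝ) : ℂ) * z

lemma rpow_sub_rpow_mul_le {β x y : ℝ} (hβ : 1 ≤ β) (hy : 0 ≤ y) (hxy : y ≤ x) :
    (x ^ β - y ^ β) * y ≤ β * x ^ β * (x - y) := by
  rcases hy.eq_or_lt with rfl | hy
  · rw [mul_zero, sub_zero]; positivity
  · have hx : 0 < x := hy.trans_le hxy
    have h1 := one_add_mul_self_le_rpow_one_add (s := y / x - 1) (by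
      have : 0 ≤ y / x := by positivity
      linarith) hβ
    rw [add_sub_cancel, Real.div_rpow hy.le hx.le, le_div_iff₀ (by positivity)] at h1
    have h2 : x ^ β - y ^ β ≤ β * x ^ β * (1 - y / x) := by linarith
    have h3 : 0 ≤ 1 - y / x := by rw [sub_nonneg, div_le_one hx]; exact hxy
    calc (x ^ β - y ^ β) * y ≤ β * x ^ β * (1 - y / x) * x :=
          mul_le_mul h2 hxy hy.le (by positivity)
      _ = β * x ^ β * (x - y) := by field_simp

lemma lipschitzWith_truncPow {β : ℝ} (hβ : 1 ≤ β) (k : ℕ) :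
    LipschitzWith (Real.toNNReal ((1 + β) * (k : ℝ) ^ β)) (truncPow β k) := by
  have hβ0 : 0 ≤ β := by linarith
  have key : ∀ z w : ℂ, ‖w‖ ≤ ‖z‖ →
      ‖truncPow β k z - truncPow β k w‖ ≤ (1 + β) * (k : ℝ) ^ β * ‖z - w‖ := by
    intro z w hwz
    have hk : (0 : ℝ) ≤ k := k.cast_nonneg
    set a : ℝ := min ‖z‖ k with ha
    set b : ℝ := min ‖w‖ k with hb
    have hb0 : 0 ≤ b := le_min (norm_nonneg _) hk
    have hba : b ≤ a := min_le_min_right _ hwz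
    have hak : a ^ β ≤ (k : ℝ) ^ β := Real.rpow_le_rpow (hb0.trans hba) (min_le_right _ _) hβ0
    have e : truncPow β k z - truncPow β k w
        = ((a ^ β : ℝ) : ℂ) * (z - w) + ((a ^ β - b ^ β : ℝ) : ℂ) * w := by
      rw [truncPow, truncPow]; push_cast; ring
    have hab : 0 ≤ a ^ β - b ^ β := sub_nonneg.2 (Real.rpow_le_rpow hb0 hba hβ0)
    have h1 : (a ^ β - b ^ β) * ‖w‖ ≤ β * (k : ℝ) ^ β * ‖z - w‖ := by
      rcases le_total (k : ℝ) ‖w‖ with h | h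
      · have hb' : b = k := min_eq_right h
        have ha' : a = k := min_eq_right (h.trans hwz)
        rw [ha', hb', sub_self, zero_mul]; positivity
      · have hb' : b = ‖w‖ := min_eq_left h
        have h2 := rpow_sub_rpow_mul_le hβ hb0 hba
        rw [hb'] at h2 ⊢
        refine h2.trans ?_
        have h3 : a - ‖w‖ ≤ ‖z - w‖ :=
          (sub_le_sub_right (min_le_left _ _) _).trans (norm_sub_norm_le z w)
        have h4 : 0 ≤ a - ‖w‖ := by rw [← hb']; linarith
        gcongr
    rw [e]
    refine (norm_add_le _ _).trans ?_
    rw [norm_mul, norm_mul, Complex.norm_real, Complex.norm_real, Real.norm_of_nonneg hab,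
      Real.norm_of_nonneg (Real.rpow_nonneg (hb0.trans hba) _)]
    have h5 : a ^ β * ‖z - w‖ ≤ (k : ℝ) ^ β * ‖z - w‖ := by gcongr
    linarith
  refine LipschitzWith.of_dist_le_mul fun z w => ?_
  rw [Real.coe_toNNReal _ (by positivity), dist_eq_norm, dist_eq_norm]
  rcases le_total ‖w‖ ‖z‖ with h | h
  · exact key z w h
  · rw [norm_sub_rev, norm_sub_rev z w]; exact key w z h

lemma truncPow_zero (β : ℝ) (k : ℕ) : truncPow β k 0 = 0 := by simp [truncPow]

lemma norm_truncPow_mono {β : ℝ} (hβ : 0 ≤ β) {k l : ℕ} (hkl : k ≤ l) (z : ℂ) :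
    ‖truncPow β k z‖ ≤ ‖truncPow β l z‖ := by
  have h0 : ∀ k : ℕ, 0 ≤ min ‖z‖ (k : ℝ) := fun k => le_min (norm_nonneg _) k.cast_nonneg
  rw [truncPow, truncPow, norm_mul, norm_mul, Complex.norm_real, Complex.norm_real,
    Real.norm_of_nonneg (Real.rpow_nonneg (h0 k) _), Real.norm_of_nonneg (Real.rpow_nonneg (h0 l) _)]
  have : min ‖z‖ (k : ℝ) ≤ min ‖z‖ (l : ℝ) := min_le_min_left _ (by exact_mod_cast hkl)
  have h1 := h0 k
  gcongr

lemma truncPow_eq {β : ℝ} {k : ℕ} {z : ℂ} (h : ‖z‖ ≤ k) :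
    truncPow β k z = ((‖z‖ ^ β : ℝ) : ℂ) * z := by
  rw [truncPow, min_eq_left h]

lemma norm_truncPow_sub_le {β : ℝ} (hβ : 0 ≤ β) (k : ℕ) (z : ℂ) :
    ‖truncPow β k z - ((‖z‖ ^ β : ℝ) : ℂ) * z‖ ≤ ‖((‖z‖ ^ β : ℝ) : ℂ) * z‖ := by
  have h0 : 0 ≤ min ‖z‖ (k : ℝ) := le_min (norm_nonneg _) k.cast_nonneg
  have h1 : min ‖z‖ (k : ℝ) ^ β ≤ ‖z‖ ^ β := Real.rpow_le_rpow h0 (min_le_left _ _) hβ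
  rw [truncPow, ← sub_mul, norm_mul, norm_mul, ← Complex.ofReal_sub, Complex.norm_real,
    Complex.norm_real]
  refine mul_le_mul_of_nonneg_right ?_ (norm_nonneg _)
  rw [Real.norm_eq_abs, Real.norm_eq_abs, abs_of_nonneg (a := ‖z‖ ^ β) (by positivity), abs_le]
  constructor <;> linarith [Real.rpow_nonneg h0 β, Real.rpow_nonneg (norm_nonneg z) β]

lemma eventually_truncPow_eq (β : ℝ) (z : ℂ) :
    ∀ᶠ k : ℕ in atTop, truncPow β k z = ((‖z‖ ^ β : ℝ) : ℂ) * z := by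
  obtain ⟨k, hk⟩ := exists_nat_ge ‖z‖
  filter_upwards [eventually_ge_atTop k] with l hl
  exact truncPow_eq (hk.trans (by exact_mod_cast hl))

lemma dim_sub_two_pos : 0 < (d : ℝ) - 2 := by
  have h1 : (3 : ℝ) ≤ d := by exact_mod_cast hd.out
  linarith

lemma one_lt_p1 : 1 < p1 d := by
  have := dim_sub_two_pos (d := d)
  have h : 0 < 4 / ((d : ℝ) - 2) := by positivity
  rw [p1]; linarith

/-- The `L²` norm of `|f|^{p₁ - 1} f` is `‖f‖_{L^{2p₁}}^{p₁}`. -/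
lemma eLpNorm_powerFun (f : L2 d) : eLpNorm (powerFun f) 2 volume
    = eLpNorm f (ENNReal.ofReal (2 * p1 d)) volume ^ p1 d := by
  have hp := one_lt_p1 (d := d)
  have h1 : eLpNorm (powerFun f) 2 volume = eLpNorm (fun x => ‖f x‖ ^ p1 d) 2 volume := by
    refine eLpNorm_congr_norm_ae (Eventually.of_forall fun x => ?_)
    have hdim := dim_sub_two_pos (d := d)
    rw [powerFun, norm_mul, Complex.norm_real, Real.norm_of_nonneg (by positivity),
      Real.norm_of_nonneg (by positivity), p1, Real.rpow_add' (norm_nonneg _) (by positivity),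
      Real.rpow_one, mul_comm]
  rw [h1, eLpNorm_norm_rpow _ (by linarith), ENNReal.ofReal_mul (by norm_num)]
  simp

lemma aestronglyMeasurable_powerFun {d : ℕ} (f : L2 d) : AEStronglyMeasurable (powerFun f) volume := by
  have h := Lp.aestronglyMeasurable f
  refine AEStronglyMeasurable.mul ?_ h
  exact (Complex.continuous_ofReal.comp_aestronglyMeasurable
    ((h.norm.aemeasurable.pow_const _).aestronglyMeasurable))

lemma memLp_powerFun_iff {d : ℕ} (f : L2 d) : MemLp (powerFun f) 2 volume ↔
    eLpNorm (powerFun f) 2 volume < ⊤ :=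
  ⟨fun h => h.2, fun h => ⟨aestronglyMeasurable_powerFun f, h⟩⟩

lemma power_ae {d : ℕ} {f : L2 d} (h : MemLp (powerFun f) 2 volume) :
    power f =ᵐ[volume] powerFun f := by
  rw [power, dif_pos h]; exact h.coeFn_toLp

lemma enorm_power {d : ℕ} {f : L2 d} (h : MemLp (powerFun f) 2 volume) :
    ‖power f‖ₑ = eLpNorm (powerFun f) 2 volume := by
  rw [Lp.enorm_def]
  exact eLpNorm_congr_ae (power_ae h)

/-- The truncated nonlinearity as a Lipschitz map on `L²`. -/
def truncPower {d : ℕ} (β : ℝ) (hβ : 1 ≤ β) (k : ℕ) (f : L2 d) : L2 d :=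
  (lipschitzWith_truncPow hβ k).compLp (truncPow_zero β k) f

lemma truncPower_ae {d : ℕ} {β : ℝ} (hβ : 1 ≤ β) (k : ℕ) (f : L2 d) :
    truncPower β hβ k f =ᵐ[volume] fun x => truncPow β k (f x) :=
  (lipschitzWith_truncPow hβ k).coeFn_compLp (truncPow_zero β k) f

lemma continuous_truncPower {d : ℕ} {β : ℝ} (hβ : 1 ≤ β) (k : ℕ) :
    Continuous (truncPower (d := d) β hβ k) :=
  (lipschitzWith_truncPow hβ k).continuous_compLp (truncPow_zero β k)

/-- The truncations approximate the nonlinearity monotonically; they give the measurability in time of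
its `L²` norm. -/
lemma iSup_enorm_truncPower {d : ℕ} (hβ : 1 ≤ 4 / ((d : ℝ) - 2)) (f : L2 d) :
    ⨆ k, ‖truncPower (4 / ((d : ℝ) - 2)) hβ k f‖ₑ = eLpNorm (powerFun f) 2 volume := by
  set β := 4 / ((d : ℝ) - 2) with hβd
  have hβ0 : 0 ≤ β := by linarith
  have e1 : ∀ k, ‖truncPower β hβ k f‖ₑ
      = (∫⁻ x, ‖truncPow β k (f x)‖ₑ ^ (2 : ℝ)) ^ (1 / 2 : ℝ) := by
    intro k
    rw [Lp.enorm_def, eLpNorm_congr_ae (truncPower_ae hβ k f),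
      eLpNorm_eq_lintegral_rpow_enorm_toReal two_ne_zero ENNReal.ofNat_ne_top]
    simp
  have e2 : eLpNorm (powerFun f) 2 volume
      = (∫⁻ x, ⨆ k, ‖truncPow β k (f x)‖ₑ ^ (2 : ℝ)) ^ (1 / 2 : ℝ) := by
    rw [eLpNorm_eq_lintegral_rpow_enorm_toReal two_ne_zero ENNReal.ofNat_ne_top]
    simp only [ENNReal.toReal_ofNat]
    congr 1
    refine lintegral_congr fun x => ?_
    have hmono : Monotone fun k => ‖truncPow β k (f x)‖ₑ ^ (2 : ℝ) := fun k l hkl => by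
      refine ENNReal.rpow_le_rpow ?_ (by norm_num)
      rw [← ofReal_norm, ← ofReal_norm]
      exact ENNReal.ofReal_le_ofReal (norm_truncPow_mono hβ0 hkl _)
    refine tendsto_nhds_unique ?_ (tendsto_atTop_iSup hmono)
    refine tendsto_const_nhds.congr' ?_
    filter_upwards [eventually_truncPow_eq β (f x)] with k hk
    rw [hk, powerFun]
  have hmono : ∀ x, Monotone fun k => ‖truncPow β k (f x)‖ₑ ^ (2 : ℝ) := fun x k l hkl => by
    refine ENNReal.rpow_le_rpow ?_ (by norm_num)
    rw [← ofReal_norm, ← ofReal_norm]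
    exact ENNReal.ofReal_le_ofReal (norm_truncPow_mono hβ0 hkl _)
  rw [e2, lintegral_iSup' (fun k => ?_) (Eventually.of_forall hmono)]
  · refine (iSup_congr e1).trans ?_
    exact ((ENNReal.orderIsoRpow (1 / 2) (by norm_num)).map_iSup _).symm
  · exact ((lipschitzWith_truncPow hβ k).continuous.comp_aestronglyMeasurable
      (Lp.aestronglyMeasurable f)).enorm.pow_const _

lemma tendsto_truncPower {d : ℕ} (hβ : 1 ≤ 4 / ((d : ℝ) - 2)) {f : L2 d}
    (h : MemLp (powerFun f) 2 volume) :
    Tendsto (fun k => truncPower (4 / ((d : ℝ) - 2)) hβ k f) atTop (𝓝 (power f)) := by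
  refine tendsto_L2_of_dominated (G := power f) (K := 1)
    (F' := fun k x => truncPow (4 / ((d : ℝ) - 2)) k (f x) - powerFun f x) ?_ ?_ ?_
  · refine Eventually.of_forall fun k => ?_
    filter_upwards [truncPower_ae hβ k f, power_ae h] with x h1 h2
    rw [h1, h2]
  · refine Eventually.of_forall fun k => ?_
    filter_upwards [power_ae h] with x h2
    rw [h2, one_mul]
    exact norm_truncPow_sub_le (by linarith) k (f x)
  · refine Eventually.of_forall fun x => ?_
    refine tendsto_const_nhds.congr' ?_
    filter_upwards [eventually_truncPow_eq (4 / ((d : ℝ) - 2)) (f x)] with k hk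
    rw [hk, powerFun, sub_self]

/-- The nonlinearity along a continuous path with finite space-time norm is integrable in time,
and its norm is controlled by the space-time norm. -/
lemma integrable_power {v : ℝ → L2 d} (hβ : 1 ≤ 4 / ((d : ℝ) - 2))
    (hv : ContinuousOn v (Ici 0)) (hst : stNorm v (Ici 0) < ⊤) :
    IntegrableOn (fun s => power (v s)) (Ici 0) volume ∧
      ∀ t : ℝ, 0 ≤ t → ∫ s in Ici t, ‖power (v s)‖ = (stNorm v (Ici t)).toReal ^ p1 d := by
  have hp := one_lt_p1 (d := d)
  set g : ℝ → ℝ≥0∞ := fun s => eLpNorm (powerFun (v s)) 2 volume with hg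
  have hst' : ∀ J : Set ℝ, stNorm v J = (∫⁻ s in J, g s) ^ (1 / p1 d) := fun J => by
    rw [stNorm]; simp only [hg, eLpNorm_powerFun]
  have htm : ∀ k, AEStronglyMeasurable (fun s => truncPower (4 / ((d : ℝ) - 2)) hβ k (v s))
      (volume.restrict (Ici 0)) := fun k =>
    ((continuous_truncPower hβ k).comp_continuousOn hv).aestronglyMeasurable measurableSet_Ici
  have hgm : AEMeasurable g (volume.restrict (Ici 0)) := by
    have : g = fun s => ⨆ k, ‖truncPower (4 / ((d : ℝ) - 2)) hβ k (v s)‖ₑ :=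
      funext fun s => (iSup_enorm_truncPower hβ (v s)).symm
    rw [this]
    exact AEMeasurable.iSup fun k => (htm k).enorm
  have hgfin : ∫⁻ s in Ici 0, g s ≠ ⊤ := by
    intro h
    rw [hst', h, ENNReal.top_rpow_of_pos (by positivity)] at hst
    exact lt_irrefl _ hst
  have hae : ∀ᵐ s ∂(volume.restrict (Ici (0 : ℝ))), MemLp (powerFun (v s)) 2 volume := by
    filter_upwards [ae_lt_top' hgm hgfin] with s hs
    exact (memLp_powerFun_iff _).2 hs
  have hpm : AEStronglyMeasurable (fun s => power (v s)) (volume.restrict (Ici 0)) := by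
    refine aestronglyMeasurable_of_tendsto_ae atTop htm ?_
    filter_upwards [hae] with s hs using tendsto_truncPower hβ hs
  have hen : ∀ᵐ s ∂(volume.restrict (Ici (0 : ℝ))), ‖power (v s)‖ₑ = g s := by
    filter_upwards [hae] with s hs using enorm_power hs
  have hint : IntegrableOn (fun s => power (v s)) (Ici 0) volume := by
    refine ⟨hpm, ?_⟩
    rw [HasFiniteIntegral, lintegral_congr_ae hen]
    exact hgfin.lt_top
  refine ⟨hint, fun t ht => ?_⟩
  have hsub : Ici t ⊆ Ici 0 := Ici_subset_Ici.2 ht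
  rw [integral_norm_eq_lintegral_enorm (hint.mono_set hsub).aestronglyMeasurable,
    lintegral_congr_ae (ae_restrict_of_ae_restrict_of_subset hsub hen), hst',
    ENNReal.toReal_rpow, ← ENNReal.rpow_mul, one_div_mul_cancel (by linarith), ENNReal.rpow_one]

lemma stNorm_mono (v : ℝ → L2 d) {I J : Set ℝ} (h : I ⊆ J) : stNorm v I ≤ stNorm v J := by
  have hp := one_lt_p1 (d := d)
  exact ENNReal.rpow_le_rpow (lintegral_mono_set h) (by positivity)

/-- The tail of the space-time norm tends to zero, because its `p₁`-th power is the tail of a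
convergent integral. -/
lemma tendsto_stNorm {v : ℝ → L2 d} (hβ : 1 ≤ 4 / ((d : ℝ) - 2))
    (hv : ContinuousOn v (Ici 0)) (hst : stNorm v (Ici 0) < ⊤) :
    Tendsto (fun t : ℝ => stNorm v (Ici t)) atTop (𝓝 0) := by
  have hp := one_lt_p1 (d := d)
  obtain ⟨hint, heq⟩ := integrable_power hβ hv hst
  have h1 : IntegrableOn (fun s => ‖power (v s)‖) (Ioi 0) volume :=
    (hint.mono_set Ioi_subset_Ici_self).norm
  have h2 := intervalIntegral_tendsto_integral_Ioi 0 h1 tendsto_id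
  have h3 : Tendsto (fun t : ℝ => ∫ s in Ici t, ‖power (v s)‖) atTop (𝓝 0) := by
    have h4 := h2.const_sub (∫ s in Ioi 0, ‖power (v s)‖)
    rw [sub_self] at h4
    refine h4.congr' ?_
    filter_upwards [eventually_ge_atTop 0] with t ht
    have h5 := intervalIntegral.integral_interval_add_Ioi
      (f := fun s => ‖power (v s)‖) (a := 0) (b := t) h1 (h1.mono_set (Ioi_subset_Ioi ht))
    rw [integral_Ici_eq_integral_Ioi, ← h5]
    simp
  have h6 : Tendsto (fun t : ℝ => (stNorm v (Ici t)).toReal) atTop (𝓝 0) := by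
    have h7 := h3.rpow_const (p := 1 / p1 d) (Or.inr (by positivity))
    rw [Real.zero_rpow (by positivity)] at h7
    refine h7.congr' ?_
    filter_upwards [eventually_ge_atTop 0] with t ht
    rw [heq t ht, ← Real.rpow_mul ENNReal.toReal_nonneg, mul_one_div_cancel (by linarith),
      Real.rpow_one]
  have h8 := (ENNReal.continuous_ofReal.tendsto 0).comp h6
  rw [ENNReal.ofReal_zero] at h8
  refine h8.congr' ?_
  filter_upwards [eventually_ge_atTop 0] with t ht
  exact ENNReal.ofReal_toReal ((stNorm_mono v (Ici_subset_Ici.2 ht)).trans_lt hst).ne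

/-! ### Distributions in the homogeneous Sobolev space -/

lemma HasFourierFunction.ae_eq {d : ℕ} {u : 𝓢'(Space d, ℂ)} {g g' : Space d → ℂ}
    (h : HasFourierFunction u g) (h' : HasFourierFunction u g') : g =ᵐ[volume] g' := by
  have hloc := h.1.sub h'.1
  have h1 := ae_eq_zero_of_integral_contDiff_smul_eq_zero hloc (μ := volume) ?_
  · filter_upwards [h1] with ξ hξ
    exact sub_eq_zero.1 hξ
  · intro φ hφ hcpt
    have hc : HasCompactSupport (fun ξ => (φ ξ : ℂ)) :=
      hcpt.comp_left (g := fun x : ℝ => (x : ℂ)) Complex.ofReal_zero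
    have hs : ContDiff ℝ ((⊤ : ℕ∞) : WithTop ℕ∞) (fun ξ => (φ ξ : ℂ)) := Complex.ofRealCLM.contDiff.comp hφ
    have e1 := h.2 (hc.toSchwartzMap hs)
    have e2 := h'.2 (hc.toSchwartzMap hs)
    have i1 := h.1.integrable_smul_left_of_hasCompactSupport hφ.continuous hcpt
    have i2 := h'.1.integrable_smul_left_of_hasCompactSupport hφ.continuous hcpt
    simp only [Pi.sub_apply, smul_sub]
    rw [integral_sub i1 i2, sub_eq_zero]
    exact e1.symm.trans e2

/-- Square integrability of `|ξ| g`, the condition on the Fourier transform of an element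
of `Ḣ¹`. -/
def EnergyFunction (g : Space d → ℂ) : Prop :=
  AEStronglyMeasurable g volume ∧ MemLp (fun ξ => (freq ξ : ℂ) * g ξ) 2 volume

/-- In dimension at least three, `|ξ| g ∈ L²` forces `g ∈ L¹ + L²`: near the origin this is the
Cauchy-Schwarz inequality, as `1 / |ξ|` is locally square integrable. -/
lemma EnergyFunction.exists_split {g : Space d → ℂ} (hg : EnergyFunction g) :
    ∃ g₁ g₂ : Space d → ℂ, MemLp g₁ 1 volume ∧ MemLp g₂ 2 volume ∧ g = g₁ + g₂ := by
  have hball : MeasurableSet (Metric.ball (0 : Space d) 1) := measurableSet_ball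
  refine ⟨(Metric.ball 0 1).indicator g, (Metric.ball 0 1)ᶜ.indicator g, ?_, ?_,
    (indicator_self_add_compl _ _).symm⟩
  · have h1 : MemLp (indicator (Metric.ball (0 : Space d) 1) fun ξ => ((freq ξ)⁻¹ : ℂ)) 2 volume := by
      have hm : AEStronglyMeasurable (fun ξ : Space d => ((freq ξ)⁻¹ : ℂ)) volume :=
        (Complex.continuous_ofReal.comp continuous_freq).measurable.inv.aestronglyMeasurable
      rw [memLp_indicator_iff_restrict hball, memLp_two_iff_integrable_sq_norm hm.restrict]
      have hfin : Module.finrank ℝ (Space d) = d := by simp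
      have h3 := hd.out
      refine integrableOn_ball_of_norm_le_rpow (C := 1) (α := 2) ?_ ?_ ?_ ?_
      · rw [hfin]; omega
      · rw [hfin]; exact_mod_cast (by omega : 2 < d)
      · refine Eventually.of_forall fun ξ => ?_
        rw [Real.norm_of_nonneg (by positivity), norm_inv, Complex.norm_real, one_mul,
          Real.rpow_neg (norm_nonneg _), Real.rpow_two, inv_pow]
        rcases eq_or_ne ξ 0 with rfl | h0
        · simp [freq]
        have hp : 0 < ‖ξ‖ := norm_pos_iff.2 h0
        refine inv_anti₀ (by positivity) ?_
        rw [Real.norm_of_nonneg (freq_pos_of_ne h0).le, freq]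
        refine pow_le_pow_left₀ hp.le ?_ 2
        nlinarith [Real.pi_gt_three]
      · exact hm.norm.pow 2
    have h2 := h1.integrable_mul hg.2
    rw [memLp_one_iff_integrable]
    refine h2.congr ?_
    filter_upwards [ae_freq_pos d] with ξ hξ
    by_cases h : ξ ∈ Metric.ball (0 : Space d) 1
    · have : (freq ξ : ℂ) ≠ 0 := by exact_mod_cast hξ.ne'
      simp only [Pi.mul_apply, indicator_of_mem h]
      field_simp
    · simp [indicator_of_notMem h]
  · refine hg.2.of_le (hg.1.indicator hball.compl) (Eventually.of_forall fun ξ => ?_)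
    by_cases h : ξ ∈ (Metric.ball (0 : Space d) 1)ᶜ
    · rw [indicator_of_mem h, norm_mul, Complex.norm_real]
      have h1 : 1 ≤ ‖ξ‖ := by simpa using h
      have h2 : 1 ≤ ‖freq ξ‖ := by
        rw [freq, Real.norm_of_nonneg (by positivity)]
        nlinarith [Real.pi_gt_three]
      exact le_mul_of_one_le_left (norm_nonneg _) h2
    · rw [indicator_of_notMem h, norm_zero]
      positivity

lemma EnergyFunction.integrable_mul {g : Space d → ℂ} (hg : EnergyFunction g)
    (χ : 𝓢(Space d, ℂ)) : Integrable (fun ξ => χ ξ * g ξ) volume := by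
  obtain ⟨g₁, g₂, h1, h2, rfl⟩ := hg.exists_split
  have i1 : Integrable (fun ξ => χ ξ * g₁ ξ) volume := χ.memLp_top.integrable_mul h1
  have i2 : Integrable (fun ξ => χ ξ * g₂ ξ) volume := (χ.memLp 2).integrable_mul h2
  refine (i1.add i2).congr (Eventually.of_forall fun ξ => ?_)
  simp only [Pi.add_apply, mul_add]

/-- In dimension at least three every `g` with `|ξ| g ∈ L²` is the Fourier transform of a tempered
distribution. -/
lemma EnergyFunction.exists_hasFourierFunction {g : Space d → ℂ} (hg : EnergyFunction g) :
    ∃ u, HasFourierFunction u g := by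
  obtain ⟨g₁, g₂, h1, h2, rfl⟩ := hg.exists_split
  refine ⟨𝓕⁻ (Lp.toTemperedDistribution (h1.toLp g₁) + Lp.toTemperedDistribution (h2.toLp g₂)),
    (h1.locallyIntegrable le_rfl).add (h2.locallyIntegrable one_le_two), fun χ => ?_⟩
  have i1 : Integrable (fun ξ => χ ξ * g₁ ξ) volume := χ.memLp_top.integrable_mul h1
  have i2 : Integrable (fun ξ => χ ξ * g₂ ξ) volume := (χ.memLp 2).integrable_mul h2
  rw [FourierTransform.fourier_fourierInv_eq]
  have e : (Lp.toTemperedDistribution (h1.toLp g₁) + Lp.toTemperedDistribution (h2.toLp g₂)) χ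
      = Lp.toTemperedDistribution (h1.toLp g₁) χ + Lp.toTemperedDistribution (h2.toLp g₂) χ := rfl
  rw [e, Lp.toTemperedDistribution_apply, Lp.toTemperedDistribution_apply]
  simp only [Pi.add_apply, mul_add]
  rw [integral_add i1 i2]
  congr 1
  · refine integral_congr_ae ?_
    filter_upwards [h1.coeFn_toLp] with ξ hξ
    rw [hξ, smul_eq_mul]
  · refine integral_congr_ae ?_
    filter_upwards [h2.coeFn_toLp] with ξ hξ
    rw [hξ, smul_eq_mul]

lemma hasFourierFunction_L2 {d : ℕ} (f : L2 d) :
    HasFourierFunction (f : 𝓢'(Space d, ℂ)) (𝓕 f : L2 d) := by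
  refine ⟨(Lp.memLp _).locallyIntegrable one_le_two, fun χ => ?_⟩
  rw [Lp.fourier_toTemperedDistribution_eq, Lp.toTemperedDistribution_apply]
  rfl

lemma HasFourierFunction.fourierFunction_ae {d : ℕ} {u : 𝓢'(Space d, ℂ)} {g : Space d → ℂ}
    (h : HasFourierFunction u g) : fourierFunction u =ᵐ[volume] g := by
  have h1 : ∃ g, HasFourierFunction u g := ⟨g, h⟩
  rw [fourierFunction, dif_pos h1]
  exact h1.choose_spec.ae_eq h

lemma HasFourierFunction.dist_eq {d : ℕ} {u : 𝓢'(Space d, ℂ)} {g : Space d → ℂ}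
    (h : HasFourierFunction u g) : distOfFourier g = u := by
  have h1 : ∃ u, HasFourierFunction u g := ⟨u, h⟩
  rw [distOfFourier, dif_pos h1]
  have h2 : 𝓕 h1.choose = 𝓕 u := by
    ext χ
    rw [h1.choose_spec.2 χ, h.2 χ]
  have h3 : ∀ w : 𝓢'(Space d, ℂ), 𝓕⁻ (𝓕 w) = w := FourierTransform.fourierInv_fourier_eq
  rw [← h3 h1.choose, h2, h3]

lemma HasFourierFunction.hdotNorm_eq {d : ℕ} {u : 𝓢'(Space d, ℂ)} {g : Space d → ℂ}
    (h : HasFourierFunction u g) :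
    hdotNorm u = eLpNorm (fun ξ => (freq ξ : ℂ) * g ξ) 2 volume := by
  rw [hdotNorm, if_pos ⟨g, h⟩]
  refine eLpNorm_congr_ae ?_
  filter_upwards [h.fourierFunction_ae] with ξ hξ
  rw [hξ]

/-- The hypotheses on `g` and `g'` make the pairings with Schwartz functions integrable. -/
lemma HasFourierFunction.sub {u u' : 𝓢'(Space d, ℂ)} {g g' : Space d → ℂ}
    (h : HasFourierFunction u g) (h' : HasFourierFunction u' g') (hg : EnergyFunction g)
    (hg' : EnergyFunction g') : HasFourierFunction (u - u') (g - g') := by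
  refine ⟨h.1.sub h'.1, fun χ => ?_⟩
  have e : (𝓕 (u - u')) χ = (𝓕 u) χ - (𝓕 u') χ := rfl
  rw [e, h.2 χ, h'.2 χ, ← integral_sub (hg.integrable_mul χ) (hg'.integrable_mul χ)]
  simp only [Pi.sub_apply, mul_sub]

/-! ### Real-valued solutions and Hermitian symmetry -/

/-- Pointwise complex conjugation on `L²`. -/
def conjL {d : ℕ} : L2 d →L[ℝ] L2 d := (Complex.conjCLE : ℂ →L[ℝ] ℂ).compLpL 2 volume

/-- The Hermitian reflection `f ↦ conj (f (-·))` on `L²`, which is complex conjugation seen through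
the Fourier transform. -/
def hermL {d : ℕ} : L2 d →L[ℝ] L2 d :=
  conjL ∘L (Lp.compMeasurePreservingₗᵢ ℝ Neg.neg
    (Measure.measurePreserving_neg (volume : Measure (Space d)))).toContinuousLinearMap

lemma conjL_ae {d : ℕ} (f : L2 d) : conjL f =ᵐ[volume] fun x => (starRingEnd ℂ) (f x) :=
  (Complex.conjCLE : ℂ →L[ℝ] ℂ).coeFn_compLpL f

lemma hermL_ae {d : ℕ} (f : L2 d) : hermL f =ᵐ[volume] fun x => (starRingEnd ℂ) (f (-x)) := by
  have hm := Measure.measurePreserving_neg (volume : Measure (Space d))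
  have h1 : hermL f = conjL (Lp.compMeasurePreserving Neg.neg hm f) := rfl
  rw [h1]
  filter_upwards [conjL_ae (Lp.compMeasurePreserving Neg.neg hm f),
    Lp.coeFn_compMeasurePreserving f hm] with x h2 h3
  rw [h2, h3]
  rfl

lemma fourier_conj {d : ℕ} (φ : Space d → ℂ) (ξ : Space d) :
    𝓕 (fun x => (starRingEnd ℂ) (φ x)) ξ = (starRingEnd ℂ) (𝓕 φ (-ξ)) := by
  rw [Real.fourier_eq, Real.fourier_eq, ← integral_conj]
  congr 1
  ext x
  simp only [inner_neg_right, neg_neg, Circle.smul_def, smul_eq_mul, map_mul]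
  rw [← Circle.coe_inv_eq_conj, ← AddChar.map_neg_eq_inv]

/-- The identity is checked pointwise on Schwartz functions, which are dense. -/
lemma fourier_conjL {d : ℕ} (f : L2 d) : 𝓕 (conjL f) = hermL (𝓕 f) := by
  have hd1 := SchwartzMap.denseRange_toLpCLM (E := Space d) (F := ℂ) (p := 2) (μ := volume)
    ENNReal.ofNat_ne_top
  have hF : Continuous fun f : L2 d => (𝓕 f : L2 d) := (Lp.fourierTransformₗᵢ (Space d) ℂ).continuous
  refine congrFun (hd1.equalizer (hF.comp conjL.continuous) (hermL.continuous.comp hF) ?_) f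
  funext φ
  simp only [Function.comp_apply]
  set ψ : 𝓢(Space d, ℂ) := φ.postcompCLM (Complex.conjCLE : ℂ →L[ℝ] ℂ) with hψ
  have e1 : conjL (SchwartzMap.toLpCLM ℝ ℂ 2 volume φ) = ψ.toLp 2 := by
    refine Lp.ext ?_
    filter_upwards [conjL_ae (SchwartzMap.toLpCLM ℝ ℂ 2 volume φ), φ.coeFn_toLp 2, ψ.coeFn_toLp 2]
      with x h1 h2 h3
    rw [h1, h3]
    exact congrArg _ h2
  rw [e1, SchwartzMap.toLp_fourier_eq]
  have e2 : (𝓕 (SchwartzMap.toLpCLM ℝ ℂ 2 volume φ) : L2 d) = (𝓕 φ).toLp 2 :=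
    SchwartzMap.toLp_fourier_eq φ
  rw [e2]
  refine Lp.ext ?_
  have hq := (Measure.measurePreserving_neg (volume : Measure (Space d))).quasiMeasurePreserving
  have hφ : ∀ᵐ x ∂(volume : Measure (Space d)), ((𝓕 φ).toLp 2 : L2 d) x = (𝓕 φ) x :=
    (𝓕 φ).coeFn_toLp 2 volume
  filter_upwards [hermL_ae ((𝓕 φ).toLp 2), (𝓕 ψ).coeFn_toLp 2,
    hq.ae hφ] with x h1 h2 h3
  rw [h1, h2, h3, SchwartzMap.fourier_coe, SchwartzMap.fourier_coe]
  exact fourier_conj φ x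

lemma isRealL2_iff_conjL {d : ℕ} (f : L2 d) : IsRealL2 f ↔ conjL f = f := by
  constructor
  · intro h
    refine Lp.ext ?_
    filter_upwards [conjL_ae f, h] with x h1 h2
    rw [h1]
    exact Complex.conj_eq_iff_im.2 h2
  · intro h
    have h1 := conjL_ae f
    rw [h] at h1
    filter_upwards [h1] with x h2
    exact Complex.conj_eq_iff_im.1 h2.symm

/-- `f ∈ L²` is real-valued if and only if its Fourier transform is Hermitian symmetric. -/
lemma isRealL2_iff_hermL {d : ℕ} (f : L2 d) : IsRealL2 f ↔ hermL (𝓕 f) = 𝓕 f := by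
  rw [isRealL2_iff_conjL, ← fourier_conjL]
  exact (Lp.fourierTransformₗᵢ (Space d) ℂ).injective.eq_iff.symm

lemma isRealL2_power {d : ℕ} {f : L2 d} (h : IsRealL2 f) : IsRealL2 (power f) := by
  rw [power]
  split_ifs with hm
  · filter_upwards [hm.coeFn_toLp, h] with x h1 h2
    rw [h1, powerFun, Complex.im_ofReal_mul, h2, mul_zero]
  · filter_upwards [Lp.coeFn_zero ℂ 2 (volume : Measure (Space d))] with x h1
    rw [h1]; rfl

lemma hermL_mulL {m : ℝ → ℂ} {B : ℝ} (hm : GoodSymbol m B) (hr : ∀ r, (starRingEnd ℂ) (m r) = m r)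
    (f : L2 d) : hermL (mulL m f) = mulL m (hermL f) := by
  refine Lp.ext ?_
  have hq := (Measure.measurePreserving_neg (volume : Measure (Space d))).quasiMeasurePreserving
  filter_upwards [hermL_ae (mulL m f), mulL_ae hm (hermL f), hermL_ae f, hq.ae (mulL_ae hm f)]
    with x h1 h2 h3 h4
  rw [h1, h2, h3, h4, map_mul, freq_neg, hr]

lemma isRealDist_of_hermitian {d : ℕ} {u : 𝓢'(Space d, ℂ)} {g : Space d → ℂ}
    (h : HasFourierFunction u g)
    (hg : ∀ᵐ ξ ∂(volume : Measure (Space d)), (starRingEnd ℂ) (g (-ξ)) = g ξ) : IsRealDist u := by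
  intro χ hχ
  have h1 : u χ = ∫ ξ, (𝓕⁻ χ : 𝓢(Space d, ℂ)) ξ * g ξ := by
    rw [← h.2, TemperedDistribution.fourier_apply, FourierTransform.fourier_fourierInv_eq]
  have hχ' : (fun x => (starRingEnd ℂ) (χ x)) = χ := by
    funext x
    exact Complex.conj_eq_iff_im.2 (hχ x)
  have h2 : ∀ ξ, (starRingEnd ℂ) ((𝓕⁻ χ : 𝓢(Space d, ℂ)) (-ξ)) = (𝓕⁻ χ : 𝓢(Space d, ℂ)) ξ := by
    intro ξ
    rw [SchwartzMap.fourierInv_coe, Real.fourierInv_eq_fourier_neg, Real.fourierInv_eq_fourier_neg,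
      ← fourier_conj, hχ']
  rw [← Complex.conj_eq_iff_im, h1, ← integral_conj,
    ← integral_neg_eq_self (μ := volume) (fun ξ => (starRingEnd ℂ) ((𝓕⁻ χ : 𝓢(Space d, ℂ)) ξ * g ξ))]
  refine integral_congr_ae ?_
  filter_upwards [hg] with ξ hξ
  rw [map_mul, hξ, h2]

/-! ### Scattering of the forced wave equation -/

/-- The asymptotic state of `|∇|v` for the forced wave evolution. -/
def asymA (a0 : L2 d) (F : ℝ → L2 d) : L2 d := a0 - ∫ s in Ioi (0 : ℝ), mulL (sinS s) (F s)

/-- The asymptotic state of `∂ₜv` for the forced wave evolution. -/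
def asymB (V1 : L2 d) (F : ℝ → L2 d) : L2 d := V1 + ∫ s in Ioi (0 : ℝ), mulL (cosS s) (F s)

lemma integrableOn_mulL {m : ℝ → ℝ → ℂ} (hm : ∀ s, GoodSymbol (m s) 1)
    (hc : ∀ r : ℝ, 0 < r → Continuous fun s => m s r) {F : ℝ → L2 d}
    (hF : IntegrableOn F (Ioi 0)) : IntegrableOn (fun s => mulL (m s) (F s)) (Ioi 0) := by
  have hi : ∀ t : ℝ, 0 ≤ t → IntervalIntegrable F volume 0 t := fun t ht =>
    (intervalIntegrable_iff_integrableOn_Ioc_of_le ht).2 (hF.mono_set Ioc_subset_Ioi_self)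
  have hi' : ∀ t : ℝ, 0 ≤ t → IntervalIntegrable (fun s => mulL (m s) (F s)) volume 0 t :=
    fun t ht => intervalIntegrable_mulL ht (fun s _ => hm s) (fun r hr => (hc r hr).continuousOn)
      (hi t ht)
  refine integrableOn_Ioi_of_intervalIntegral_norm_bounded (b := fun n : ℕ => (n : ℝ)) (l := atTop)
    (∫ s in Ioi 0, ‖F s‖) 0
    (fun n => (intervalIntegrable_iff_integrableOn_Ioc_of_le n.cast_nonneg).1 (hi' n n.cast_nonneg))
    tendsto_natCast_atTop_atTop (Eventually.of_forall fun n => ?_)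
  calc ∫ s in (0 : ℝ)..n, ‖mulL (m s) (F s)‖ ≤ ∫ s in (0 : ℝ)..n, ‖F s‖ :=
        intervalIntegral.integral_mono_on n.cast_nonneg (hi' n n.cast_nonneg).norm
          (hi n n.cast_nonneg).norm fun s _ => by simpa using norm_mulL_le (hm s) (F s)
    _ ≤ ∫ s in Ioi 0, ‖F s‖ := by
        rw [intervalIntegral.integral_of_le n.cast_nonneg]
        exact setIntegral_mono_set hF.norm (Eventually.of_forall fun _ => norm_nonneg _)
          Ioc_subset_Ioi_self.eventuallyLE

lemma norm_integral_mulL_le {m : ℝ → ℝ → ℂ} (hm : ∀ s, GoodSymbol (m s) 1) {F : ℝ → L2 d}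
    (hF : IntegrableOn F (Ioi 0)) {t : ℝ} (ht : 0 ≤ t) :
    ‖∫ s in Ioi t, mulL (m s) (F s)‖ ≤ ∫ s in Ioi t, ‖F s‖ :=
  norm_integral_le_of_norm_le (hF.mono_set (Ioi_subset_Ioi ht)).norm
    (Eventually.of_forall fun s => by simpa using norm_mulL_le (hm s) (F s))

/-- The distance in energy between the forced wave evolution at time `t` and the free evolution of
its asymptotic state is controlled by the forcing after time `t`. -/
lemma norm_state_sub_le (a0 V1 : L2 d) {F : ℝ → L2 d} (hF : IntegrableOn F (Ioi 0)) {t : ℝ}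
    (ht : 0 ≤ t) :
    ‖stateA a0 V1 F t - (mulL (cosS t) (asymA a0 F) + mulL (sinS t) (asymB V1 F))‖
        ≤ 2 * ∫ s in Ioi t, ‖F s‖ ∧
      ‖stateB a0 V1 F t - (mulL (cosS t) (asymB V1 F) - mulL (sinS t) (asymA a0 F))‖
        ≤ 2 * ∫ s in Ioi t, ‖F s‖ := by
  set IS : L2 d := ∫ s in Ioi t, mulL (sinS s) (F s) with hIS
  set IC : L2 d := ∫ s in Ioi t, mulL (cosS s) (F s) with hIC
  have h1 := intervalIntegral.integral_Ioi_sub_Ioi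
    (integrableOn_mulL goodSymbol_sinS (fun r _ => continuous_sinS r) hF) ht
  have h2 := intervalIntegral.integral_Ioi_sub_Ioi
    (integrableOn_mulL goodSymbol_cosS (fun r _ => continuous_cosS r) hF) ht
  have eS : a0 - primS F t = asymA a0 F + IS := by
    rw [primS, ← h1, asymA]; abel
  have eC : V1 + primC F t = asymB V1 F - IC := by
    rw [primC, ← h2, asymB]; abel
  have nS : ‖IS‖ ≤ ∫ s in Ioi t, ‖F s‖ := norm_integral_mulL_le goodSymbol_sinS hF ht
  have nC : ‖IC‖ ≤ ∫ s in Ioi t, ‖F s‖ := norm_integral_mulL_le goodSymbol_cosS hF ht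
  have hc : ∀ f : L2 d, ‖mulL (cosS t) f‖ ≤ ‖f‖ := fun f => by
    simpa using norm_mulL_le (goodSymbol_cosS t) f
  have hs : ∀ f : L2 d, ‖mulL (sinS t) f‖ ≤ ‖f‖ := fun f => by
    simpa using norm_mulL_le (goodSymbol_sinS t) f
  rw [stateA, stateB, eS, eC]
  simp only [map_add, map_sub]
  constructor
  · have e : ∀ x y z w : L2 d, x + y + (z - w) - (x + z) = y - w := fun x y z w => by abel
    rw [e]
    refine (norm_sub_le _ _).trans ?_
    linarith [hc IS, hs IC]
  · have e : ∀ x y z w : L2 d, x - y - (z + w) - (x - z) = -(y + w) := fun x y z w => by abel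
    rw [e, norm_neg]
    refine (norm_add_le _ _).trans ?_
    linarith [hc IC, hs IS]

/-! ### Growth of the solution in `L²` and decay of the mass term -/

/-- The growth exponent of the `L²` norm of the solution. -/
def growthExp (μ α : ℝ) : ℝ := max (1 / 2 + (order μ).re) (1 - α)

/-- The `L²` norm of the solution grows at most at the rate of the symbols of the propagator,
or at that of the Duhamel term of the decaying nonlinearity. -/
lemma exists_growth_bound {μ : ℝ} (hμ : 0 ≤ μ) (α : ℝ) : ∃ K > 0, ∀ (V0 V1 : L2 d)
    (V n : ℝ → L2 d) (N : ℝ → ℝ), IntegrableOn N (Ioi 0) → (∀ s, 0 ≤ N s) →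
    (∀ s, 0 ≤ s → ‖n s‖ ≤ (1 + s) ^ (-α) * N s) →
    (∀ t, 0 ≤ t → V t = mulL (symbolE0 μ t 0) V0 + mulL (symbolE1 μ t 0) V1
      + ∫ s in (0 : ℝ)..t, mulL (symbolE1 μ t s) (n s)) →
    ∀ t, 0 ≤ t → ‖V t‖ ≤ K * (‖V0‖ + ‖V1‖ + ∫ s in Ioi 0, N s)
      * ((1 + t) ^ growthExp μ α * logCorr μ t) := by
  obtain ⟨K, hK, h0, h1⟩ := exists_symbol_bound hμ
  refine ⟨K, hK, fun V0 V1 V n N hN hN0 hn hV t ht => ?_⟩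
  obtain ⟨D0, D1, -, hc, -⟩ := exists_symbol_derivatives hμ
  have hL : 0 ≤ logCorr μ t := zero_le_one.trans (one_le_logCorr μ ht)
  set R := (1 + t) ^ growthExp μ α * logCorr μ t with hR
  have hR0 : 0 ≤ R := by positivity
  set a := 1 / 2 + (order μ).re with ha
  have haγ : (1 + t) ^ a ≤ (1 + t) ^ growthExp μ α :=
    Real.rpow_le_rpow_of_exponent_le (by linarith) (le_max_left _ _)
  have g0 : GoodSymbol (symbolE0 μ t 0) (K * R) := by
    refine ⟨(hc t 0 (by linarith) (by norm_num)).1, fun r hr => (h0 t r ht hr).trans ?_⟩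
    rw [mul_assoc, hR]
    gcongr
  have g1 : ∀ s ∈ Icc 0 t, GoodSymbol (symbolE1 μ t s)
      (K * (1 + t) ^ a * (1 + s) ^ (1 / 2 - (order μ).re) * logCorr μ t) := fun s hs =>
    ⟨(hc t s (by linarith) (by linarith [hs.1])).2.1, fun r hr => h1 t s r hs.1 hs.2 hr⟩
  have g10 : GoodSymbol (symbolE1 μ t 0) (K * R) := by
    refine (g1 0 ⟨le_rfl, ht⟩).mono ?_
    rw [add_zero, Real.one_rpow, mul_one, mul_assoc, hR]
    gcongr
  -- The two cases are those of a growing and of a decaying weight of the Duhamel term.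
  have hpow : ∀ s, 0 ≤ s → s ≤ t →
      (1 + t) ^ a * (1 + s) ^ (1 / 2 - (order μ).re - α) ≤ (1 + t) ^ growthExp μ α := by
    intro s hs hst
    rcases le_total (1 / 2 - (order μ).re - α) 0 with hb | hb
    · have h2 : (1 + s) ^ (1 / 2 - (order μ).re - α) ≤ 1 :=
        Real.rpow_le_one_of_one_le_of_nonpos (by linarith) hb
      exact (mul_le_of_le_one_right (by positivity) h2).trans haγ
    · have h2 : (1 + s) ^ (1 / 2 - (order μ).re - α) ≤ (1 + t) ^ (1 / 2 - (order μ).re - α) :=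
        Real.rpow_le_rpow (by linarith) (by linarith) hb
      refine (mul_le_mul_of_nonneg_left h2 (by positivity)).trans ?_
      rw [← Real.rpow_add (by linarith)]
      refine Real.rpow_le_rpow_of_exponent_le (by linarith) (le_trans (le_of_eq ?_) (le_max_right _ _))
      rw [ha]; ring
  have hNi : IntervalIntegrable N volume 0 t :=
    (intervalIntegrable_iff_integrableOn_Ioc_of_le ht).2 (hN.mono_set Ioc_subset_Ioi_self)
  have hI : ‖∫ s in (0 : ℝ)..t, mulL (symbolE1 μ t s) (n s)‖ ≤ K * R * ∫ s in Ioi 0, N s := by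
    have h2 : ‖∫ s in (0 : ℝ)..t, mulL (symbolE1 μ t s) (n s)‖ ≤ ∫ s in (0 : ℝ)..t, K * R * N s := by
      refine intervalIntegral.norm_integral_le_of_norm_le ht (Eventually.of_forall fun s hs => ?_)
        (hNi.const_mul _)
      have hs0 := hs.1.le
      refine (norm_mulL_le (g1 s ⟨hs0, hs.2⟩) (n s)).trans ?_
      have h4 : 0 ≤ (1 + s) ^ (1 / 2 - (order μ).re) := Real.rpow_nonneg (by linarith) _
      have h5 : (1 + s) ^ (1 / 2 - (order μ).re - α)
          = (1 + s) ^ (1 / 2 - (order μ).re) * (1 + s) ^ (-α) := by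
        rw [sub_eq_add_neg _ α, Real.rpow_add (by linarith)]
      calc _ ≤ K * (1 + t) ^ a * (1 + s) ^ (1 / 2 - (order μ).re) * logCorr μ t
              * ((1 + s) ^ (-α) * N s) :=
            mul_le_mul_of_nonneg_left (hn s hs0) (by positivity)
        _ = K * (((1 + t) ^ a * (1 + s) ^ (1 / 2 - (order μ).re - α)) * logCorr μ t) * N s := by
            rw [h5]; ring
        _ ≤ K * R * N s := by
            have := hN0 s
            rw [hR]
            gcongr
            exact hpow s hs0 hs.2
    refine h2.trans ?_
    rw [intervalIntegral.integral_const_mul]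
    refine mul_le_mul_of_nonneg_left ?_ (by positivity)
    rw [intervalIntegral.integral_of_le ht]
    exact setIntegral_mono_set hN (Eventually.of_forall hN0) Ioc_subset_Ioi_self.eventuallyLE
  rw [hV t ht]
  refine (norm_add₃_le).trans ?_
  have e1 := norm_mulL_le g0 V0
  have e2 := norm_mulL_le g10 V1
  nlinarith

/-- The tail integral behind the decay of the mass term; in the degenerate case `μ = 1/4` the
logarithm survives the integration. -/
lemma exists_tail_bound (μ : ℝ) {δ : ℝ} (hδ : 0 < δ) : ∃ c ≥ 0, ∀ t : ℝ, 0 ≤ t →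
    IntegrableOn (fun s => (1 + s) ^ (-δ - 1) * logCorr μ s) (Ioi t) ∧
      ∫ s in Ioi t, (1 + s) ^ (-δ - 1) * logCorr μ s ≤ c * ((1 + t) ^ (-δ) * logCorr μ t) := by
  obtain ⟨ε, hε0, hε1, hε⟩ : ∃ ε : ℝ, 0 ≤ ε ∧ ε ≤ 1 ∧
      ∀ t, logCorr μ t = 1 + ε * Real.log (1 + t) := by
    by_cases h : μ = 1 / 4
    · exact ⟨1, zero_le_one, le_rfl, fun t => by rw [logCorr, if_pos h, one_mul]⟩
    · exact ⟨0, le_rfl, zero_le_one, fun t => by rw [logCorr, if_neg h, zero_mul, add_zero]⟩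
  set G : ℝ → ℝ := fun s => -((1 + s) ^ (-δ) / δ * (logCorr μ s + ε / δ)) with hG
  have hder : ∀ s : ℝ, 0 ≤ s → HasDerivAt G ((1 + s) ^ (-δ - 1) * logCorr μ s) s := by
    intro s hs
    have hs' : 0 < 1 + s := by linarith
    have h0 : HasDerivAt (fun s : ℝ => 1 + s) 1 s := (hasDerivAt_id s).const_add 1
    have h1 := h0.rpow_const (p := -δ) (Or.inl hs'.ne')
    have h2 : HasDerivAt (fun s => logCorr μ s + ε / δ) (ε * (1 / (1 + s))) s := by
      simp only [hε]
      exact (((h0.log hs'.ne').const_mul ε).const_add 1).add_const _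
    refine (((h1.div_const δ).mul h2).neg).congr_deriv ?_
    have h3 : (1 + s) ^ (-δ) = (1 + s) ^ (-δ - 1) * (1 + s) := by
      rw [← Real.rpow_add_one hs'.ne']; congr 1; ring
    rw [h3]
    field_simp
    ring
  have hpos : ∀ s : ℝ, 0 ≤ s → 0 ≤ (1 + s) ^ (-δ - 1) * logCorr μ s := fun s hs =>
    mul_nonneg (Real.rpow_nonneg (by linarith) _) (zero_le_one.trans (one_le_logCorr μ hs))
  have hlim : Tendsto G atTop (𝓝 0) := by
    have h1 : Tendsto (fun x : ℝ => x ^ (-δ)) atTop (𝓝 0) := tendsto_rpow_neg_atTop hδ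
    have h2 : Tendsto (fun x : ℝ => x ^ (-δ) * Real.log x) atTop (𝓝 0) := by
      refine ((isLittleO_log_rpow_atTop hδ).tendsto_div_nhds_zero).congr' ?_
      filter_upwards [eventually_gt_atTop 0] with x hx
      rw [Real.rpow_neg hx.le]; field_simp
    have h3 : Tendsto (fun s : ℝ => 1 + s) atTop atTop := tendsto_atTop_add_const_left _ _ tendsto_id
    have h4 := (((h1.comp h3).mul_const ((1 + ε / δ) / δ)).add
      ((h2.comp h3).mul_const (ε / δ))).neg
    simp only [zero_mul, add_zero, neg_zero] at h4
    refine h4.congr fun s => ?_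
    simp only [hG, hε, Function.comp_apply]
    ring
  refine ⟨1 / δ * (1 + 1 / δ), by positivity, fun t ht => ⟨?_, ?_⟩⟩
  · exact integrableOn_Ioi_deriv_of_nonneg' (fun s hs => hder s (ht.trans hs))
      (fun s hs => hpos s (ht.trans hs.le)) hlim
  · rw [integral_Ioi_of_hasDerivAt_of_nonneg' (fun s hs => hder s (ht.trans hs))
      (fun s hs => hpos s (ht.trans (le_of_lt hs))) hlim, zero_sub, hG]
    have h1 := one_le_logCorr μ ht
    have h2 : ε / δ ≤ 1 / δ * logCorr μ t := by
      rw [div_eq_mul_one_div ε, mul_comm]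
      exact mul_le_mul_of_nonneg_left (hε1.trans h1) (by positivity)
    have h3 : 0 ≤ (1 + t) ^ (-δ) / δ := by positivity
    calc - -((1 + t) ^ (-δ) / δ * (logCorr μ t + ε / δ))
        = (1 + t) ^ (-δ) / δ * (logCorr μ t + ε / δ) := neg_neg _
      _ ≤ (1 + t) ^ (-δ) / δ * (logCorr μ t + 1 / δ * logCorr μ t) := by gcongr
      _ = _ := by ring

lemma growthExp_lt_one {μ α : ℝ} (hμ : 0 < μ) (hα : 0 < α) : growthExp μ α < 1 := by
  refine max_lt ?_ (by linarith)
  rw [order]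
  split_ifs with h
  · rw [Complex.ofReal_re]
    have : Real.sqrt (1 - 4 * μ) < 1 := by
      rw [Real.sqrt_lt' one_pos]; linarith
    linarith
  · rw [Complex.I_mul_re, Complex.ofReal_im]; norm_num

/-- The forcing of the free wave equation: the nonlinearity and the mass term both have finite
norm in `L¹([t, ∞); L²)`, which decays as `t → ∞`. -/
lemma exists_forcing_bound {d : ℕ} {μ α : ℝ} (hμ : 0 ≤ μ) (hα : 0 < α) : ∃ c ≥ 0, ∀ (V n : ℝ → L2 d)
    (N : ℝ → ℝ) (D : ℝ), 0 ≤ D → ContinuousOn V (Ici 0) →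
    AEStronglyMeasurable n (volume.restrict (Ioi 0)) → IntegrableOn N (Ioi 0) → (∀ s, 0 ≤ N s) →
    (∀ s, 0 ≤ s → ‖n s‖ ≤ (1 + s) ^ (-α) * N s) →
    (∀ s, 0 ≤ s → ‖V s‖ ≤ D * ((1 + s) ^ growthExp μ α * logCorr μ s)) →
    IntegrableOn (fun s => n s - massCoeff μ s • V s) (Ioi 0) ∧
      ∀ t, 0 ≤ t → ∫ s in Ioi t, ‖n s - massCoeff μ s • V s‖
        ≤ (1 + t) ^ (-α) * (∫ s in Ioi t, N s)
          + D * c * (μ * ((1 + t) ^ (growthExp μ α - 1) * logCorr μ t)) := by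
  obtain ⟨c, hc, hM⟩ : ∃ c ≥ 0, ∀ t : ℝ, 0 ≤ t →
      IntegrableOn (fun s => μ * ((1 + s) ^ (growthExp μ α - 2) * logCorr μ s)) (Ioi t) ∧
        ∫ s in Ioi t, μ * ((1 + s) ^ (growthExp μ α - 2) * logCorr μ s)
          ≤ c * (μ * ((1 + t) ^ (growthExp μ α - 1) * logCorr μ t)) := by
    rcases hμ.eq_or_lt with rfl | hμ'
    · exact ⟨0, le_rfl, fun t _ => by simp⟩
    · have hδ : 0 < 1 - growthExp μ α := by linarith [growthExp_lt_one hμ' hα]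
      obtain ⟨c, hc, h⟩ := exists_tail_bound μ hδ
      rw [show -(1 - growthExp μ α) - 1 = growthExp μ α - 2 by ring,
        show -(1 - growthExp μ α) = growthExp μ α - 1 by ring] at h
      refine ⟨c, hc, fun t ht => ⟨(h t ht).1.const_mul μ, ?_⟩⟩
      rw [integral_const_mul]
      calc _ ≤ μ * (c * ((1 + t) ^ (growthExp μ α - 1) * logCorr μ t)) :=
            mul_le_mul_of_nonneg_left (h t ht).2 hμ
        _ = _ := by ring
  refine ⟨c, hc, fun V n N D hD hV hnm hN hN0 hn hVb => ?_⟩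
  have hn' : ∀ t, 0 ≤ t → ∀ s ∈ Ioi t, ‖n s‖ ≤ (1 + t) ^ (-α) * N s := by
    intro t ht s hs
    have hs' : t < s := hs
    refine (hn s (ht.trans hs'.le)).trans (mul_le_mul_of_nonneg_right ?_ (hN0 s))
    exact Real.rpow_le_rpow_of_nonpos (by linarith) (by linarith) (by linarith)
  have hm : ∀ s, 0 ≤ s → ‖massCoeff μ s • V s‖
      ≤ D * (μ * ((1 + s) ^ (growthExp μ α - 2) * logCorr μ s)) := by
    intro s hs
    have h1 : 0 < 1 + s := by linarith
    have h2 : ‖massCoeff μ s‖ = μ * (1 + s) ^ (-2 : ℝ) := by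
      rw [massCoeff, Complex.norm_real, Real.norm_of_nonneg (by positivity), Real.rpow_neg h1.le,
        Real.rpow_two, div_eq_mul_inv]
    rw [norm_smul, h2]
    calc _ ≤ μ * (1 + s) ^ (-2 : ℝ) * (D * ((1 + s) ^ growthExp μ α * logCorr μ s)) :=
          mul_le_mul_of_nonneg_left (hVb s hs) (by positivity)
      _ = _ := by rw [sub_eq_add_neg (growthExp μ α), Real.rpow_add h1]; ring
  have hmm : AEStronglyMeasurable (fun s => massCoeff μ s • V s) (volume.restrict (Ioi 0)) :=
    (((continuousOn_massCoeff μ).smul hV).mono Ioi_subset_Ici_self).aestronglyMeasurable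
      measurableSet_Ioi
  have hni : IntegrableOn n (Ioi 0) := by
    refine (hN.const_mul ((1 + 0 : ℝ) ^ (-α))).mono' hnm ?_
    filter_upwards [self_mem_ae_restrict measurableSet_Ioi] with s hs using hn' 0 le_rfl s hs
  have hmi : IntegrableOn (fun s => massCoeff μ s • V s) (Ioi 0) := by
    refine ((hM 0 le_rfl).1.const_mul D).mono' hmm ?_
    filter_upwards [self_mem_ae_restrict measurableSet_Ioi] with s hs using hm s (le_of_lt hs)
  refine ⟨hni.sub hmi, fun t ht => ?_⟩
  have hNt := (hN.mono_set (Ioi_subset_Ioi ht)).const_mul ((1 + t) ^ (-α))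
  have hMt := (hM t ht).1.const_mul D
  calc ∫ s in Ioi t, ‖n s - massCoeff μ s • V s‖
      ≤ ∫ s in Ioi t, ((1 + t) ^ (-α) * N s
          + D * (μ * ((1 + s) ^ (growthExp μ α - 2) * logCorr μ s))) := by
        refine setIntegral_mono_on ((hni.sub hmi).mono_set (Ioi_subset_Ioi ht)).norm
          (hNt.add hMt) measurableSet_Ioi fun s hs => (norm_sub_le _ _).trans ?_
        exact add_le_add (hn' t ht s hs) (hm s (ht.trans (le_of_lt hs)))
    _ = (1 + t) ^ (-α) * (∫ s in Ioi t, N s)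
          + D * ∫ s in Ioi t, μ * ((1 + s) ^ (growthExp μ α - 2) * logCorr μ s) := by
        rw [integral_add hNt hMt, integral_const_mul, integral_const_mul]
    _ ≤ _ := by
        rw [mul_assoc D]
        exact add_le_add_right (mul_le_mul_of_nonneg_left (hM t ht).2 hD) _

/-! ### The free evolution in the energy space -/

lemma enorm_fourier {d : ℕ} (f : L2 d) : ‖(𝓕 f : L2 d)‖ₑ = ‖f‖ₑ :=
  (Lp.fourierTransformₗᵢ (Space d) ℂ).enorm_map f

lemma energyNorm_le_add {d : ℕ} (w : 𝓢'(Space d, ℂ) × L2 d) :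
    energyNorm w ≤ hdotNorm w.1 + ‖w.2‖ₑ := by
  have h : hdotNorm w.1 ^ 2 + ‖w.2‖ₑ ^ 2 ≤ (hdotNorm w.1 + ‖w.2‖ₑ) ^ (2 : ℝ) := by
    rw [ENNReal.rpow_two, add_sq]
    exact add_le_add_left le_self_add _
  refine (ENNReal.rpow_le_rpow h (by norm_num)).trans ?_
  rw [← ENNReal.rpow_mul]
  norm_num

lemma l2OfFourier_eq {d : ℕ} {g : Space d → ℂ} {f : L2 d} (h : g =ᵐ[volume] f) :
    l2OfFourier g = 𝓕⁻ f := by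
  have h1 : MemLp g 2 volume := (memLp_congr_ae h).2 (Lp.memLp f)
  rw [l2OfFourier, dif_pos h1]
  congr 1
  exact Lp.ext (h1.coeFn_toLp.trans h)

lemma fourier_fourierInv_L2 {d : ℕ} (f : L2 d) : (𝓕 (𝓕⁻ f : L2 d) : L2 d) = f :=
  FourierTransform.fourier_fourierInv_eq f

/-- Every pair `(A, B)` of `L²` functions is the pair `(|∇|u, w)`, on the Fourier side, of a state
`(u, w)` of finite energy, whose free evolution is the rotation of `(A, B)` by the angle `t|ξ|`. -/
lemma exists_free_state (A B : L2 d) : ∃ w : 𝓢'(Space d, ℂ) × L2 d, MemHdot w.1 ∧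
    HasFourierFunction w.1 (fun ξ => (freq ξ : ℂ)⁻¹ * A ξ) ∧ 𝓕 w.2 = B ∧
    ∀ (t : ℝ) (f g S : L2 d), S =ᵐ[volume] (fun ξ => (freq ξ : ℂ) * (𝓕 f : L2 d) ξ) →
      energyNorm (((f : 𝓢'(Space d, ℂ)), g) - freeWave t w)
        ≤ ‖S - (mulL (cosS t) A + mulL (sinS t) B)‖ₑ
          + ‖(𝓕 g : L2 d) - (mulL (cosS t) B - mulL (sinS t) A)‖ₑ := by
  have hEA : ∀ (h : Space d → ℂ) (f : L2 d), f =ᵐ[volume] (fun ξ => (freq ξ : ℂ) * h ξ) →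
      EnergyFunction h := by
    intro h f e
    refine ⟨?_, (memLp_congr_ae e).1 (Lp.memLp f)⟩
    have hm : AEStronglyMeasurable (fun ξ : Space d => (freq ξ : ℂ)⁻¹) volume :=
      (Complex.continuous_ofReal.comp continuous_freq).measurable.inv.aestronglyMeasurable
    refine (hm.mul (Lp.aestronglyMeasurable f)).congr ?_
    filter_upwards [e, ae_freq_pos d] with ξ h1 h2
    have h3 : (freq ξ : ℂ) ≠ 0 := by exact_mod_cast h2.ne'
    rw [Pi.mul_apply, h1, inv_mul_cancel_left₀ h3]
  set gA : Space d → ℂ := fun ξ => (freq ξ : ℂ)⁻¹ * A ξ with hgA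
  have eA : A =ᵐ[volume] fun ξ => (freq ξ : ℂ) * gA ξ := by
    filter_upwards [ae_freq_pos d] with ξ h2
    have h3 : (freq ξ : ℂ) ≠ 0 := by exact_mod_cast h2.ne'
    rw [hgA, mul_inv_cancel_left₀ h3]
  obtain ⟨u, hu⟩ := (hEA gA A eA).exists_hasFourierFunction
  refine ⟨(u, 𝓕⁻ B), ?_, hu, fourier_fourierInv_L2 B, fun t f g S hS => ?_⟩
  · rw [MemHdot, hu.hdotNorm_eq, ← eLpNorm_congr_ae eA]
    exact Lp.eLpNorm_lt_top A
  set P : L2 d := mulL (cosS t) A + mulL (sinS t) B with hP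
  set Q : L2 d := mulL (cosS t) B - mulL (sinS t) A with hQ
  have aP : P =ᵐ[volume] fun ξ => cosS t (freq ξ) * A ξ + sinS t (freq ξ) * B ξ := by
    filter_upwards [Lp.coeFn_add (mulL (cosS t) A) (mulL (sinS t) B),
      mulL_ae (goodSymbol_cosS t) A, mulL_ae (goodSymbol_sinS t) B] with ξ h1 h2 h3
    rw [hP, h1, Pi.add_apply, h2, h3]
  have aQ : Q =ᵐ[volume] fun ξ => cosS t (freq ξ) * B ξ - sinS t (freq ξ) * A ξ := by
    filter_upwards [Lp.coeFn_sub (mulL (cosS t) B) (mulL (sinS t) A),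
      mulL_ae (goodSymbol_cosS t) B, mulL_ae (goodSymbol_sinS t) A] with ξ h1 h2 h3
    rw [hQ, h1, Pi.sub_apply, h2, h3]
  set k : Space d → ℂ := fun ξ => (Real.cos (t * freq ξ) : ℂ) * fourierFunction u ξ
        + ((Real.sin (t * freq ξ) / freq ξ : ℝ) : ℂ) * (𝓕 (𝓕⁻ B : L2 d) : L2 d) ξ with hk
  have ePk : P =ᵐ[volume] fun ξ => (freq ξ : ℂ) * k ξ := by
    filter_upwards [aP, hu.fourierFunction_ae, ae_freq_pos d] with ξ h1 h2 h3
    have h4 : (freq ξ : ℂ) ≠ 0 := by exact_mod_cast h3.ne'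
    rw [h1, hk, fourier_fourierInv_L2]
    simp only [h2, hgA, cosS, sinS]
    push_cast
    field_simp
  have hEk := hEA k P ePk
  obtain ⟨u', hu'⟩ := hEk.exists_hasFourierFunction
  have hw1 : HasFourierFunction (freeWave t (u, 𝓕⁻ B)).1 k := by
    have : (freeWave t (u, 𝓕⁻ B)).1 = u' := hu'.dist_eq
    rw [this]; exact hu'
  have hw2 : (freeWave t (u, 𝓕⁻ B)).2 = 𝓕⁻ Q := by
    refine l2OfFourier_eq ?_
    filter_upwards [aQ, hu.fourierFunction_ae, ae_freq_pos d] with ξ h1 h2 h3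
    have h4 : (freq ξ : ℂ) ≠ 0 := by exact_mod_cast h3.ne'
    rw [h1, fourier_fourierInv_L2]
    simp only [h2, hgA, cosS, sinS]
    push_cast
    field_simp
    ring
  have hsub := (hasFourierFunction_L2 f).sub hw1 (hEA _ S hS) hEk
  refine (energyNorm_le_add _).trans (add_le_add (le_of_eq ?_) (le_of_eq ?_))
  · rw [Prod.fst_sub, hsub.hdotNorm_eq, Lp.enorm_def]
    refine eLpNorm_congr_ae ?_
    filter_upwards [Lp.coeFn_sub S P, hS, ePk] with ξ h1 h2 h3
    rw [h1, Pi.sub_apply, Pi.sub_apply, h2, h3, mul_sub]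
  · rw [Prod.snd_sub, hw2, ← enorm_fourier]
    congr 1
    have e := map_sub (Lp.fourierTransformₗᵢ (Space d) ℂ) g (𝓕⁻ Q)
    have e' : (𝓕 (g - 𝓕⁻ Q : L2 d) : L2 d) = 𝓕 g - 𝓕 (𝓕⁻ Q : L2 d) := e
    rw [e', fourier_fourierInv_L2]

/-! ### Solutions of the nonlinear equation -/

lemma timeInterval_top : timeInterval ⊤ = Ici 0 := by
  ext t; simp [timeInterval]

lemma enorm_le_h1Norm {d : ℕ} (f : L2 d) : ‖f‖ₑ ≤ h1Norm f := by
  rw [← enorm_fourier, Lp.enorm_def, h1Norm]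
  refine eLpNorm_mono fun ξ => ?_
  rw [norm_mul, Complex.norm_real, Real.norm_of_nonneg (Real.sqrt_nonneg _)]
  refine le_mul_of_one_le_left (norm_nonneg _) ?_
  rw [Real.one_le_sqrt]
  nlinarith [sq_nonneg (freq ξ)]

lemma memLp_freq_of_h1Norm {d : ℕ} {f : L2 d} (h : h1Norm f < ⊤) :
    MemLp (fun ξ => (freq ξ : ℂ) * (𝓕 f : L2 d) ξ) 2 volume := by
  refine ⟨(Complex.continuous_ofReal.comp continuous_freq).aestronglyMeasurable.mul
    (Lp.aestronglyMeasurable _), lt_of_le_of_lt (eLpNorm_mono fun ξ => ?_) h⟩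
  rw [norm_mul, norm_mul, Complex.norm_real, Complex.norm_real, Real.norm_eq_abs,
    Real.norm_of_nonneg (Real.sqrt_nonneg _)]
  refine mul_le_mul_of_nonneg_right (Real.abs_le_sqrt ?_) (norm_nonneg _)
  linarith

lemma IsSolution.continuousOn {d : ℕ} {μ₁ μ lam : ℝ} {v₀ v₁ : L2 d} {v : ℝ → L2 d}
    (h : IsSolution μ₁ μ lam ⊤ v₀ v₁ v) : ContinuousOn v (Ici 0) := by
  intro t ht
  have h1 := h.continuous_h1 t (by rwa [timeInterval_top])
  rw [timeInterval_top] at h1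
  rw [ContinuousWithinAt, tendsto_iff_edist_tendsto_0]
  refine tendsto_of_tendsto_of_tendsto_of_le_of_le tendsto_const_nhds h1 (fun _ => zero_le) fun s => ?_
  rw [edist_eq_enorm_sub]
  exact enorm_le_h1Norm _

/-- The nonlinearity on the Fourier side. -/
def forcing {d : ℕ} (μ₁ lam : ℝ) (v : ℝ → L2 d) (s : ℝ) : L2 d :=
  𝓕 ((lam * (1 + s) ^ (-decayExp d μ₁)) • power (v s))

lemma forcing_eq {d : ℕ} (μ₁ lam : ℝ) (v : ℝ → L2 d) (s : ℝ) :
    forcing μ₁ lam v s = (lam * (1 + s) ^ (-decayExp d μ₁)) • (𝓕 (power (v s)) : L2 d) :=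
  ((Lp.fourierTransformₗᵢ (Space d) ℂ).toContinuousLinearEquiv.toContinuousLinearMap.restrictScalars
    ℝ).map_smul _ _

/-- Duhamel's formula on the Fourier side. -/
lemma IsSolution.duhamel_fourier {μ₁ μ lam : ℝ} {v₀ v₁ : L2 d} {v : ℝ → L2 d} (hμ : 0 ≤ μ)
    (h : IsSolution μ₁ μ lam ⊤ v₀ v₁ v) {t : ℝ} (ht : 0 ≤ t) :
    (𝓕 (v t) : L2 d) = mulL (symbolE0 μ t 0) (𝓕 v₀) + mulL (symbolE1 μ t 0) (𝓕 v₁)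
      + ∫ s in (0 : ℝ)..t, mulL (symbolE1 μ t s) (forcing μ₁ lam v s) := by
  obtain ⟨B, h0, h1⟩ := exists_goodSymbol hμ t
  have e0 : propE0 μ t 0 v₀ = 𝓕⁻ (mulL (symbolE0 μ t 0) (𝓕 v₀)) :=
    multiplier_eq (h0 t ⟨ht, le_rfl⟩) v₀
  have e1 : ∀ s ∈ Icc 0 t, ∀ f : L2 d, propE1 μ t s f = 𝓕⁻ (mulL (symbolE1 μ t s) (𝓕 f)) :=
    fun s hs f => multiplier_eq (h1 (t, s) ⟨hs.1, hs.2, le_rfl⟩) f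
  set Φ := Lp.fourierTransformₗᵢ (Space d) ℂ with hΦ
  have eΦ : ∀ f : L2 d, Φ (𝓕⁻ f) = f := fourier_fourierInv_L2
  have h2 : Φ (v t) = _ := congrArg Φ (h.duhamel t (by rwa [timeInterval_top]))
  refine h2.trans ?_
  rw [map_add, map_add, e0, e1 0 ⟨le_rfl, ht⟩, eΦ, eΦ]
  congr 1
  rw [intervalIntegral.integral_of_le ht, intervalIntegral.integral_of_le ht]
  refine (Φ.toContinuousLinearEquiv.integral_comp_comm _).symm.trans ?_
  refine setIntegral_congr_fun measurableSet_Ioc fun s hs => ?_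
  have h3 := e1 s (Ioc_subset_Icc_self hs) ((lam * (1 + s) ^ (-decayExp d μ₁)) • power (v s))
  exact (congrArg Φ h3).trans (eΦ _)

/-! ### The source term of a solution -/

lemma IsSolution.aestronglyMeasurable_forcing {μ₁ μ lam : ℝ} {v₀ v₁ : L2 d} {v : ℝ → L2 d}
    (hβ : 1 ≤ 4 / ((d : ℝ) - 2)) (h : IsSolution μ₁ μ lam ⊤ v₀ v₁ v) :
    AEStronglyMeasurable (forcing μ₁ lam v) (volume.restrict (Ioi 0)) := by
  have hst : stNorm v (Ici 0) < ⊤ := by rw [← timeInterval_top]; exact h.strichartz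
  have h1 := ((integrable_power hβ h.continuousOn hst).1.mono_set
    Ioi_subset_Ici_self).aestronglyMeasurable
  have h2 : AEStronglyMeasurable (fun s => (𝓕 (power (v s)) : L2 d)) (volume.restrict (Ioi 0)) :=
    (Lp.fourierTransformₗᵢ (Space d) ℂ).continuous.comp_aestronglyMeasurable h1
  have h3 : ContinuousOn (fun s : ℝ => lam * (1 + s) ^ (-decayExp d μ₁)) (Ioi 0) := by
    refine continuousOn_const.mul (ContinuousOn.rpow_const (by fun_prop) fun s hs => Or.inl ?_)
    have : (0 : ℝ) < s := hs
    positivity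
  refine ((h3.aestronglyMeasurable measurableSet_Ioi).smul h2).congr
    (Eventually.of_forall fun s => ?_)
  rw [forcing_eq]; rfl

lemma norm_forcing {d : ℕ} {μ₁ lam : ℝ} (hlam : lam = 1 ∨ lam = -1) (v : ℝ → L2 d) {s : ℝ} (hs : 0 ≤ s) :
    ‖forcing μ₁ lam v s‖ = (1 + s) ^ (-decayExp d μ₁) * ‖power (v s)‖ := by
  have h1 : |lam| = 1 := by rcases hlam with rfl | rfl <;> simp
  rw [forcing_eq, norm_smul, Real.norm_eq_abs, abs_mul, h1, one_mul,
    abs_of_nonneg (Real.rpow_nonneg (by linarith) _)]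
  congr 1
  exact (Lp.fourierTransformₗᵢ (Space d) ℂ).norm_map _

/-- The right-hand side of the free wave equation satisfied by the solution, on the Fourier
side. -/
def source {d : ℕ} (μ₁ μ lam : ℝ) (v : ℝ → L2 d) (s : ℝ) : L2 d :=
  forcing μ₁ lam v s - massCoeff μ s • (𝓕 (v s) : L2 d)

/-- The forcing of a solution of bounded size decays at the rate of the theorem. -/
lemma exists_source_bound {μ₁ μ : ℝ} (hμ₁ : 0 < μ₁) (hμ : 0 ≤ μ) (hβ : 1 ≤ 4 / ((d : ℝ) - 2))
    (M : ℝ≥0) : ∃ C ≥ 0, ∀ (lam : ℝ), (lam = 1 ∨ lam = -1) → ∀ (v₀ v₁ : L2 d) (v : ℝ → L2 d),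
      IsSolution μ₁ μ lam ⊤ v₀ v₁ v →
      h1Norm v₀ + ‖v₁‖ₑ + stNorm v (Ici 0) ≤ (M : ℝ≥0∞) →
      IntegrableOn (source μ₁ μ lam v) (Ioi 0) ∧ ∀ t, 0 ≤ t →
        ∫ s in Ioi t, ‖source μ₁ μ lam v s‖ ≤
          C * (μ * ((1 + t) ^ (growthExp μ (decayExp d μ₁) - 1) * logCorr μ t)
            + (1 + t) ^ (-decayExp d μ₁) * (stNorm v (Ici t)).toReal) := by
  have hα : 0 < decayExp d μ₁ := by
    have := dim_sub_two_pos (d := d)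
    rw [decayExp]; positivity
  obtain ⟨K, hK, hgrowth⟩ := exists_growth_bound (d := d) hμ (decayExp d μ₁)
  obtain ⟨c, hc, hforc⟩ := exists_forcing_bound (d := d) hμ hα
  have hp := one_lt_p1 (d := d)
  set p := p1 d with hpd
  set D := K * (M + M + (M : ℝ) ^ p) with hD
  have hD0 : 0 ≤ D := by positivity
  refine ⟨D * c + (M : ℝ) ^ (p - 1), by positivity, fun lam hlam v₀ v₁ v hv hM => ?_⟩
  have hst : stNorm v (Ici 0) < ⊤ := by rw [← timeInterval_top]; exact hv.strichartz
  obtain ⟨hpi, hpt⟩ := integrable_power hβ hv.continuousOn hst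
  have hst' : ∀ t, 0 ≤ t → (stNorm v (Ici t)).toReal ≤ M := fun t ht =>
    ENNReal.toReal_le_coe_of_le_coe
      (((stNorm_mono v (Ici_subset_Ici.2 ht)).trans le_add_self).trans hM)
  have hn0 : ‖v₀‖ ≤ M := by
    have h1 : ‖v₀‖ₑ ≤ (M : ℝ≥0∞) :=
      (enorm_le_h1Norm v₀).trans ((le_self_add.trans le_self_add).trans hM)
    simpa using ENNReal.toReal_le_coe_of_le_coe h1
  have hn1 : ‖v₁‖ ≤ M := by
    have h1 : ‖v₁‖ₑ ≤ (M : ℝ≥0∞) := (le_add_self.trans le_self_add).trans hM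
    simpa using ENNReal.toReal_le_coe_of_le_coe h1
  have hN : IntegrableOn (fun s => ‖power (v s)‖) (Ioi 0) :=
    (hpi.mono_set Ioi_subset_Ici_self).norm
  have hNt : ∀ t, 0 ≤ t → ∫ s in Ioi t, ‖power (v s)‖ = (stNorm v (Ici t)).toReal ^ p :=
    fun t ht => by rw [← integral_Ici_eq_integral_Ioi, hpt t ht]
  have hnf : ∀ f : L2 d, ‖(𝓕 f : L2 d)‖ = ‖f‖ := (Lp.fourierTransformₗᵢ (Space d) ℂ).norm_map
  have hV : ∀ t, 0 ≤ t → ‖(𝓕 (v t) : L2 d)‖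
      ≤ D * ((1 + t) ^ growthExp μ (decayExp d μ₁) * logCorr μ t) := by
    intro t ht
    refine (hgrowth (𝓕 v₀) (𝓕 v₁) (fun t => 𝓕 (v t)) (forcing μ₁ lam v)
      (fun s => ‖power (v s)‖) hN (fun _ => norm_nonneg _)
      (fun s hs => (norm_forcing hlam v hs).le) (fun t ht => hv.duhamel_fourier hμ ht) t ht).trans ?_
    have hL := zero_le_one.trans (one_le_logCorr μ ht)
    refine mul_le_mul_of_nonneg_right ?_ (by positivity)
    rw [hD, hnf, hnf, hNt 0 le_rfl]
    gcongr
    exact hst' 0 le_rfl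
  obtain ⟨hi, hb⟩ := hforc (fun t => 𝓕 (v t)) (forcing μ₁ lam v) (fun s => ‖power (v s)‖) D hD0
    ((Lp.fourierTransformₗᵢ (Space d) ℂ).continuous.comp_continuousOn hv.continuousOn)
    (hv.aestronglyMeasurable_forcing hβ) hN (fun _ => norm_nonneg _)
    (fun s hs => (norm_forcing hlam v hs).le) hV
  refine ⟨hi, fun t ht => (hb t ht).trans ?_⟩
  have hL := zero_le_one.trans (one_le_logCorr μ ht)
  set x := (stNorm v (Ici t)).toReal with hx
  have hx0 : 0 ≤ x := ENNReal.toReal_nonneg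
  have h1 : x ^ p ≤ (M : ℝ) ^ (p - 1) * x := by
    have e : x ^ p = x ^ (p - 1) * x := by
      rw [← Real.rpow_add_one' hx0 (by linarith), sub_add_cancel]
    rw [e]
    exact mul_le_mul_of_nonneg_right (Real.rpow_le_rpow hx0 (hst' t ht) (by linarith)) hx0
  have h2 : (0 : ℝ) ≤ (1 + t) ^ (-decayExp d μ₁) := by positivity
  have h3 : 0 ≤ μ * ((1 + t) ^ (growthExp μ (decayExp d μ₁) - 1) * logCorr μ t) := by positivity
  have h4 : (0 : ℝ) ≤ (M : ℝ) ^ (p - 1) := by positivity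
  rw [hNt t ht]
  have h5 := mul_le_mul_of_nonneg_left h1 h2
  have h6 := mul_nonneg h4 h3
  have h7 := mul_nonneg (mul_nonneg hD0 hc) (mul_nonneg h2 hx0)
  nlinarith

/-- The asymptotic states of a real-valued solution are Hermitian symmetric. -/
lemma IsSolution.hermL_asym {μ₁ μ lam : ℝ} {v₀ v₁ : L2 d} {v : ℝ → L2 d}
    (h : IsSolution μ₁ μ lam ⊤ v₀ v₁ v) (hF : IntegrableOn (source μ₁ μ lam v) (Ioi 0))
    (hreal : ∀ t, 0 ≤ t → IsRealL2 (v t)) {a0 : L2 d}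
    (ha0 : a0 =ᵐ[volume] fun ξ => (freq ξ : ℂ) * (𝓕 v₀ : L2 d) ξ) :
    hermL (asymA a0 (source μ₁ μ lam v)) = asymA a0 (source μ₁ μ lam v) ∧
      hermL (asymB (𝓕 v₁) (source μ₁ μ lam v)) = asymB (𝓕 v₁) (source μ₁ μ lam v) := by
  have hV : ∀ t, 0 ≤ t → hermL (𝓕 (v t)) = (𝓕 (v t) : L2 d) := fun t ht =>
    (isRealL2_iff_hermL _).1 (hreal t ht)
  have hsrc : ∀ s ∈ Ioi (0 : ℝ), hermL (source μ₁ μ lam v s) = source μ₁ μ lam v s := by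
    intro s hs
    have hs' : 0 ≤ s := le_of_lt hs
    have h1 := (isRealL2_iff_hermL _).1 (isRealL2_power (hreal s hs'))
    have h2 : massCoeff μ s • (𝓕 (v s) : L2 d) = (μ / (1 + s) ^ 2 : ℝ) • (𝓕 (v s) : L2 d) :=
      Complex.coe_smul _ _
    rw [source, forcing_eq, h2, map_sub, map_smul, map_smul, h1, hV s hs']
  have hv1 : hermL (𝓕 v₁) = (𝓕 v₁ : L2 d) := by
    refine (isRealL2_iff_hermL _).1 ((isRealL2_iff_conjL _).2 ?_)
    have h1 := h.initial_deriv
    rw [timeInterval_top] at h1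
    have h2 : HasDerivWithinAt (fun t => conjL (v t)) (conjL v₁) (Ici 0) 0 :=
      conjL.hasFDerivAt.comp_hasDerivWithinAt 0 h1
    have h3 := h2.congr (f₁ := v) (fun t ht => ((isRealL2_iff_conjL _).1 (hreal t ht)).symm)
      ((isRealL2_iff_conjL _).1 (hreal 0 le_rfl)).symm
    exact (uniqueDiffOn_Ici (0 : ℝ) 0 self_mem_Ici).eq_deriv _ h3 h1
  have ha : hermL a0 = a0 := by
    have h0 := hV 0 le_rfl
    rw [h.initial] at h0
    refine Lp.ext ?_
    have hq := (Measure.measurePreserving_neg (volume : Measure (Space d))).quasiMeasurePreserving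
    have h1 := hermL_ae (𝓕 v₀ : L2 d)
    rw [h0] at h1
    filter_upwards [hermL_ae a0, ha0, hq.ae ha0, h1] with ξ e1 e2 e3 e4
    rw [e1, e2, e3, map_mul, Complex.conj_ofReal, freq_neg, e4]
  have hint : ∀ m : ℝ → ℝ → ℂ, (∀ s, GoodSymbol (m s) 1) →
      (∀ r : ℝ, 0 < r → Continuous fun s => m s r) → (∀ s r, (starRingEnd ℂ) (m s r) = m s r) →
      hermL (∫ s in Ioi (0 : ℝ), mulL (m s) (source μ₁ μ lam v s))
        = ∫ s in Ioi (0 : ℝ), mulL (m s) (source μ₁ μ lam v s) := by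
    intro m hm hc hr
    rw [← hermL.integral_comp_comm (integrableOn_mulL hm hc hF)]
    refine setIntegral_congr_fun measurableSet_Ioi fun s hs => ?_
    rw [hermL_mulL (hm s) (hr s), hsrc s hs]
  constructor
  · rw [asymA, map_sub, ha, hint _ goodSymbol_sinS (fun r _ => continuous_sinS r)
      fun s r => Complex.conj_ofReal _]
  · rw [asymB, map_add, hv1, hint _ goodSymbol_cosS (fun r _ => continuous_cosS r)
      fun s r => Complex.conj_ofReal _]

/-- The rate of the theorem in terms of the growth exponent. -/
lemma growth_rate_eq {d : ℕ} (μ μ₁ t : ℝ) :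
    (1 + t) ^ (growthExp μ (decayExp d μ₁) - 1) * logCorr μ t
      = if μ = 1 / 4 then (1 + t) ^ (max (-1 / 2) (-decayExp d μ₁)) * (1 + Real.log (1 + t))
        else (1 + t) ^ (max (-1 / 2 + (order μ).re) (-decayExp d μ₁)) := by
  have e : growthExp μ (decayExp d μ₁) - 1 = max (-1 / 2 + (order μ).re) (-decayExp d μ₁) := by
    rw [growthExp, ← max_sub_sub_right]
    congr 1 <;> ring
  rw [e, logCorr]
  split_ifs with h
  · rw [h, order_quarter, Complex.zero_re, add_zero]
  · rw [mul_one]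

/-- Differentiability in time and scattering of a solution, with the forcing as the error. -/
lemma IsSolution.exists_scattering {μ₁ μ lam : ℝ} {v₀ v₁ : L2 d} {v : ℝ → L2 d} (hμ : 0 ≤ μ)
    (h : IsSolution μ₁ μ lam ⊤ v₀ v₁ v)
    (hF : IntegrableOn (source μ₁ μ lam v) (Ioi 0)) :
    ∃ vt : ℝ → L2 d, (∀ t : ℝ, 0 ≤ t → HasDerivWithinAt v (vt t) (Ici 0) t) ∧
      ∃ w : 𝓢'(Space d, ℂ) × L2 d, MemHdot w.1 ∧
        ((∀ t : ℝ, 0 ≤ t → IsRealL2 (v t)) → IsRealDist w.1 ∧ IsRealL2 w.2) ∧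
        ∀ t : ℝ, 0 ≤ t → energyNorm (((v t : 𝓢'(Space d, ℂ)), vt t) - freeWave t w)
          ≤ ENNReal.ofReal (4 * ∫ s in Ioi t, ‖source μ₁ μ lam v s‖) := by
  set F := source μ₁ μ lam v with hFd
  have hVc : ContinuousOn (fun t => (𝓕 (v t) : L2 d)) (Ici 0) :=
    (Lp.fourierTransformₗᵢ (Space d) ℂ).continuous.comp_continuousOn h.continuousOn
  have hFi : ∀ t : ℝ, 0 ≤ t → IntervalIntegrable F volume 0 t := fun t ht =>
    (intervalIntegrable_iff_integrableOn_Ioc_of_le ht).2 (hF.mono_set Ioc_subset_Ioi_self)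
  have hni : ∀ t : ℝ, 0 ≤ t → IntervalIntegrable (forcing μ₁ lam v) volume 0 t := by
    intro t ht
    have h1 : ContinuousOn (fun s => massCoeff μ s • (𝓕 (v s) : L2 d)) (uIcc 0 t) := by
      rw [uIcc_of_le ht]
      exact ((continuousOn_massCoeff μ).smul hVc).mono Icc_subset_Ici_self
    refine ((hFi t ht).add h1.intervalIntegrable).congr fun s _ => ?_
    exact sub_add_cancel _ _
  have ha := memLp_freq_of_h1Norm h.data
  set a0 : L2 d := ha.toLp _ with ha0d
  have ha0 : a0 =ᵐ[volume] fun ξ => (freq ξ : ℂ) * (𝓕 v₀ : L2 d) ξ := ha.coeFn_toLp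
  have hwave : ∀ t : ℝ, 0 ≤ t → (𝓕 (v t) : L2 d) = mulL (cosS t) (𝓕 v₀) + mulL (sincS t) (𝓕 v₁)
      + ∫ s in (0 : ℝ)..t, mulL (sincS (t - s)) (F s) := fun t ht =>
    wave_duhamel (V := fun t => 𝓕 (v t)) hμ hVc hni (fun t ht => h.duhamel_fourier hμ ht) ht
  have hB : ∀ t : ℝ, 0 ≤ t →
      HasDerivWithinAt (fun t => (𝓕 (v t) : L2 d)) (stateB a0 (𝓕 v₁) F t) (Ici 0) t := fun t ht =>
    hasDerivWithinAt_of_integral (continuousOn_stateB a0 (𝓕 v₁) hFi)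
      (fun t ht => by rw [h.initial]; exact integral_stateB ht hFi ha0 (hwave t ht)) ht
  have hinv : ∀ f : L2 d, (𝓕⁻ (𝓕 f : L2 d) : L2 d) = f := FourierTransform.fourierInv_fourier_eq
  refine ⟨fun t => 𝓕⁻ (stateB a0 (𝓕 v₁) F t), fun t ht => ?_, ?_⟩
  · have h1 := ((Lp.fourierTransformₗᵢ (Space d) ℂ).symm.toContinuousLinearEquiv
      |>.toContinuousLinearMap.restrictScalars ℝ).hasFDerivAt.comp_hasDerivWithinAt t (hB t ht)
    exact h1.congr (fun s _ => (hinv (v s)).symm) (hinv (v t)).symm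
  · obtain ⟨w, hw, hwA, hwB, hest⟩ := exists_free_state (asymA a0 F) (asymB (𝓕 v₁) F)
    refine ⟨w, hw, fun hreal => ?_, fun t ht => ?_⟩
    · obtain ⟨hA', hB'⟩ := h.hermL_asym hF hreal ha0
      refine ⟨isRealDist_of_hermitian hwA ?_, (isRealL2_iff_hermL _).2 (by rw [hwB]; exact hB')⟩
      have h1 := hermL_ae (asymA a0 F)
      rw [hA'] at h1
      filter_upwards [h1] with ξ h2
      rw [map_mul, map_inv₀, Complex.conj_ofReal, freq_neg, h2]
    · refine (hest t (v t) _ _ (stateA_ae ht (hFi t ht) ha0 (hwave t ht))).trans ?_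
      obtain ⟨h1, h2⟩ := norm_state_sub_le a0 (𝓕 v₁) hF ht
      rw [fourier_fourierInv_L2, ← ofReal_norm, ← ofReal_norm,
        ← ENNReal.ofReal_add (norm_nonneg _) (norm_nonneg _)]
      exact ENNReal.ofReal_le_ofReal (by linarith)

end NLKG

end

theorem mainTheorem2 (d : ℕ) (hd3 : 3 ≤ d) (hd5 : d ≤ 5) (μ₁ μ : ℝ) (hμ₁ : 0 < μ₁) (hμ : 0 ≤ μ)
    (M : ℝ≥0) :
    ∃ C : ℝ, ∀ (lam : ℝ), (lam = 1 ∨ lam = -1) →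
      ∀ (v₀ v₁ : NLKG.L2 d) (v : ℝ → NLKG.L2 d),
        NLKG.IsSolution μ₁ μ lam ⊤ v₀ v₁ v →
        NLKG.h1Norm v₀ + ‖v₁‖ₑ + NLKG.stNorm v (Ici 0) ≤ (M : ℝ≥0∞) →
        Tendsto (fun t : ℝ => NLKG.stNorm v (Ici t)) atTop (𝓝 0) ∧
        ∃ vt : ℝ → NLKG.L2 d,
          (∀ t : ℝ, 0 ≤ t → HasDerivWithinAt v (vt t) (Ici 0) t) ∧
          ∃ vplus : 𝓢'(NLKG.Space d, ℂ) × NLKG.L2 d,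
            NLKG.MemHdot vplus.1 ∧
            ((∀ t : ℝ, 0 ≤ t → NLKG.IsRealL2 (v t)) →
              NLKG.IsRealDist vplus.1 ∧ NLKG.IsRealL2 vplus.2) ∧
            ∀ t : ℝ, 0 ≤ t →
              NLKG.energyNorm
                  (((v t : 𝓢'(NLKG.Space d, ℂ)), vt t) - NLKG.freeWave t vplus) ≤
                ENNReal.ofReal (C *
                  (μ * (if μ = 1 / 4 then
                          (1 + t) ^ (max (-1 / 2) (-NLKG.decayExp d μ₁))
                            * (1 + Real.log (1 + t))
                        else
                          (1 + t) ^ (max (-1 / 2 + (NLKG.order μ).re) (-NLKG.decayExp d μ₁)))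
                    + (1 + t) ^ (-NLKG.decayExp d μ₁)
                      * (NLKG.stNorm v (Ici t)).toReal)) := by
  have : Fact (3 ≤ d) := ⟨hd3⟩
  have hβ : 1 ≤ 4 / ((d : ℝ) - 2) := by
    have h3 : (3 : ℝ) ≤ d := by exact_mod_cast hd3
    have h5 : (d : ℝ) ≤ 5 := by exact_mod_cast hd5
    rw [le_div_iff₀ (by linarith)]
    linarith
  obtain ⟨C, -, hC⟩ := NLKG.exists_source_bound (d := d) hμ₁ hμ hβ M
  refine ⟨4 * C, fun lam hlam v₀ v₁ v hv hM => ?_⟩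
  have hst : NLKG.stNorm v (Ici 0) < ⊤ := by
    rw [← NLKG.timeInterval_top]; exact hv.strichartz
  obtain ⟨hF, hbound⟩ := hC lam hlam v₀ v₁ v hv hM
  obtain ⟨vt, hvt, w, hw, hreal, hest⟩ := hv.exists_scattering hμ hF
  refine ⟨NLKG.tendsto_stNorm hβ hv.continuousOn hst, vt, hvt, w, hw, hreal, fun t ht => ?_⟩
  refine (hest t ht).trans (ENNReal.ofReal_le_ofReal ?_)
  rw [← NLKG.growth_rate_eq, mul_assoc]
  exact mul_le_mul_of_nonneg_left (hbound t ht) (by norm_num)
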